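/- Let $-\infty\le\ell_-<0<\ell_+\le\infty$, $\Omega_0=(\ell_-,\ell_+)$, $\alpha>0$, $0<\beta<\tfrac12$, $\gamma>0$, and let $\varepsilon_0>0$ satisfy $\varepsilon_0<\min\{(2\gamma)^{-1/\alpha},|\ell_-|,\ell_+\}$, $\varepsilon_0<\gamma^{-1/(\alpha+1-\beta)}$ and $\varepsilon_0<\min\{\gamma,\gamma^{-1}\}$. For $\varepsilon\in(0,\varepsilon_0]$ put $d_\varepsilon=\gamma\varepsilon^{\alpha+1}$, $h_\varepsilon=\varepsilon^\alpha$, $b_\varepsilon=\varepsilon^\beta$, $$S_\varepsilon=\Omega_0\times(-\varepsilon,0),\quad P_\varepsilon=\{|x_1|<\tfrac{d_\varepsilon}2,\ 0<x_2<h_\varepsilon\},\quad R_\varepsilon=\{|x_1|<\tfrac{b_\varepsilon}2,\ h_\varepsilon<x_2<h_\varepsilon+b_\varepsilon\},$$ and let $\Omega_\varepsilon$ be the interior of $\overline{S_\varepsilon\cup P_\varepsilon\cup R_\varepsilon}$. Let $V_0\in L^\infty(\Omega_0)$ be real-valued with $V_0\ge0$, and let $V_\varepsilon(x)=V_0(x_1)$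 on $S_\varepsilon$ and $V_\varepsilon=0$ on $P_\varepsilon\cup R_\varepsilon$. In $\mathcal H_\varepsilon=L^2(\Omega_\varepsilon)$ and in the Hilbert space $\mathcal H_0=L^2(\Omega_0)\oplus\mathbb C$ consider the forms $$a_\varepsilon[u,v]=\int_{\Omega_\varepsilon}\bigl(\nabla u\cdot\overline{\nabla v}+V_\varepsilon u\overline v\bigr)\,dx,\qquad \operatorname{dom}a_\varepsilon=H^1(\Omega_\varepsilon),$$ $$a_0[f,g]=\int_{\Omega_0}\bigl(f_1'\overline{g_1'}+V_0f_1\overline{g_1}\bigr)\,dx+\gamma f_1(0)\overline{g_1(0)},\qquad \operatorname{dom}a_0=H^1(\Omega_0)\times\mathbb C,$$ the associated non-negative self-adjoint operators $\mathcal A_\varepsilon$, $\mathcal A_0$, their resolvents $\mathcal R_\varepsilon=(\mathcal A_\varepsilon+I)^{-1}$, $\mathcal R_0=(\mathcal A_0+I)^{-1}$, and the energy norms $\|u\|_{\mathcal H^1_\varepsilon}=(a_\varepsilon[u,u]+\|u\|^2_{\mathcal H_\varepsilon})^{1/2}$, $\|f\|_{\mathcal H^1_0}=(a_0[f,f]+\|f\|^2_{\mathcal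 H_0})^{1/2}$. Define $J_\varepsilon:\mathcal H_0\to\mathcal H_\varepsilon$ by $J_\varepsilon f=\varepsilon^{-1/2}f_1(x_1)$ on $S_\varepsilon$, $0$ on $P_\varepsilon$, $b_\varepsilon^{-1}f_2$ on $R_\varepsilon$, and $\widetilde J_\varepsilon:\mathcal H_\varepsilon\to\mathcal H_0$ by $$\widetilde J_\varepsilon u=\Bigl(\varepsilon^{-1/2}\int_{-\varepsilon}^0u(\cdot,x_2)\,dx_2,\ b_\varepsilon^{-1}\int_{R_\varepsilon}u\,dx\Bigr).$$ Then there is a constant $C_{18}>0$, independent of $\varepsilon$ and of $V_0$, such that for all $\varepsilon\in(0,\varepsilon_0]$ one has $\widetilde J_\varepsilon J_\varepsilon f=f$ for all $f\in\mathcal H_0$ and $$\|u-J_\varepsilon\widetilde J_\varepsilon u\|_{\mathcal H_\varepsilon}\le C_{18}\,\varepsilon^{\min\{\alpha,\beta\}}\|u\|_{\mathcal H^1_\varepsilon}\qquad\text{for all }u\in H^1(\Omega_\varepsilon).$$ Moreover, there is a constant $C>0$ independent of $\varepsilon$ such that for all $\varepsilon\in(0,\varepsilon_0]$ the operators $\mathcal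 A_0$ and $\mathcal A_\varepsilon$ are $\delta_\varepsilon$-quasi-unitarily equivalent with $\delta_\varepsilon=C\varepsilon^{\min\{\alpha,\beta,1/2-\beta\}}$, which tends to $0$ as $\varepsilon\to0$; that is, $$\|f-\widetilde J_\varepsilon J_\varepsilon f\|\le\delta_\varepsilon\|f\|_{\mathcal H_0^1}\ (f\in\operatorname{dom}a_0),\quad \|u-J_\varepsilon\widetilde J_\varepsilon u\|\le\delta_\varepsilon\|u\|_{\mathcal H^1_\varepsilon}\ (u\in\operatorname{dom}a_\varepsilon),$$ $$|(J_\varepsilon f,u)-(f,\widetilde J_\varepsilon u)|\le\delta_\varepsilon\|f\|\|u\|\ (f\in\mathcal H_0,\ u\in\mathcal H_\varepsilon),$$ $$\|\mathcal R_\varepsilon J_\varepsilon-J_\varepsilon\mathcal R_0\|\le\delta_\varepsilon,\qquad \|\widetilde J_\varepsilon\mathcal R_\varepsilon-\mathcal R_0\widetilde J_\varepsilon\|\le\delta_\varepsilon.$$ In particular $\mathcal A_\varepsilon$ converges to $\mathcal A_0$ in the generalised norm resolvent sense. -/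

import Mathlib

open MeasureTheory Set Filter Topology
open scoped ENNReal

noncomputable section

namespace Waveguide

/-! ### Weak derivatives and the space `H¹` -/

open scoped ContDiff in
/-- `g` is the weak derivative of `u` in the direction `v` on the open set `U`:
`∫_U u ∂_v φ = - ∫_U g φ` for all test functions `φ ∈ C_c^∞(U)`. -/
def HasWeakDeriv {E : Type*} [NormedAddCommGroup E] [NormedSpace ℝ E] [MeasureSpace E]
    (U : Set E) (v : E) (u g : E → ℂ) : Prop :=
  ∀ φ : E → ℝ, ContDiff ℝ ∞ φ → HasCompactSupport φ → tsupport φ ⊆ U →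
    ∫ x in U, ((fderiv ℝ φ x v : ℝ) : ℂ) * u x = - ∫ x in U, ((φ x : ℝ) : ℂ) * g x

/-- The complex Hilbert space `L²(U)` with respect to Lebesgue measure. -/
abbrev L2 {E : Type*} [MeasureSpace E] (U : Set E) : Type _ :=
  Lp ℂ 2 ((volume : Measure E).restrict U)

/-- `u ∈ L²(U)` has a weak derivative in direction `v` that belongs to `L²(U)`. -/
def HasL2WeakDeriv {E : Type*} [NormedAddCommGroup E] [NormedSpace ℝ E] [MeasureSpace E]
    (U : Set E) (v : E) (u : L2 U) : Prop :=
  ∃ g : L2 U, HasWeakDeriv U v u g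

open Classical in
/-- The weak derivative `∂_v u ∈ L²(U)` (only used where it exists; it is then unique). -/
def weakDeriv {E : Type*} [NormedAddCommGroup E] [NormedSpace ℝ E] [MeasureSpace E]
    (U : Set E) (v : E) (u : L2 U) : L2 U :=
  if h : HasL2WeakDeriv U v u then h.choose else 0

/-- `H¹(U)` for an open set `U ⊆ ℝ`. -/
def H1Line (U : Set ℝ) : Set (L2 U) := {u | HasL2WeakDeriv U 1 u}

/-- `H¹(U)` for an open set `U ⊆ ℝ²`. -/
def H1Plane (U : Set (ℝ × ℝ)) : Set (L2 U) :=
  {u | HasL2WeakDeriv U (1, 0) u ∧ HasL2WeakDeriv U (0, 1) u}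

open Classical in
/-- The value at the point `x` of the representative of `f` that is continuous on `U`
(only used where such a representative exists and `x ∈ U`, `U` open). -/
def pointValue (U : Set ℝ) (f : L2 U) (x : ℝ) : ℂ :=
  if h : ∃ g : ℝ → ℂ, ContinuousOn g U ∧ f =ᵐ[volume.restrict U] g then h.choose x else 0

/-! ### Sesquilinear forms, associated operators, quasi-unitary equivalence -/

/-- A form in `H` with its domain; `form u v` is linear in `u` and antilinear in `v` for the forms
considered below. -/
structure HForm (H : Type*) where
  dom : Set H
  form : H → H → ℂ

section Abstract

variable {H K : Type*} [NormedAddCommGroup H] [InnerProductSpace ℂ H]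
  [NormedAddCommGroup K] [InnerProductSpace ℂ K]

/-- The energy norm `‖u‖_{H¹} = (a[u,u] + ‖u‖²)^{1/2}` of a form. -/
def HForm.energyNorm (a : HForm H) (u : H) : ℝ :=
  Real.sqrt ((a.form u u).re + ‖u‖ ^ 2)

/-- The graph of the operator `A` associated with the form `a`: `u ∈ dom A` and `A u = w` iff
`u ∈ dom a` and `(w, v) = a[u, v]` for all `v ∈ dom a`.
(Mathlib's inner product is antilinear in its first argument, so `(w, v)` is `inner ℂ v w`.) -/
def HForm.OperatorEq (a : HForm H) (u w : H) : Prop :=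
  u ∈ a.dom ∧ ∀ v ∈ a.dom, inner ℂ v w = a.form u v

/-- The bounded operator `R` is the resolvent `(A + I)⁻¹` of the operator associated with `a`:
`R g = u` iff `u ∈ dom A` and `A u + u = g`. -/
def HForm.IsResolvent (a : HForm H) (R : H →L[ℂ] H) : Prop :=
  ∀ g u : H, R g = u ↔ a.OperatorEq u (g - u)

/-- `J` and `J'` are `δ`-quasi-unitary with respect to the forms `a` in `H` and `b` in `K`. -/
structure IsQuasiUnitary (a : HForm H) (b : HForm K) (J : H →L[ℂ] K) (J' : K →L[ℂ] H)
    (δ : ℝ) : Prop where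
  left : ∀ f ∈ a.dom, ‖f - J' (J f)‖ ≤ δ * a.energyNorm f
  right : ∀ u ∈ b.dom, ‖u - J (J' u)‖ ≤ δ * b.energyNorm u
  almost_adjoint : ∀ (f : H) (u : K), ‖inner ℂ u (J f) - inner ℂ (J' u) f‖ ≤ δ * ‖f‖ * ‖u‖

/-- The operators associated with the forms `a` and `b` are `δ`-quasi-unitarily equivalent through
the identification operators `J` and `J'`. The existence of the resolvents (which are unique)
is part of the assertion. -/
def QuasiUnitarilyEquivalent (a : HForm H) (b : HForm K) (J : H →L[ℂ] K) (J' : K →L[ℂ] H)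
    (δ : ℝ) : Prop :=
  0 ≤ δ ∧ IsQuasiUnitary a b J J' δ ∧
    ∃ (Ra : H →L[ℂ] H) (Rb : K →L[ℂ] K), a.IsResolvent Ra ∧ b.IsResolvent Rb ∧
      ‖Rb ∘L J - J ∘L Ra‖ ≤ δ ∧ ‖J' ∘L Rb - Ra ∘L J'‖ ≤ δ

end Abstract

/-! ### The waveguide with a passage and a room -/

/-- The parameters of the model. -/
structure Params where
  lm : EReal
  lp : EReal
  α : ℝ
  β : ℝ
  γ : ℝ
  lm_neg : lm < 0
  lp_pos : 0 < lp
  α_pos : 0 < α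
  β_pos : 0 < β
  β_lt : β < 1 / 2
  γ_pos : 0 < γ

namespace Params

variable (p : Params) (ε : ℝ)

/-- The interval `Ω₀ = (ℓ₋, ℓ₊)`, possibly unbounded. -/
def Omega0 : Set ℝ := {x | p.lm < (x : EReal) ∧ (x : EReal) < p.lp}

/-- Width of the passage. -/
def d : ℝ := p.γ * ε ^ (p.α + 1)

/-- Height of the passage. -/
def h : ℝ := ε ^ p.α

/-- Side length of the room. -/
def b : ℝ := ε ^ p.β

/-- The upper bound `ε₀` for the small parameter is admissible. -/
structure Admissible (ε₀ : ℝ) : Prop where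
  pos : 0 < ε₀
  lt_one : ε₀ < (2 * p.γ) ^ (-1 / p.α)
  lt_left : (ε₀ : EReal) < -p.lm
  lt_right : (ε₀ : EReal) < p.lp
  lt_two : ε₀ < p.γ ^ (-1 / (p.α + 1 - p.β))
  lt_three : ε₀ < min p.γ p.γ⁻¹

/-- The straight strip `S_ε`. -/
def strip : Set (ℝ × ℝ) := p.Omega0 ×ˢ Ioo (-ε) 0

/-- The passage `P_ε`. -/
def passage : Set (ℝ × ℝ) := {x | |x.1| < p.d ε / 2 ∧ x.2 ∈ Ioo 0 (p.h ε)}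

/-- The room `R_ε`. -/
def room : Set (ℝ × ℝ) := {x | |x.1| < p.b ε / 2 ∧ x.2 ∈ Ioo (p.h ε) (p.h ε + p.b ε)}

/-- The domain `Ω_ε`. -/
def Omega : Set (ℝ × ℝ) := interior (closure (p.strip ε ∪ p.passage ε ∪ p.room ε))

/-- `H_ε = L²(Ω_ε)`. -/
abbrev HEps : Type := L2 (p.Omega ε)

/-- `H₀ = L²(Ω₀) ⊕ ℂ`, the Hilbert space direct sum. -/
abbrev HZero : Type := WithLp 2 (L2 p.Omega0 × ℂ)

open Classical in
/-- The potential `V_ε`. -/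
def potential (V₀ : ℝ → ℝ) (x : ℝ × ℝ) : ℝ := if x ∈ p.strip ε then V₀ x.1 else 0

/-- The form `a_ε`. -/
def formEps (V₀ : ℝ → ℝ) : HForm (p.HEps ε) where
  dom := H1Plane (p.Omega ε)
  form u v := ∫ x in p.Omega ε,
    (weakDeriv (p.Omega ε) (1, 0) u x * star (weakDeriv (p.Omega ε) (1, 0) v x)
      + weakDeriv (p.Omega ε) (0, 1) u x * star (weakDeriv (p.Omega ε) (0, 1) v x)
      + (p.potential ε V₀ x : ℂ) * u x * star (v x))

/-- The form `a₀`. -/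
def formZero (V₀ : ℝ → ℝ) : HForm p.HZero where
  dom := {f | f.fst ∈ H1Line p.Omega0}
  form f g := (∫ x in p.Omega0,
      (weakDeriv p.Omega0 1 f.fst x * star (weakDeriv p.Omega0 1 g.fst x)
        + (V₀ x : ℂ) * f.fst x * star (g.fst x)))
    + (p.γ : ℂ) * pointValue p.Omega0 f.fst 0 * star (pointValue p.Omega0 g.fst 0)

/-! ### Elementary facts needed to define the identification operators -/

theorem isOpen_Omega0 : IsOpen p.Omega0 :=
  (isOpen_lt continuous_const continuous_coe_real_ereal).inter
    (isOpen_lt continuous_coe_real_ereal continuous_const)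

theorem isOpen_strip : IsOpen (p.strip ε) := p.isOpen_Omega0.prod isOpen_Ioo

theorem isOpen_passage : IsOpen (p.passage ε) :=
  (isOpen_lt (continuous_abs.comp continuous_fst) continuous_const).inter
    (isOpen_Ioo.preimage continuous_snd)

theorem isOpen_room : IsOpen (p.room ε) :=
  (isOpen_lt (continuous_abs.comp continuous_fst) continuous_const).inter
    (isOpen_Ioo.preimage continuous_snd)

theorem strip_subset : p.strip ε ⊆ p.Omega ε :=
  interior_maximal (fun _ hx => subset_closure (Or.inl (Or.inl hx))) (p.isOpen_strip ε)

theorem room_subset : p.room ε ⊆ p.Omega ε :=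
  interior_maximal (fun _ hx => subset_closure (Or.inr hx)) (p.isOpen_room ε)

theorem volume_room_ne_top : (volume.restrict (p.Omega ε)) (p.room ε) ≠ ∞ := by
  refine ne_top_of_le_ne_top ?_ (Measure.restrict_apply_le _ _)
  have hsub : p.room ε ⊆ Icc (-(p.b ε / 2)) (p.b ε / 2) ×ˢ Icc (p.h ε) (p.h ε + p.b ε) := by
    rintro x ⟨h1, h2⟩
    exact ⟨⟨(abs_lt.1 h1).1.le, (abs_lt.1 h1).2.le⟩, ⟨h2.1.le, h2.2.le⟩⟩
  exact ne_top_of_le_ne_top (isCompact_Icc.prod isCompact_Icc).measure_lt_top.ne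
    (measure_mono hsub)

theorem restrict_strip : (volume : Measure (ℝ × ℝ)).restrict (p.strip ε)
    = (volume.restrict p.Omega0).prod (volume.restrict (Ioo (-ε) 0)) := by
  rw [strip, Measure.volume_eq_prod, Measure.prod_restrict]

theorem restrict_strip' : ((volume : Measure (ℝ × ℝ)).restrict (p.Omega ε)).restrict (p.strip ε)
    = (volume.restrict p.Omega0).prod (volume.restrict (Ioo (-ε) 0)) := by
  rw [Measure.restrict_restrict_of_subset (p.strip_subset ε), restrict_strip]

end Params

section Product

variable {X Y : Type*} [MeasurableSpace X] [MeasurableSpace Y] {μ : Measure X} {ν : Measure Y}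
  [IsFiniteMeasure ν] {u : X × Y → ℂ}

theorem eLpNorm_two_sq {Z : Type*} [MeasurableSpace Z] (m : Measure Z) (w : Z → ℂ) :
    eLpNorm w 2 m ^ 2 = ∫⁻ z, ‖w z‖ₑ ^ 2 ∂m := by
  have := eLpNorm_nnreal_pow_eq_lintegral (μ := m) (f := w) (p := 2) (by norm_num)
  simpa using this

theorem ae_memLp_section (hu : MemLp u 2 (μ.prod ν)) :
    ∀ᵐ x ∂μ, MemLp (fun y => u (x, y)) 2 ν := by
  have hfin : ∫⁻ z, ‖u z‖ₑ ^ 2 ∂(μ.prod ν) < ∞ := by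
    rw [← eLpNorm_two_sq]
    exact ENNReal.pow_lt_top hu.2
  have hm : AEMeasurable (fun z => ‖u z‖ₑ ^ 2) (μ.prod ν) := hu.1.enorm.pow_const 2
  rw [lintegral_prod _ hm] at hfin
  filter_upwards [ae_lt_top' hm.lintegral_prod_right' hfin.ne, hu.1.prodMk_left] with x hx hx'
  refine ⟨hx', ?_⟩
  rw [← eLpNorm_two_sq] at hx
  exact lt_of_not_ge fun h => by simp [top_le_iff.1 h] at hx

theorem eLpNorm_section_integral_le (hu : MemLp u 2 (μ.prod ν)) :
    eLpNorm (fun x => ∫ y, u (x, y) ∂ν) 2 μ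
      ≤ ν univ ^ (1 / 2 : ℝ) * eLpNorm u 2 (μ.prod ν) := by
  have hm : AEMeasurable (fun z => ‖u z‖ₑ ^ 2) (μ.prod ν) := hu.1.enorm.pow_const 2
  rw [← ENNReal.pow_le_pow_left_iff (n := 2) (by norm_num), mul_pow, eLpNorm_two_sq,
    eLpNorm_two_sq, lintegral_prod _ hm, ← lintegral_const_mul'' _ hm.lintegral_prod_right']
  refine lintegral_mono_ae ?_
  filter_upwards [ae_memLp_section hu] with x hx
  have h1 : ‖∫ y, u (x, y) ∂ν‖ₑ ≤ eLpNorm (fun y => u (x, y)) 1 ν := by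
    rw [eLpNorm_one_eq_lintegral_enorm]
    exact enorm_integral_le_lintegral_enorm _
  have h2 := eLpNorm_le_eLpNorm_mul_rpow_measure_univ (p := 1) (q := 2) (by norm_num) hx.1
  have h3 : (1 : ℝ≥0∞).toReal⁻¹ = 1 := by simp
  have h4 := h1.trans h2
  rw [← eLpNorm_two_sq, ← mul_pow]
  refine pow_le_pow_left₀ zero_le (h4.trans_eq ?_) 2
  rw [mul_comm]
  norm_num

end Product

namespace Params

variable (p : Params) (ε : ℝ)

theorem memLp_on_strip (u : p.HEps ε) :
    MemLp u 2 ((volume.restrict p.Omega0).prod (volume.restrict (Ioo (-ε) 0))) := by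
  rw [← p.restrict_strip' ε]
  exact (Lp.memLp u).restrict _

theorem memLp_stripMean (u : p.HEps ε) :
    MemLp (fun x₁ : ℝ => ∫ x₂ in Ioo (-ε) 0, u (x₁, x₂)) 2 (volume.restrict p.Omega0) :=
  ⟨(p.memLp_on_strip ε u).1.integral_prod_right',
    (eLpNorm_section_integral_le (p.memLp_on_strip ε u)).trans_lt
      (ENNReal.mul_lt_top (ENNReal.rpow_lt_top_of_nonneg (by norm_num) (measure_ne_top _ _))
        (p.memLp_on_strip ε u).2)⟩

theorem ae_strip {q : ℝ × ℝ → Prop} (hq : ∀ᵐ x ∂volume.restrict (p.Omega ε), q x) :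
    ∀ᵐ x₁ ∂volume.restrict p.Omega0, ∀ᵐ x₂ ∂volume.restrict (Ioo (-ε) 0), q (x₁, x₂) := by
  refine Measure.ae_ae_of_ae_prod ?_
  rw [← p.restrict_strip' ε]
  exact ae_restrict_of_ae hq

/-- `u ↦ ∫_{-ε}^0 u(·, x₂) dx₂` as a bounded operator `L²(Ω_ε) → L²(Ω₀)`. -/
def stripIntegral : p.HEps ε →L[ℂ] L2 p.Omega0 :=
  LinearMap.mkContinuous
    { toFun := fun u => (p.memLp_stripMean ε u).toLp
        (fun x₁ : ℝ => ∫ x₂ in Ioo (-ε) 0, u (x₁, x₂))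
      map_add' := fun u v => by
        rw [← MemLp.toLp_add, MemLp.toLp_eq_toLp_iff]
        filter_upwards [p.ae_strip ε (Lp.coeFn_add u v), ae_memLp_section (p.memLp_on_strip ε u),
          ae_memLp_section (p.memLp_on_strip ε v)] with x hx hu hv
        rw [integral_congr_ae hx]
        exact integral_add (hu.integrable (by norm_num)) (hv.integrable (by norm_num))
      map_smul' := fun c u => by
        rw [RingHom.id_apply, ← MemLp.toLp_const_smul, MemLp.toLp_eq_toLp_iff]
        filter_upwards [p.ae_strip ε (Lp.coeFn_smul c u)] with x hx
        rw [integral_congr_ae hx]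
        exact integral_smul c _ }
    (((volume.restrict (Ioo (-ε) 0)) univ ^ (1 / 2 : ℝ)).toReal) (fun u => by
      simp only [LinearMap.coe_mk, AddHom.coe_mk]
      rw [Lp.norm_toLp, Lp.norm_def]
      rw [← ENNReal.toReal_mul]
      have hfin : (volume.restrict (Ioo (-ε) 0)) univ ^ (1 / 2 : ℝ) ≠ ∞ :=
        (ENNReal.rpow_lt_top_of_nonneg (by norm_num) (measure_ne_top _ _)).ne
      refine ENNReal.toReal_mono (ENNReal.mul_ne_top hfin (Lp.eLpNorm_ne_top u)) ?_
      refine (eLpNorm_section_integral_le (p.memLp_on_strip ε u)).trans ?_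
      refine mul_le_mul' le_rfl ?_
      rw [← p.restrict_strip' ε]
      exact eLpNorm_mono_measure _ Measure.restrict_le_self)

theorem memLp_stripLift (f : L2 p.Omega0) :
    MemLp ((p.strip ε).indicator fun x => f x.1) 2 (volume.restrict (p.Omega ε)) := by
  rw [memLp_indicator_iff_restrict (p.isOpen_strip ε).measurableSet, p.restrict_strip' ε]
  exact (Lp.memLp f).comp_fst _

/-- `f ↦ f(x₁) 1_{S_ε}(x)` as a bounded operator `L²(Ω₀) → L²(Ω_ε)`. -/
def stripLift : L2 p.Omega0 →L[ℂ] p.HEps ε :=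
  LinearMap.mkContinuous
    { toFun := fun f => (p.memLp_stripLift ε f).toLp
        ((p.strip ε).indicator fun x => f x.1)
      map_add' := fun f g => by
        rw [← MemLp.toLp_add, MemLp.toLp_eq_toLp_iff]
        have h : ∀ᵐ x ∂(volume.restrict (p.Omega ε)).restrict (p.strip ε),
            (f + g : L2 p.Omega0) x.1 = f x.1 + g x.1 := by
          rw [p.restrict_strip' ε]
          exact Measure.quasiMeasurePreserving_fst.ae (Lp.coeFn_add f g)
        filter_upwards [ae_imp_of_ae_restrict h] with x hx
        by_cases hxs : x ∈ p.strip ε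
        · simp only [Pi.add_apply, indicator_of_mem hxs]
          exact hx hxs
        · simp [hxs]
      map_smul' := fun c f => by
        rw [RingHom.id_apply, ← MemLp.toLp_const_smul, MemLp.toLp_eq_toLp_iff]
        have h : ∀ᵐ x ∂(volume.restrict (p.Omega ε)).restrict (p.strip ε),
            (c • f : L2 p.Omega0) x.1 = c • f x.1 := by
          rw [p.restrict_strip' ε]
          exact Measure.quasiMeasurePreserving_fst.ae (Lp.coeFn_smul c f)
        filter_upwards [ae_imp_of_ae_restrict h] with x hx
        by_cases hxs : x ∈ p.strip ε
        · simp [hxs, hx hxs]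
        · simp [hxs] }
    (((volume.restrict (Ioo (-ε) 0)) univ ^ (1 / 2 : ℝ)).toReal) (fun f => by
      simp only [LinearMap.coe_mk, AddHom.coe_mk]
      rw [Lp.norm_toLp, Lp.norm_def]
      rw [← ENNReal.toReal_mul,
        eLpNorm_indicator_eq_eLpNorm_restrict (p.isOpen_strip ε).measurableSet,
        p.restrict_strip' ε]
      have hfin : (volume.restrict (Ioo (-ε) 0)) univ ^ (1 / 2 : ℝ) ≠ ∞ :=
        (ENNReal.rpow_lt_top_of_nonneg (by norm_num) (measure_ne_top _ _)).ne
      refine ENNReal.toReal_mono (ENNReal.mul_ne_top hfin (Lp.eLpNorm_ne_top f)) ?_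
      have h := eLpNorm_map_measure (p := 2) (g := (f : ℝ → ℂ)) (f := Prod.fst)
        (μ := (volume.restrict p.Omega0).prod (volume.restrict (Ioo (-ε) 0)))
        (by
          rw [Measure.map_fst_prod]
          exact (Lp.aestronglyMeasurable f).smul_measure _) measurable_fst.aemeasurable
      rw [Measure.map_fst_prod, eLpNorm_smul_measure_of_ne_top (by norm_num)] at h
      exact le_of_eq (by simpa [Function.comp_def] using h.symm))

/-- `u ↦ ∫_{R_ε} u` as a bounded functional on `L²(Ω_ε)`. -/
def roomIntegral : p.HEps ε →L[ℂ] ℂ :=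
  innerSL ℂ (indicatorConstLp 2 (p.isOpen_room ε).measurableSet (p.volume_room_ne_top ε) (1 : ℂ))

theorem roomIntegral_apply (u : p.HEps ε) : p.roomIntegral ε u = ∫ x in p.room ε, u x := by
  rw [roomIntegral, innerSL_apply_apply, L2.inner_indicatorConstLp_one,
    Measure.restrict_restrict_of_subset (p.room_subset ε)]

/-- `c ↦ c 1_{R_ε}` as a bounded operator `ℂ → L²(Ω_ε)`. -/
def roomConst : ℂ →L[ℂ] p.HEps ε :=
  ContinuousLinearMap.toSpanSingleton ℂ
    (indicatorConstLp 2 (p.isOpen_room ε).measurableSet (p.volume_room_ne_top ε) (1 : ℂ))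

/-! ### The identification operators -/

/-- `J_ε : H₀ → H_ε`, equal to `ε^{-1/2} f₁(x₁)` on the strip, to `0` on the passage and to
`b_ε⁻¹ f₂` on the room. -/
def J : p.HZero →L[ℂ] p.HEps ε :=
  ((ε ^ (-1 / 2 : ℝ) : ℝ) : ℂ) • (p.stripLift ε ∘L WithLp.fstL 2 ℂ (L2 p.Omega0) ℂ)
    + (((p.b ε)⁻¹ : ℝ) : ℂ) • (p.roomConst ε ∘L WithLp.sndL 2 ℂ (L2 p.Omega0) ℂ)

/-- `J̃_ε : H_ε → H₀`, with components `ε^{-1/2} ∫_{-ε}^0 u(·, x₂) dx₂` and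
`b_ε⁻¹ ∫_{R_ε} u`. -/
def Jtilde : p.HEps ε →L[ℂ] p.HZero :=
  ((WithLp.prodContinuousLinearEquiv 2 ℂ (L2 p.Omega0) ℂ).symm :
      (L2 p.Omega0 × ℂ) →L[ℂ] p.HZero) ∘L
    ((((ε ^ (-1 / 2 : ℝ) : ℝ) : ℂ) • p.stripIntegral ε).prod
      ((((p.b ε)⁻¹ : ℝ) : ℂ) • p.roomIntegral ε))

open Classical in
theorem J_apply_ae (f : p.HZero) : p.J ε f =ᵐ[volume.restrict (p.Omega ε)] fun x =>
    if x ∈ p.strip ε then ((ε ^ (-1 / 2 : ℝ) : ℝ) : ℂ) * f.fst x.1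
    else if x ∈ p.room ε then (((p.b ε)⁻¹ : ℝ) : ℂ) * f.snd else 0 := by
  have hdisj : ∀ x, x ∈ p.strip ε → x ∉ p.room ε := by
    rintro x ⟨-, h1⟩ ⟨h2, h3⟩
    have hh : p.h ε < 0 := h3.1.trans h1.2
    have hε : -ε < 0 := h1.1.trans h1.2
    exact absurd hh (not_lt.2 (Real.rpow_nonneg (by linarith) _))
  have e : p.J ε f = ((ε ^ (-1 / 2 : ℝ) : ℝ) : ℂ) • p.stripLift ε f.fst
      + (((p.b ε)⁻¹ : ℝ) : ℂ) • (f.snd • indicatorConstLp 2 (p.isOpen_room ε).measurableSet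
        (p.volume_room_ne_top ε) (1 : ℂ)) := rfl
  rw [e]
  have e1 : p.stripLift ε f.fst =ᵐ[volume.restrict (p.Omega ε)]
      (p.strip ε).indicator fun x => f.fst x.1 := (p.memLp_stripLift ε f.fst).coeFn_toLp
  have e2 := indicatorConstLp_coeFn (p := 2) (hs := (p.isOpen_room ε).measurableSet)
    (hμs := p.volume_room_ne_top ε) (c := (1 : ℂ))
  refine (Lp.coeFn_add _ _).trans ?_
  filter_upwards [e1, e2, Lp.coeFn_smul ((ε ^ (-1 / 2 : ℝ) : ℝ) : ℂ) (p.stripLift ε f.fst),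
    Lp.coeFn_smul (((p.b ε)⁻¹ : ℝ) : ℂ) (f.snd • indicatorConstLp 2
      (p.isOpen_room ε).measurableSet (p.volume_room_ne_top ε) (1 : ℂ)),
    Lp.coeFn_smul f.snd (indicatorConstLp 2
      (p.isOpen_room ε).measurableSet (p.volume_room_ne_top ε) (1 : ℂ))] with x h1 h2 h3 h4 h5
  rw [Pi.add_apply, h3, h4, Pi.smul_apply, Pi.smul_apply, h5, Pi.smul_apply, h1, h2]
  by_cases hs : x ∈ p.strip ε
  · simp [hs, hdisj x hs]
  · by_cases hr : x ∈ p.room ε <;> simp [hs, hr]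

theorem Jtilde_fst_ae (u : p.HEps ε) : (p.Jtilde ε u).fst =ᵐ[volume.restrict p.Omega0]
    fun x₁ => ((ε ^ (-1 / 2 : ℝ) : ℝ) : ℂ) * ∫ x₂ in Ioo (-ε) 0, u (x₁, x₂) := by
  have e : (p.Jtilde ε u).fst = ((ε ^ (-1 / 2 : ℝ) : ℝ) : ℂ) • p.stripIntegral ε u := rfl
  rw [e]
  have e1 : p.stripIntegral ε u =ᵐ[volume.restrict p.Omega0]
      fun x₁ : ℝ => ∫ x₂ in Ioo (-ε) 0, u (x₁, x₂) := (p.memLp_stripMean ε u).coeFn_toLp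
  filter_upwards [Lp.coeFn_smul ((ε ^ (-1 / 2 : ℝ) : ℝ) : ℂ) (p.stripIntegral ε u), e1]
    with x h1 h2
  rw [h1, Pi.smul_apply, h2, smul_eq_mul]

theorem Jtilde_snd (u : p.HEps ε) :
    (p.Jtilde ε u).snd = (((p.b ε)⁻¹ : ℝ) : ℂ) * ∫ x in p.room ε, u x := by
  rw [← p.roomIntegral_apply ε u]
  rfl

end Params

end Waveguide

end

noncomputable section

namespace Waveguide

/-! ### Resolvents of forms -/

section AbstractResolvents

variable {H K : Type*} [NormedAddCommGroup H] [InnerProductSpace ℂ H]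
  [NormedAddCommGroup K] [InnerProductSpace ℂ K]

/-! Write `s = ε^{-1/2}`, and let `d`, `h`, `b` be the sizes of passage and room. The normalisations
make `J` an isometry whose adjoint is `J̃`, so `J̃ J = I` and two of the requirements hold with no
defect.

The vector `u - J J̃ u` is the deviation from the vertical mean on the strip, from the mean on the
room, and `u` itself on the passage. Poincaré inequalities give `ε` and `b`. On the passage, `u` is
compared along each vertical line with its mean over the strip below. By the one-dimensional Sobolev
inequality for `J̃ u` this mean is of order `s`, and the area `d h = γ ε h²` turns that into order
`h`. Only `‖u‖` and the gradient enter, so the constant does not see `V₀` (`norm_sub_J_Jtilde_le`).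

For the resolvents put `g = R₀ f`. Since `J g` jumps at the ends of the passage, it is replaced by a
trial function `t` that interpolates affinely in height between the two values.
`norm_resolvent_sub_le` reduces the claim to two facts: `t` is close to `J g`, and `a₀[g, J̃ w] -
a_ε[t, w]` is small relative to the energy norm of `w` (`exists_trial`). On the strip the two forms
agree exactly, because `J̃` is the adjoint of `J` and commutes with `∂₁`. What is left, up to small
terms, is `g(0)` times the conjugate of `γ (J̃ w)₁(0) + h⁻¹ s ∫_P ∂₂ w`.

That this balance is small is the heart of the proof (`norm_gate_le`). The flux `∫_P ∂₂ w` is `d`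
times the difference of the means of `w` over squares of side `d` above and below the passage, up to
`O(d)`, and `d = γ ε h` gives `h⁻¹ s d = γ √ε`. The lower mean times `√ε` is nearly `(J̃ w)₁(0)`, so
it cancels the point interaction. The upper mean is comparable with the room mean, which is only
bounded by `b⁻¹`; this leaves `√ε b⁻¹ = ε^{1/2-β}`, the third exponent of the rate. Changing the
side of the squares from `d` to `ε` or `b` costs a bounded amount per doubling, as Poincaré is scale
invariant in two dimensions; the resulting logarithm is absorbed by `b⁻¹`.

Replacing `g` on the gate by `g(0)` needs `g'` bounded near the origin. On either side of it `g'' =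
V₀ g + g - f`, so `g'` is in `H¹` there and Sobolev applies (`ae_norm_weakDeriv_le`). Here the
supremum norm of `V₀` enters, and with it the dependence of `C` on `V₀`.

The resolvents exist because weak derivatives have closed graphs: the form domain together with its
gradients is a Hilbert space, and the weak equation is solved by an adjoint
(`HForm.exists_resolvent`). -/

theorem HForm.energyNorm_nonneg {H : Type*} [NormedAddCommGroup H] (a : HForm H) (u : H) :
    0 ≤ a.energyNorm u := Real.sqrt_nonneg _

/-- If the inner product `a[u, v] + (u, v)` on the form domain is represented through a bounded
operator `T` that is bounded from below on a Hilbert space `V`, then the resolvent exists and is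
symmetric. -/
theorem HForm.exists_resolvent {V W : Type*} [NormedAddCommGroup V] [InnerProductSpace ℂ V]
    [CompleteSpace V] [NormedAddCommGroup W] [InnerProductSpace ℂ W] [CompleteSpace H]
    (a : HForm H) (ι : V →L[ℂ] H) (T : V →L[ℂ] W) (c : ℝ) (hT : ∀ v, ‖v‖ ≤ c * ‖T v‖)
    (hdom : a.dom = range ι)
    (hform : ∀ u v, inner ℂ (T v) (T u) = a.form (ι u) (ι v) + inner ℂ (ι v) (ι u)) :
    ∃ R : H →L[ℂ] H, a.IsResolvent R ∧ ∀ f g, inner ℂ (R f) g = inner ℂ f (R g) := by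
  have hanti : AntilipschitzWith (Real.toNNReal c) T := by
    refine AddMonoidHomClass.antilipschitz_of_bound T fun v => (hT v).trans ?_
    gcongr
    exact Real.le_coe_toNNReal c
  have hinj : Function.Injective T.toLinearMap := hanti.injective
  -- Being bounded below on a complete space, `T` has complete range. This range stands for the form
  -- domain with the inner product `a[u, v] + (u, v)`, and operators on it have adjoints.
  have hcomp : CompleteSpace (LinearMap.range T.toLinearMap) := by
    have h := hanti.isComplete_range T.uniformContinuous
    exact h.completeSpace_coe
  let e := LinearEquiv.ofInjective T.toLinearMap hinj
  let E : LinearMap.range T.toLinearMap →L[ℂ] V :=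
    LinearMap.mkContinuous e.symm.toLinearMap c (fun x => by
      have h1 : T (e.symm x) = x := congrArg Subtype.val (e.apply_symm_apply x)
      have h2 := hT (e.symm x)
      rw [h1] at h2
      exact h2)
  have hE : ∀ x, T (E x) = x := fun x => congrArg Subtype.val (e.apply_symm_apply x)
  have hE' : ∀ v, E (e v) = v := fun v => e.symm_apply_apply v
  let ι' : LinearMap.range T.toLinearMap →L[ℂ] H := ι ∘L E
  have hι : ∀ v, ι' (e v) = ι v := fun v => congrArg ι (hE' v)
  have hadj : ∀ v g, inner ℂ (e v) (ι'.adjoint g) = inner ℂ (ι v) g := fun v g => by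
    rw [ContinuousLinearMap.adjoint_inner_right, hι]
  -- On the range of `T` the equation `a[u, v] + (u, v) = (g, v)` says that a vector has the same
  -- products with all `e v` as `ι'.adjoint g`, hence equals it. The resolvent is therefore `ι'`
  -- after its adjoint, which is symmetric.
  refine ⟨ι' ∘L ι'.adjoint, fun g u => ?_, fun f g => ?_⟩
  · constructor
    · intro hu
      have hw : u = ι (E (ι'.adjoint g)) := hu.symm
      refine ⟨by rw [hdom, hw]; exact mem_range_self _, fun v hv => ?_⟩
      rw [hdom] at hv
      obtain ⟨v, rfl⟩ := hv
      have h1 := hform (E (ι'.adjoint g)) v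
      rw [hE, ← hw] at h1
      have h2 := hadj v g
      have h3 : inner ℂ (e v) (ι'.adjoint g) = inner ℂ (T v) (ι'.adjoint g : W) := rfl
      rw [inner_sub_right, ← h2, h3, h1]
      ring
    · rintro ⟨hu, hv⟩
      rw [hdom] at hu hv
      obtain ⟨w, rfl⟩ := hu
      have : e w = ι'.adjoint g := by
        refine ext_inner_left ℂ fun x => ?_
        obtain ⟨v, rfl⟩ := e.surjective x
        rw [hadj]
        have h1 := hform w v
        have h2 := hv (ι v) (mem_range_self v)
        rw [inner_sub_right] at h2
        have h3 : inner ℂ (e v) (e w) = inner ℂ (T v) (T w) := rfl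
        rw [h3, h1, ← h2]
        ring
      change ι' (ι'.adjoint g) = _
      rw [← this, hι]
  · change inner ℂ (ι' (ι'.adjoint f)) g = inner ℂ f (ι' (ι'.adjoint g))
    rw [← ContinuousLinearMap.adjoint_inner_right, ContinuousLinearMap.adjoint_inner_left]

/-- The energy norm of `R u` is bounded by `‖u‖`. -/
theorem HForm.IsResolvent.energyNorm_le {b : HForm K} {R : K →L[ℂ] K} (hR : b.IsResolvent R)
    (hb : ∀ u ∈ b.dom, 0 ≤ (b.form u u).re) (u : K) :
    b.energyNorm (R u) ≤ ‖u‖ := by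
  obtain ⟨hw, h⟩ := (hR u (R u)).1 rfl
  set w := R u
  -- The equation for `w = R u` is tested with `w` itself.
  have h1 : (b.form w w).re + ‖w‖ ^ 2 = (inner ℂ w u).re := by
    rw [← h w hw, inner_sub_right, Complex.sub_re]
    have : (inner ℂ w w).re = ‖w‖ ^ 2 := by
      have := inner_self_eq_norm_sq (𝕜 := ℂ) w
      simpa using this
    linarith
  have hn : 0 ≤ (b.form w w).re + ‖w‖ ^ 2 := by have := hb w hw; positivity
  have h2 : ‖w‖ ≤ b.energyNorm w :=
    Real.le_sqrt_of_sq_le (by linarith [hb w hw])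
  have h3 : b.energyNorm w ^ 2 ≤ b.energyNorm w * ‖u‖ := by
    have h4 : b.energyNorm w ^ 2 = (inner ℂ w u).re := by
      rw [HForm.energyNorm, Real.sq_sqrt hn, h1]
    rw [h4]
    refine (Complex.re_le_norm _).trans ((norm_inner_le_norm _ _).trans ?_)
    gcongr
  by_contra hlt
  push Not at hlt
  have := b.energyNorm_nonneg w
  nlinarith [norm_nonneg u]

theorem norm_le_of_forall_inner_le {x : K} {c : ℝ} (hc : 0 ≤ c)
    (h : ∀ u, ‖inner ℂ u x‖ ≤ c * ‖u‖) : ‖x‖ ≤ c := by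
  have hx := h x
  rw [inner_self_eq_norm_sq_to_K] at hx
  have hx' : ‖x‖ * ‖x‖ ≤ c * ‖x‖ := by simpa [sq] using hx
  rcases eq_or_lt_of_le (norm_nonneg x) with h0 | h0
  · exact h0 ▸ hc
  · exact le_of_mul_le_mul_right hx' h0

/-- Closeness of resolvents from closeness of forms, for mutually adjoint identification
operators `J`, `J'` with `J'` mapping form domain to form domain. -/
theorem norm_resolvent_sub_le (a : HForm H) (b : HForm K) (J : H →L[ℂ] K) (J' : K →L[ℂ] H)
    {Ra : H →L[ℂ] H} {Rb : K →L[ℂ] K} (hRa : a.IsResolvent Ra) (hRb : b.IsResolvent Rb)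
    (hRas : ∀ f g, inner ℂ (Ra f) g = inner ℂ f (Ra g))
    (hRbs : ∀ f g, inner ℂ (Rb f) g = inner ℂ f (Rb g))
    (hadj : ∀ f u, inner ℂ u (J f) = inner ℂ (J' u) f)
    (hb : ∀ u ∈ b.dom, 0 ≤ (b.form u u).re)
    (hsymm : ∀ u ∈ b.dom, ∀ v ∈ b.dom, b.form u v = star (b.form v u))
    (hJ' : ∀ w ∈ b.dom, J' w ∈ a.dom) {δ₁ δ₂ : ℝ} (h₁ : 0 ≤ δ₁) (h₂ : 0 ≤ δ₂)
    (h : ∀ f, ∃ g ∈ b.dom, ‖g - J (Ra f)‖ ≤ δ₁ * ‖f‖ ∧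
      ∀ w ∈ b.dom, ‖a.form (Ra f) (J' w) - b.form g w‖ ≤ δ₂ * ‖f‖ * b.energyNorm w) :
    ‖Rb ∘L J - J ∘L Ra‖ ≤ 2 * δ₁ + δ₂ ∧ ‖J' ∘L Rb - Ra ∘L J'‖ ≤ 2 * δ₁ + δ₂ := by
  -- One bilinear bound serves both estimates, because the second operator is the adjoint of the
  -- first.
  have key : ∀ f u, ‖inner ℂ u ((Rb ∘L J - J ∘L Ra) f)‖ ≤ (2 * δ₁ + δ₂) * ‖f‖ * ‖u‖ := by
    intro f u
    obtain ⟨g, hg, hg1, hg2⟩ := h f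
    obtain ⟨hw, hwe⟩ := (hRb u (Rb u)).1 rfl
    obtain ⟨-, hfe⟩ := (hRa f (Ra f)).1 rfl
    have hE := hRb.energyNorm_le hb u
    have hwn : ‖Rb u‖ ≤ ‖u‖ :=
      le_trans (Real.le_sqrt_of_sq_le (by linarith [hb _ hw])) hE
    have e1 : inner ℂ (Rb u) (J f) = inner ℂ (J' (Rb u)) f := hadj _ _
    have e2 := hfe (J' (Rb u)) (hJ' _ hw)
    have e3 : inner ℂ (u - Rb u) g = b.form g (Rb u) := by
      rw [hsymm _ hg _ hw, ← hwe g hg]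
      exact (inner_conj_symm _ _).symm
    have e4 := hadj (Ra f) (Rb u)
    rw [inner_sub_right] at e2
    rw [inner_sub_left] at e3
    -- The vector `g` stands in for `J (Ra f)`, which need not lie in `b.dom`. The equation for `Ra
    -- f` is tested with `J' (Rb u)` and the one for `Rb u` with `g`. The replacement is paid for
    -- twice, against `Rb u` and against `u`, hence `2 * δ₁`.
    have e : inner ℂ u ((Rb ∘L J - J ∘L Ra) f)
        = (a.form (Ra f) (J' (Rb u)) - b.form g (Rb u)) - inner ℂ (Rb u) (g - J (Ra f))
          + inner ℂ u (g - J (Ra f)) := by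
      have : (Rb ∘L J - J ∘L Ra) f = Rb (J f) - J (Ra f) := rfl
      rw [this, inner_sub_right, inner_sub_right, inner_sub_right, ← hRbs, e1]
      linear_combination e2 - e3 - e4
    rw [e]
    have n1 := norm_inner_le_norm (𝕜 := ℂ) (Rb u) (g - J (Ra f))
    have n2 := norm_inner_le_norm (𝕜 := ℂ) u (g - J (Ra f))
    have n3 : ‖Rb u‖ * ‖g - J (Ra f)‖ ≤ ‖u‖ * (δ₁ * ‖f‖) := by gcongr
    have n4 : ‖u‖ * ‖g - J (Ra f)‖ ≤ ‖u‖ * (δ₁ * ‖f‖) := by gcongr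
    have n5 : δ₂ * ‖f‖ * b.energyNorm (Rb u) ≤ δ₂ * ‖f‖ * ‖u‖ := by gcongr
    refine (norm_add_le _ _).trans ?_
    have n6 := norm_sub_le (a.form (Ra f) (J' (Rb u)) - b.form g (Rb u))
      (inner ℂ (Rb u) (g - J (Ra f)))
    linarith [hg2 _ hw]
  have hpos : 0 ≤ 2 * δ₁ + δ₂ := by positivity
  refine ⟨ContinuousLinearMap.opNorm_le_bound _ hpos fun f =>
    norm_le_of_forall_inner_le (by positivity) (key f),
    ContinuousLinearMap.opNorm_le_bound _ hpos fun u =>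
      norm_le_of_forall_inner_le (by positivity) fun f => ?_⟩
  have hk := key f u
  have : inner ℂ f ((J' ∘L Rb - Ra ∘L J') u) = star (inner ℂ u ((Rb ∘L J - J ∘L Ra) f)) := by
    have e1 : (J' ∘L Rb - Ra ∘L J') u = J' (Rb u) - Ra (J' u) := rfl
    have e2 : (Rb ∘L J - J ∘L Ra) f = Rb (J f) - J (Ra f) := rfl
    rw [e1, e2, inner_sub_right, inner_sub_right, ← hRbs, hadj, hadj, ← hRas]
    simp only [star_sub]
    congr 1
    · exact (inner_conj_symm _ _).symm
    · exact (inner_conj_symm _ _).symm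
  rw [this, norm_star]
  linarith

end AbstractResolvents

end Waveguide

namespace Waveguide

set_option linter.unusedSectionVars false

/-! ### Weak derivatives: uniqueness and locality -/

open scoped ContDiff

section General

variable {E : Type*} [NormedAddCommGroup E] [NormedSpace ℝ E] [MeasureSpace E] {U : Set E} {v : E}

theorem setIntegral_eq_integral_of_tsupport_subset {φ : E → ℝ} {U : Set E}
    (hU : tsupport φ ⊆ U) (u : E → ℂ) :
    ∫ x in U, (φ x : ℂ) * u x = ∫ x, (φ x : ℂ) * u x := by
  refine setIntegral_eq_integral_of_forall_compl_eq_zero fun x hx => ?_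
  rw [image_eq_zero_of_notMem_tsupport fun h => hx (hU h)]
  simp

theorem tsupport_fderiv_apply_subset {φ : E → ℝ} (v : E) :
    tsupport (fun x => fderiv ℝ φ x v) ⊆ tsupport φ := by
  refine closure_minimal (fun x hx => ?_) (isClosed_tsupport φ)
  by_contra hn
  refine hx ?_
  have := image_eq_zero_of_notMem_tsupport (fun h => hn (tsupport_fderiv_subset ℝ h))
  simp [this]

theorem HasWeakDeriv.mono {U' : Set E} {u g : E → ℂ} (h : HasWeakDeriv U v u g) (hU : U' ⊆ U) :
    HasWeakDeriv U' v u g := by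
  intro φ h1 h2 h3
  have := h φ h1 h2 (h3.trans hU)
  rwa [setIntegral_eq_integral_of_tsupport_subset (h3.trans hU),
    ← setIntegral_eq_integral_of_tsupport_subset h3,
    setIntegral_eq_integral_of_tsupport_subset
      ((tsupport_fderiv_apply_subset v).trans (h3.trans hU)),
    ← setIntegral_eq_integral_of_tsupport_subset ((tsupport_fderiv_apply_subset v).trans h3)]
    at this

theorem HasWeakDeriv.congr_ae {u g u' g' : E → ℂ} (h : HasWeakDeriv U v u g)
    (hu : u =ᵐ[volume.restrict U] u') (hg : g =ᵐ[volume.restrict U] g') :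
    HasWeakDeriv U v u' g' := by
  intro φ h1 h2 h3
  have e1 : ∫ x in U, ((fderiv ℝ φ x v : ℝ) : ℂ) * u' x
      = ∫ x in U, ((fderiv ℝ φ x v : ℝ) : ℂ) * u x :=
    integral_congr_ae (by filter_upwards [hu] with x hx; rw [hx])
  have e2 : ∫ x in U, ((φ x : ℝ) : ℂ) * g' x = ∫ x in U, ((φ x : ℝ) : ℂ) * g x :=
    integral_congr_ae (by filter_upwards [hg] with x hx; rw [hx])
  rw [e1, e2, h φ h1 h2 h3]

theorem hasWeakDeriv_weakDeriv {u : L2 U} (h : HasL2WeakDeriv U v u) :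
    HasWeakDeriv U v u (weakDeriv U v u) := by
  rw [weakDeriv, dif_pos h]
  exact h.choose_spec

variable [BorelSpace E] [IsFiniteMeasureOnCompacts (volume : Measure E)]

theorem integrable_test_mul {μ : Measure E} [IsFiniteMeasureOnCompacts μ] {φ : E → ℝ}
    (hφ : Continuous φ) (hs : HasCompactSupport φ) {u : E → ℂ} (hu : MemLp u 2 μ) :
    Integrable (fun x => (φ x : ℂ) * u x) μ := by
  have hφ' : MemLp (fun x => (φ x : ℂ)) 2 μ :=
    (Complex.continuous_ofReal.comp hφ).memLp_of_hasCompactSupport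
      (hs.comp_left (g := Complex.ofReal) Complex.ofReal_zero)
  exact MemLp.integrable_mul (p := 2) (q := 2) hφ' hu

theorem continuous_fderiv_apply_of_contDiff {φ : E → ℝ} (hφ : ContDiff ℝ ∞ φ) (v : E) :
    Continuous fun x => fderiv ℝ φ x v :=
  (hφ.continuous_fderiv (by simp)).clm_apply continuous_const

theorem hasCompactSupport_fderiv_apply {φ : E → ℝ} (hs : HasCompactSupport φ) (v : E) :
    HasCompactSupport fun x => fderiv ℝ φ x v :=
  hs.mono' ((subset_tsupport _).trans (tsupport_fderiv_apply_subset v))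

/-- A test functional is bounded on `L²`, so it is a pairing with a fixed vector. Linearity,
closedness and density arguments for weak derivatives thereby become statements about inner
products. -/
theorem exists_inner_eq_integral_test (U : Set E) {φ : E → ℝ} (hφ : Continuous φ)
    (hs : HasCompactSupport φ) :
    ∃ t : L2 U, ∀ u : L2 U, ∫ x in U, (φ x : ℂ) * u x = inner ℂ t u := by
  have hφ' : MemLp (fun x => (φ x : ℂ)) 2 (volume.restrict U) :=
    (Complex.continuous_ofReal.comp hφ).memLp_of_hasCompactSupport
      (hs.comp_left (g := Complex.ofReal) Complex.ofReal_zero)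
  refine ⟨hφ'.toLp _, fun u => ?_⟩
  rw [L2.inner_def]
  refine integral_congr_ae ?_
  filter_upwards [hφ'.coeFn_toLp] with x hx
  rw [hx]
  simp [mul_comm]

/-- The pairs `(u, ∂_v u)` in `L²(U) × L²(U)`. -/
def weakGraph (U : Set E) (v : E) : Submodule ℂ (L2 U × L2 U) where
  carrier := {w | HasWeakDeriv U v w.1 w.2}
  zero_mem' := fun φ h1 h2 h3 => by
    obtain ⟨s, hs⟩ := exists_inner_eq_integral_test U (continuous_fderiv_apply_of_contDiff h1 v)
      (hasCompactSupport_fderiv_apply h2 v)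
    obtain ⟨t, ht⟩ := exists_inner_eq_integral_test U h1.continuous h2
    rw [hs, ht]
    simp
  add_mem' := fun {a b} ha hb φ h1 h2 h3 => by
    obtain ⟨s, hs⟩ := exists_inner_eq_integral_test U (continuous_fderiv_apply_of_contDiff h1 v)
      (hasCompactSupport_fderiv_apply h2 v)
    obtain ⟨t, ht⟩ := exists_inner_eq_integral_test U h1.continuous h2
    have ha := ha φ h1 h2 h3
    have hb := hb φ h1 h2 h3
    rw [hs, ht] at *
    rw [Prod.fst_add, Prod.snd_add, inner_add_right, inner_add_right, ha, hb]
    ring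
  smul_mem' := fun c a ha φ h1 h2 h3 => by
    obtain ⟨s, hs⟩ := exists_inner_eq_integral_test U (continuous_fderiv_apply_of_contDiff h1 v)
      (hasCompactSupport_fderiv_apply h2 v)
    obtain ⟨t, ht⟩ := exists_inner_eq_integral_test U h1.continuous h2
    have ha := ha φ h1 h2 h3
    rw [hs, ht] at *
    rw [Prod.smul_fst, Prod.smul_snd, inner_smul_right, inner_smul_right, ha]
    ring

/-- The graph is an intersection, over the test functions, of sets where two continuous functionals
agree. This is the completeness of `H¹` that the existence of the resolvents rests on. -/
theorem isClosed_weakGraph (U : Set E) (v : E) : IsClosed (weakGraph U v : Set (L2 U × L2 U)) := by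
  have : (weakGraph U v : Set (L2 U × L2 U)) = ⋂ (φ : E → ℝ) (_ : ContDiff ℝ ∞ φ)
      (_ : HasCompactSupport φ) (_ : tsupport φ ⊆ U), {w : L2 U × L2 U |
        ∫ x in U, ((fderiv ℝ φ x v : ℝ) : ℂ) * w.1 x = - ∫ x in U, ((φ x : ℝ) : ℂ) * w.2 x} := by
    ext w
    simp only [mem_iInter]
    rfl
  rw [this]
  refine isClosed_iInter fun φ => isClosed_iInter fun h1 => isClosed_iInter fun h2 =>
    isClosed_iInter fun h3 => ?_
  obtain ⟨s, hs⟩ := exists_inner_eq_integral_test U (continuous_fderiv_apply_of_contDiff h1 v)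
    (hasCompactSupport_fderiv_apply h2 v)
  obtain ⟨t, ht⟩ := exists_inner_eq_integral_test U h1.continuous h2
  simp only [hs, ht]
  exact isClosed_eq (by fun_prop) (by fun_prop)

variable [FiniteDimensional ℝ E]

/-- The fundamental lemma of the calculus of variations, applied to `g - g'`. -/
theorem HasWeakDeriv.ae_unique (hU : IsOpen U) {u : E → ℂ} {g g' : E → ℂ}
    (hg : MemLp g 2 (volume.restrict U)) (hg' : MemLp g' 2 (volume.restrict U))
    (h : HasWeakDeriv U v u g) (h' : HasWeakDeriv U v u g') : g =ᵐ[volume.restrict U] g' := by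
  have hl : LocallyIntegrableOn (g - g') U := by
    refine locallyIntegrableOn_of_locallyIntegrable_restrict ?_
    exact (hg.sub hg').locallyIntegrable (by norm_num)
  have := hU.ae_eq_zero_of_integral_contDiff_smul_eq_zero hl fun φ h1 h2 h3 => by
    have e : ∫ x, φ x • (g - g') x = ∫ x in U, (φ x : ℂ) * (g - g') x := by
      rw [setIntegral_eq_integral_of_tsupport_subset h3]
      simp
    rw [e]
    have e1 : ∀ x, (φ x : ℂ) * (g - g') x = (φ x : ℂ) * g x - (φ x : ℂ) * g' x := fun x => by
      rw [Pi.sub_apply]; ring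
    simp_rw [e1]
    rw [integral_sub (integrable_test_mul h1.continuous h2 hg)
      (integrable_test_mul h1.continuous h2 hg')]
    have a1 := h φ h1 h2 h3
    have a2 := h' φ h1 h2 h3
    rw [a1] at a2
    exact sub_eq_zero.2 (neg_injective a2)
  rw [← ae_restrict_iff' hU.measurableSet] at this
  filter_upwards [this] with x hx
  exact sub_eq_zero.1 hx

/-- By uniqueness the choice made in `weakDeriv` is harmless: any `L²` witness computes it. -/
theorem weakDeriv_eq (hU : IsOpen U) {u g : L2 U} (h : HasWeakDeriv U v u g) :
    weakDeriv U v u = g :=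
  Lp.ext ((hasWeakDeriv_weakDeriv ⟨g, h⟩).ae_unique hU (Lp.memLp _) (Lp.memLp _) h)

end General

/-! ### Weak derivatives on intervals -/

theorem exists_Icc_of_tsupport_subset_Ioo {p q : ℝ} (hpq : p < q) {φ : ℝ → ℝ}
    (hs : HasCompactSupport φ) (h : tsupport φ ⊆ Ioo p q) :
    ∃ a b, p < a ∧ a < b ∧ b < q ∧ tsupport φ ⊆ Icc a b := by
  obtain ⟨r, hr, hr'⟩ := exists_between hpq
  rcases (tsupport φ).eq_empty_or_nonempty with h0 | hne
  · obtain ⟨s, hs, hs'⟩ := exists_between hr'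
    exact ⟨r, s, hr, hs, hs', by simp [h0]⟩
  · obtain ⟨a, ha, ha'⟩ := IsCompact.exists_isLeast hs hne
    obtain ⟨b, hb, hb'⟩ := IsCompact.exists_isGreatest hs hne
    -- The right end is moved beyond the support so that the interval is nondegenerate even if the
    -- support is a point.
    obtain ⟨c, hc, hc'⟩ := exists_between (h hb).2
    exact ⟨a, c, (h ha).1, (ha' hb).trans_lt hc, hc', fun x hx => ⟨ha' hx, (hb' hx).trans hc.le⟩⟩

/-- A test function of vanishing mean is the derivative of a test function. -/
theorem exists_primitive_test {p q : ℝ} (hpq : p < q) {θ : ℝ → ℝ} (h1 : ContDiff ℝ ∞ θ)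
    (h2 : HasCompactSupport θ) (h3 : tsupport θ ⊆ Ioo p q) (h0 : ∫ x, θ x = 0) :
    ∃ ψ : ℝ → ℝ, ContDiff ℝ ∞ ψ ∧ HasCompactSupport ψ ∧ tsupport ψ ⊆ Ioo p q ∧ deriv ψ = θ := by
  obtain ⟨a, b, hpa, hab, hbq, hI⟩ := exists_Icc_of_tsupport_subset_Ioo hpq h2 h3
  have hz : ∀ x, x ∉ Icc a b → θ x = 0 := fun x hx =>
    image_eq_zero_of_notMem_tsupport fun h => hx (hI h)
  have hd : ∀ x, HasDerivAt (fun x => ∫ t in a..x, θ t) (θ x) x := fun x =>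
    intervalIntegral.integral_hasDerivAt_right (h1.continuous.intervalIntegrable _ _)
      (h1.continuous.stronglyMeasurableAtFilter _ _) h1.continuous.continuousAt
  have hderiv : deriv (fun x => ∫ t in a..x, θ t) = θ := funext fun x => (hd x).deriv
  have hfull : ∫ t in a..b, θ t = 0 := by
    rw [intervalIntegral.integral_of_le hab.le, ← integral_Icc_eq_integral_Ioc,
      setIntegral_eq_integral_of_forall_compl_eq_zero hz, h0]
  -- Left of `a` the integrand vanishes; right of `b` the primitive has collected the whole
  -- integral, which is zero.
  have hsupp : ∀ x, x ∉ Icc a b → ∫ t in a..x, θ t = 0 := by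
    intro x hx
    rcases lt_or_ge x a with h | h
    · rw [intervalIntegral.integral_symm, intervalIntegral.integral_of_le h.le, neg_eq_zero]
      rw [← integral_Ico_eq_integral_Ioc]
      exact setIntegral_eq_zero_of_forall_eq_zero fun t ht => hz t fun h' => by
        linarith [ht.2, h'.1]
    · have hbx : b < x := by by_contra hh; exact hx ⟨h, not_lt.1 hh⟩
      rw [← intervalIntegral.integral_add_adjacent_intervals
        (h1.continuous.intervalIntegrable a b) (h1.continuous.intervalIntegrable b x), hfull,
        zero_add, intervalIntegral.integral_of_le hbx.le]
      exact setIntegral_eq_zero_of_forall_eq_zero fun t ht => hz t fun h' => by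
        linarith [ht.1, h'.2]
  have hts : tsupport (fun x => ∫ t in a..x, θ t) ⊆ Icc a b :=
    closure_minimal (fun x hx => by by_contra h; exact hx (hsupp x h)) isClosed_Icc
  refine ⟨fun x => ∫ t in a..x, θ t, ?_, ?_, ?_, hderiv⟩
  · rw [contDiff_infty_iff_deriv, hderiv]
    exact ⟨fun x => (hd x).differentiableAt, h1⟩
  · exact isCompact_Icc.of_isClosed_subset (isClosed_tsupport _) hts
  · exact hts.trans fun x hx => ⟨hpa.trans_le hx.1, hx.2.trans_lt hbq⟩

theorem integrableOn_test_mul {U : Set ℝ} {φ : ℝ → ℝ} (hφ : Continuous φ)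
    (hs : HasCompactSupport φ) {u : ℝ → ℂ} (hu : IntegrableOn u U) :
    IntegrableOn (fun x => (φ x : ℂ) * u x) U := by
  obtain ⟨C, hC⟩ := hs.exists_bound_of_continuous hφ
  refine Integrable.bdd_mul (c := C) hu
    (Complex.continuous_ofReal.comp hφ).aestronglyMeasurable (.of_forall fun x => ?_)
  simpa using hC x

/-- A function with vanishing weak derivative on an interval is constant. -/
theorem HasWeakDeriv.exists_ae_eq_const {p q : ℝ} (hpq : p < q) {n : ℝ → ℂ}
    (hn : IntegrableOn n (Ioo p q)) (h : HasWeakDeriv (Ioo p q) 1 n 0) :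
    ∃ c : ℂ, ∀ᵐ x ∂volume.restrict (Ioo p q), n x = c := by
  obtain ⟨ρ, hρ1, hρ2, hρ3, hρ4⟩ : ∃ ρ : ℝ → ℝ, ContDiff ℝ ∞ ρ ∧ HasCompactSupport ρ ∧
      tsupport ρ ⊆ Ioo p q ∧ ∫ x, ρ x = 1 := by
    let f : ContDiffBump ((p + q) / 2) := ⟨(q - p) / 8, (q - p) / 4, by linarith, by linarith⟩
    refine ⟨f.normed volume, f.contDiff_normed, f.hasCompactSupport_normed, ?_, f.integral_normed⟩
    rw [f.tsupport_normed_eq, Real.closedBall_eq_Icc]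
    intro x hx
    have h1 := hx.1
    have h2 := hx.2
    change (p + q) / 2 - (q - p) / 4 ≤ x at h1
    change x ≤ (p + q) / 2 + (q - p) / 4 at h2
    constructor <;> linarith
  refine ⟨∫ x in Ioo p q, (ρ x : ℂ) * n x, ?_⟩
  set c := ∫ x in Ioo p q, (ρ x : ℂ) * n x with hc
  have hl : LocallyIntegrableOn (fun x => n x - c) (Ioo p q) :=
    (hn.sub (integrableOn_const (by simp))).locallyIntegrableOn
  have := isOpen_Ioo.ae_eq_zero_of_integral_contDiff_smul_eq_zero hl fun φ h1 h2 h3 => by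
    have hφi : Integrable φ := h1.continuous.integrable_of_hasCompactSupport h2
    have hρi : Integrable ρ := hρ1.continuous.integrable_of_hasCompactSupport hρ2
    set s := ∫ x, φ x with hs
    -- Subtracting `s ρ` removes the mean of `φ`, so the rest is some `ψ'` and integrates to zero
    -- against `n`. Thus `∫ φ n = s c = ∫ φ c`.
    obtain ⟨ψ, g1, g2, g3, g4⟩ := exists_primitive_test hpq (θ := fun x => φ x - s * ρ x)
      (h1.sub (contDiff_const.mul hρ1)) (h2.sub (hρ2.mul_left))
      ((tsupport_sub φ _).trans (union_subset h3 ((tsupport_mul_subset_right).trans hρ3)))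
      (by rw [integral_sub hφi (hρi.const_mul s), integral_const_mul, hρ4]; ring)
    have h5 := h ψ g1 g2 g3
    simp only [Pi.zero_apply, mul_zero, integral_zero, neg_zero] at h5
    have e : ∀ x, ((fderiv ℝ ψ x 1 : ℝ) : ℂ) * n x
        = (φ x : ℂ) * n x - (s : ℂ) * ((ρ x : ℂ) * n x) := fun x => by
      rw [fderiv_apply_one_eq_deriv, g4]; push_cast; ring
    simp_rw [e] at h5
    have i1 := integrableOn_test_mul h1.continuous h2 hn
    have i2 := integrableOn_test_mul hρ1.continuous hρ2 hn
    rw [integral_sub i1 (i2.const_mul _), integral_const_mul, ← hc] at h5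
    have e2 : ∫ x, φ x • (n x - c) = ∫ x in Ioo p q, (φ x : ℂ) * (n x - c) := by
      rw [setIntegral_eq_integral_of_tsupport_subset h3]
      simp
    rw [e2]
    simp_rw [mul_sub]
    have i3 : IntegrableOn (fun x => (φ x : ℂ) * c) (Ioo p q) :=
      (hφi.ofReal.mul_const c).integrableOn
    have e3 : ∫ x in Ioo p q, (φ x : ℂ) * c = s * c := by
      rw [setIntegral_eq_integral_of_tsupport_subset h3, integral_mul_const, hs,
        integral_complex_ofReal]
    rw [integral_sub i1 i3, e3]
    exact h5
  rw [← ae_restrict_iff' measurableSet_Ioo] at this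
  filter_upwards [this] with x hx
  exact sub_eq_zero.1 hx

end Waveguide

/-! ### Cauchy–Schwarz bounds, primitives and point values on intervals -/

namespace Waveguide

open scoped ContDiff

theorem norm_integral_sq_le {X : Type*} [MeasurableSpace X] {μ : Measure X} [IsFiniteMeasure μ]
    {k : X → ℂ} (hk : MemLp k 2 μ) :
    ‖∫ x, k x ∂μ‖ ^ 2 ≤ μ.real univ * ∫ x, ‖k x‖ ^ 2 ∂μ := by
  have h := integral_mul_le_Lp_mul_Lq_of_nonneg (μ := μ) (p := 2) (q := 2)
    Real.HolderConjugate.two_two (f := fun _ => (1 : ℝ)) (g := fun x => ‖k x‖)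
    (.of_forall fun _ => zero_le_one) (.of_forall fun _ => norm_nonneg _) (memLp_const 1)
    (by simpa using hk.norm)
  have h0 : 0 ≤ ∫ x, ‖k x‖ ^ 2 ∂μ := integral_nonneg fun _ => by positivity
  simp only [one_mul, integral_const, smul_eq_mul, Real.rpow_two, one_pow, mul_one] at h
  have h' := (norm_integral_le_integral_norm k (μ := μ)).trans h
  rw [← Real.sqrt_eq_rpow, ← Real.sqrt_eq_rpow] at h'
  calc ‖∫ x, k x ∂μ‖ ^ 2 ≤ (√(μ.real univ) * √(∫ x, ‖k x‖ ^ 2 ∂μ)) ^ 2 := by gcongr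
    _ = _ := by rw [mul_pow, Real.sq_sqrt measureReal_nonneg, Real.sq_sqrt h0]

theorem norm_setIntegral_Ioo_sq_le {p q : ℝ} (hpq : p ≤ q) {k : ℝ → ℂ}
    (hk : MemLp k 2 (volume.restrict (Ioo p q))) :
    ‖∫ x in Ioo p q, k x‖ ^ 2 ≤ (q - p) * ∫ x in Ioo p q, ‖k x‖ ^ 2 := by
  have := norm_integral_sq_le hk
  rwa [measureReal_restrict_apply_univ, Real.volume_real_Ioo_of_le hpq] at this

theorem integrable_norm_sq {X : Type*} [MeasurableSpace X] {μ : Measure X} {k : X → ℂ}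
    (hk : MemLp k 2 μ) : Integrable (fun x => ‖k x‖ ^ 2) μ :=
  hk.integrable_norm_pow (by norm_num)

/-- Hölder continuity of a primitive, by Cauchy–Schwarz. The length of the whole interval replaces
`|x - y|`, which makes the bound uniform in the two points. -/
theorem norm_intervalIntegral_sq_le {p q x y : ℝ} {k : ℝ → ℂ}
    (hk : MemLp k 2 (volume.restrict (Ioo p q))) (hx : x ∈ Icc p q) (hy : y ∈ Icc p q) :
    ‖∫ t in x..y, k t‖ ^ 2 ≤ (q - p) * ∫ t in Ioo p q, ‖k t‖ ^ 2 := by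
  wlog h : x ≤ y generalizing x y
  · rw [intervalIntegral.integral_symm, norm_neg]
    exact this hy hx (not_le.1 h).le
  have hsub : Ioo x y ⊆ Ioo p q := Ioo_subset_Ioo hx.1 hy.2
  rw [intervalIntegral.integral_of_le h, integral_Ioc_eq_integral_Ioo]
  refine (norm_setIntegral_Ioo_sq_le h (hk.mono_measure (Measure.restrict_mono_set _ hsub))).trans ?_
  have h1 : ∫ t in Ioo x y, ‖k t‖ ^ 2 ≤ ∫ t in Ioo p q, ‖k t‖ ^ 2 :=
    setIntegral_mono_set (integrable_norm_sq hk) (.of_forall fun _ => by positivity)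
      hsub.eventuallyLE
  have h2 : 0 ≤ ∫ t in Ioo x y, ‖k t‖ ^ 2 := integral_nonneg fun _ => by positivity
  have h3 : y - x ≤ q - p := by linarith [hx.1, hy.2]
  exact mul_le_mul h3 h1 h2 (by linarith)

/-- The moving endpoint becomes an indicator on a fixed interval, as Fubini's theorem requires. -/
theorem primitive_eq_setIntegral {p q x : ℝ} (hx : x ∈ Ioo p q) (k : ℝ → ℂ) :
    ∫ t in p..x, k t = ∫ t in Ioo p q, (Iio x).indicator k t := by
  rw [setIntegral_indicator measurableSet_Iio, intervalIntegral.integral_of_le hx.1.le,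
    integral_Ioc_eq_integral_Ioo]
  congr 2
  ext t
  simp only [mem_Ioo, mem_inter_iff, mem_Iio]
  constructor
  · rintro ⟨h1, h2⟩; exact ⟨⟨h1, h2.trans hx.2⟩, h2⟩
  · rintro ⟨⟨h1, -⟩, h2⟩; exact ⟨h1, h2⟩

/-- The primitive of an integrable function has this function as its weak derivative. -/
theorem hasWeakDeriv_primitive {p q : ℝ} {k : ℝ → ℂ}
    (hk : IntegrableOn k (Ioo p q)) :
    HasWeakDeriv (Ioo p q) 1 (fun x => ∫ t in p..x, k t) k := by
  intro ψ h1 h2 h3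
  have hd : ∀ x, HasDerivAt ψ (deriv ψ x) x := fun x =>
    ((h1.differentiable (by simp)) x).hasDerivAt
  have hc : Continuous (deriv ψ) := h1.continuous_deriv (by simp)
  have hq : ψ q = 0 := image_eq_zero_of_notMem_tsupport fun h => lt_irrefl q (h3 h).2
  -- After the order of integration is exchanged, `k t` is multiplied by the integral of `ψ'` over
  -- `(t, q)`, which is `-ψ t` because `ψ` vanishes at `q`.
  let F : ℝ → ℝ → ℂ := fun x t => ((deriv ψ x : ℝ) : ℂ) * (Iio x).indicator k t
  have e1 : ∫ x in Ioo p q, ((fderiv ℝ ψ x 1 : ℝ) : ℂ) * ∫ t in p..x, k t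
      = ∫ x in Ioo p q, ∫ t in Ioo p q, F x t := by
    refine setIntegral_congr_fun measurableSet_Ioo fun x hx => ?_
    simp only [F]
    rw [primitive_eq_setIntegral hx, integral_const_mul, fderiv_apply_one_eq_deriv]
  have hint : Integrable (Function.uncurry F)
      ((volume.restrict (Ioo p q)).prod (volume.restrict (Ioo p q))) := by
    have i1 : IntegrableOn (fun x => ((deriv ψ x : ℝ) : ℂ)) (Ioo p q) :=
      ((Complex.continuous_ofReal.comp hc).integrableOn_Icc (a := p) (b := q)).mono_set
        Ioo_subset_Icc_self
    have i2 := Integrable.mul_prod i1 hk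
    have i3 := i2.indicator (measurableSet_lt measurable_snd measurable_fst)
    refine i3.congr (.of_forall fun z => ?_)
    by_cases hz : z.2 < z.1
    · simp [F, Function.uncurry, indicator, hz]
    · simp [F, Function.uncurry, indicator, hz]
  rw [e1, integral_integral_swap hint, ← integral_neg]
  refine setIntegral_congr_fun measurableSet_Ioo fun t ht => ?_
  have e2 : ∀ x, F x t = (Ioi t).indicator (fun x => ((deriv ψ x : ℝ) : ℂ)) x * k t := fun x => by
    by_cases hx : t < x
    · simp [F, indicator, hx]
    · simp [F, indicator, hx]
  simp only [e2]
  rw [integral_mul_const, setIntegral_indicator measurableSet_Ioi]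
  have e3 : Ioo p q ∩ Ioi t = Ioo t q := by
    ext x
    simp only [mem_Ioo, mem_inter_iff, mem_Ioi]
    constructor
    · rintro ⟨⟨-, h1⟩, h2⟩; exact ⟨h2, h1⟩
    · rintro ⟨h2, h1⟩; exact ⟨⟨ht.1.trans h2, h1⟩, h2⟩
  have e4 : ∫ x in Ioo t q, ((deriv ψ x : ℝ) : ℂ) = -(ψ t : ℂ) := by
    rw [integral_complex_ofReal, ← integral_Ioc_eq_integral_Ioo,
      ← intervalIntegral.integral_of_le ht.2.le,
      intervalIntegral.integral_deriv_eq_sub (fun x _ => (hd x).differentiableAt)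
        (hc.intervalIntegrable _ _), hq]
    simp
  rw [e3, e4]
  ring

theorem integrableOn_primitive {p q : ℝ} {k : ℝ → ℂ} (hk : IntegrableOn k (Ioo p q)) :
    IntegrableOn (fun x => ∫ t in p..x, k t) (Ioo p q) := by
  rcases le_or_gt p q with hpq | hpq
  · have hc := intervalIntegral.continuousOn_primitive_interval (μ := volume) (f := k)
      (a := p) (b := q) (by
        rw [uIcc_of_le hpq]
        exact (integrableOn_Icc_iff_integrableOn_Ioo).2 hk)
    rw [uIcc_of_le hpq] at hc
    exact (hc.integrableOn_Icc).mono_set Ioo_subset_Icc_self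
  · simp [Ioo_eq_empty hpq.not_gt]

/-- A function with an integrable weak derivative on a bounded interval is a primitive. -/
theorem HasWeakDeriv.exists_ae_eq_primitive {p q : ℝ} (hpq : p < q) {m k : ℝ → ℂ}
    (hm : IntegrableOn m (Ioo p q)) (hk : IntegrableOn k (Ioo p q))
    (h : HasWeakDeriv (Ioo p q) 1 m k) :
    ∃ c : ℂ, ∀ᵐ x ∂volume.restrict (Ioo p q), m x = c + ∫ t in p..x, k t := by
  have hP := integrableOn_primitive hk
  have h0 : HasWeakDeriv (Ioo p q) 1 (fun x => m x - ∫ t in p..x, k t) 0 := by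
    intro ψ h1 h2 h3
    have a1 := h ψ h1 h2 h3
    have a2 := hasWeakDeriv_primitive hk ψ h1 h2 h3
    have hc := continuous_fderiv_apply_of_contDiff h1 (1 : ℝ)
    have hs := hasCompactSupport_fderiv_apply h2 (1 : ℝ)
    simp_rw [mul_sub]
    rw [integral_sub (integrableOn_test_mul hc hs hm) (integrableOn_test_mul hc hs hP), a1, a2]
    simp
  obtain ⟨c, hc⟩ := h0.exists_ae_eq_const hpq (hm.sub hP)
  refine ⟨c, ?_⟩
  filter_upwards [hc] with x hx
  rw [← hx, Pi.sub_apply]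
  ring

theorem memLp_Ioo_of_subset {U : Set ℝ} {k : ℝ → ℂ} (hk : MemLp k 2 (volume.restrict U))
    {a b : ℝ} (h : Ioo a b ⊆ U) : MemLp k 2 (volume.restrict (Ioo a b)) :=
  hk.mono_measure (Measure.restrict_mono_set _ h)

theorem integrableOn_Ioo_of_memLp {U : Set ℝ} {k : ℝ → ℂ} (hk : MemLp k 2 (volume.restrict U))
    {a b : ℝ} (h : Ioo a b ⊆ U) : IntegrableOn k (Ioo a b) :=
  (memLp_Ioo_of_subset hk h).integrable (by norm_num)

theorem intervalIntegrable_of_memLp {U : Set ℝ} {k : ℝ → ℂ} (hk : MemLp k 2 (volume.restrict U))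
    {a b : ℝ} (h : Ioo a b ⊆ U) {x y : ℝ} (hx : x ∈ Icc a b) (hy : y ∈ Icc a b) :
    IntervalIntegrable k volume x y := by
  have h1 : IntegrableOn k (Icc a b) :=
    (integrableOn_Icc_iff_integrableOn_Ioo).2 (integrableOn_Ioo_of_memLp hk h)
  exact intervalIntegrable_iff.2 (h1.mono_set fun t ht =>
    uIcc_subset_Icc hx hy (uIoc_subset_uIcc ht))

/-- The primitive representation on a bounded interval, with any base point. -/
theorem HasWeakDeriv.exists_ae_eq_primitive_base {U : Set ℝ} {m k : ℝ → ℂ}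
    (hm : MemLp m 2 (volume.restrict U)) (hk : MemLp k 2 (volume.restrict U))
    (h : HasWeakDeriv U 1 m k) {a b x₀ : ℝ} (hab : a < b) (hU : Ioo a b ⊆ U)
    (hx₀ : x₀ ∈ Icc a b) :
    ∃ c : ℂ, ∀ᵐ x ∂volume.restrict (Ioo a b), m x = c + ∫ t in x₀..x, k t := by
  obtain ⟨c, hc⟩ := (h.mono hU).exists_ae_eq_primitive hab (integrableOn_Ioo_of_memLp hm hU)
    (integrableOn_Ioo_of_memLp hk hU)
  refine ⟨c + ∫ t in a..x₀, k t, ?_⟩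
  filter_upwards [hc, ae_restrict_mem measurableSet_Ioo] with x hx hxm
  rw [hx, add_assoc, intervalIntegral.integral_add_adjacent_intervals
    (intervalIntegrable_of_memLp hk hU (left_mem_Icc.2 hab.le) hx₀)
    (intervalIntegrable_of_memLp hk hU hx₀ (Ioo_subset_Icc_self hxm))]

/-- Used to glue primitives: on an overlap of positive measure the constants of two local
representations must coincide. -/
theorem eq_of_ae_const {s : Set ℝ} (hs : volume s ≠ 0) {a b : ℂ} {P Q : ℝ → ℂ}
    (h1 : ∀ᵐ x ∂volume.restrict s, P x = a + Q x) (h2 : ∀ᵐ x ∂volume.restrict s, P x = b + Q x) :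
    a = b := by
  have : (ae (volume.restrict s)).NeBot := by
    rw [ae_neBot]
    exact fun h => hs (Measure.restrict_eq_zero.1 h)
  obtain ⟨x, hx1, hx2⟩ := (h1.and h2).exists
  rw [hx1] at hx2
  exact add_right_cancel hx2

/-- The primitive representation on an open interval, possibly unbounded. -/
theorem HasWeakDeriv.exists_ae_eq_primitive_of_ordConnected {U : Set ℝ} (hU : IsOpen U)
    (hc : U.OrdConnected) {x₀ : ℝ} (hx₀ : x₀ ∈ U) {m k : ℝ → ℂ}
    (hm : MemLp m 2 (volume.restrict U)) (hk : MemLp k 2 (volume.restrict U))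
    (h : HasWeakDeriv U 1 m k) :
    ∃ c : ℂ, ∀ᵐ x ∂volume.restrict U, m x = c + ∫ t in x₀..x, k t := by
  -- Intervals with rational ends that contain `x₀`: countably many, so null sets may be united, and
  -- any two of them overlap in an interval around `x₀`, so one constant serves for all.
  let S : Set (ℚ × ℚ) := {z | (z.1 : ℝ) < x₀ ∧ x₀ < z.2 ∧ Ioo (z.1 : ℝ) z.2 ⊆ U}
  have hrep : ∀ z ∈ S, ∃ c : ℂ, ∀ᵐ x ∂volume.restrict (Ioo (z.1 : ℝ) z.2),
      m x = c + ∫ t in x₀..x, k t := fun z hz =>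
    h.exists_ae_eq_primitive_base hm hk (hz.1.trans hz.2.1) hz.2.2 ⟨hz.1.le, hz.2.1.le⟩
  have hmem : ∀ x ∈ U, ∃ z ∈ S, x ∈ Ioo (z.1 : ℝ) z.2 := by
    intro x hx
    have h1 : min x x₀ ∈ U := by rcases min_choice x x₀ with h | h <;> rw [h] <;> assumption
    have h2 : max x x₀ ∈ U := by rcases max_choice x x₀ with h | h <;> rw [h] <;> assumption
    obtain ⟨l, r, hlr, hlr'⟩ := mem_nhds_iff_exists_Ioo_subset.1 (hU.mem_nhds h1)
    obtain ⟨l', r', hlr2, hlr2'⟩ := mem_nhds_iff_exists_Ioo_subset.1 (hU.mem_nhds h2)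
    obtain ⟨a, ha, ha'⟩ := exists_rat_btwn hlr.1
    obtain ⟨b, hb, hb'⟩ := exists_rat_btwn hlr2.2
    refine ⟨(a, b), ⟨ha'.trans_le (min_le_right _ _), (le_max_right _ _).trans_lt hb, ?_⟩,
      ha'.trans_le (min_le_left _ _), (le_max_left _ _).trans_lt hb⟩
    have haU : (a : ℝ) ∈ U := hlr' ⟨ha, ha'.trans hlr.2⟩
    have hbU : (b : ℝ) ∈ U := hlr2' ⟨hlr2.1.trans hb, hb'⟩
    exact Ioo_subset_Icc_self.trans (hc.out haU hbU)
  obtain ⟨z₀, hz₀, -⟩ := hmem x₀ hx₀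
  obtain ⟨c, hc0⟩ := hrep z₀ hz₀
  refine ⟨c, ?_⟩
  have hUeq : U = ⋃ z ∈ S, Ioo (z.1 : ℝ) z.2 := by
    ext x
    simp only [mem_iUnion]
    constructor
    · intro hx
      obtain ⟨z, hz, hxz⟩ := hmem x hx
      exact ⟨z, hz, hxz⟩
    · rintro ⟨z, hz, hxz⟩
      exact hz.2.2 hxz
  rw [hUeq, ae_restrict_biUnion_iff _ (Set.to_countable S)]
  intro z hz
  obtain ⟨c', hc'⟩ := hrep z hz
  have hcc : c = c' := by
    have hsub : Ioo (max (z₀.1 : ℝ) z.1) (min z₀.2 z.2) = Ioo (z₀.1 : ℝ) z₀.2 ∩ Ioo (z.1 : ℝ) z.2 :=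
      Ioo_inter_Ioo.symm
    refine eq_of_ae_const (s := Ioo (max (z₀.1 : ℝ) z.1) (min z₀.2 z.2)) ?_
      (ae_restrict_of_ae_restrict_of_subset (hsub.trans_subset inter_subset_left) hc0)
      (ae_restrict_of_ae_restrict_of_subset (hsub.trans_subset inter_subset_right) hc')
    rw [Real.volume_Ioo]
    simp only [ne_eq, ENNReal.ofReal_eq_zero, not_le, sub_pos]
    exact (max_lt hz₀.1 hz.1).trans (lt_min hz₀.2.1 hz.2.1)
  rw [hcc]
  exact hc'

/-- A weakly differentiable function on an interval has a continuous representative. -/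
theorem HasWeakDeriv.exists_continuousOn_primitive {U : Set ℝ} (hU : IsOpen U)
    (hc : U.OrdConnected) {x₀ : ℝ} (hx₀ : x₀ ∈ U) {f g : L2 U} (h : HasWeakDeriv U 1 f g) :
    ∃ c : ℂ, ContinuousOn (fun x => c + ∫ t in x₀..x, g t) U ∧
      f =ᵐ[volume.restrict U] fun x => c + ∫ t in x₀..x, g t := by
  obtain ⟨c, hcx⟩ := h.exists_ae_eq_primitive_of_ordConnected hU hc hx₀ (Lp.memLp f) (Lp.memLp g)
  refine ⟨c, ?_, hcx⟩
  refine continuousOn_const.add fun x hx => ContinuousAt.continuousWithinAt ?_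
  have h1 : min x x₀ ∈ U := by rcases min_choice x x₀ with h | h <;> rw [h] <;> assumption
  have h2 : max x x₀ ∈ U := by rcases max_choice x x₀ with h | h <;> rw [h] <;> assumption
  obtain ⟨l, r, hlr, hlr'⟩ := mem_nhds_iff_exists_Ioo_subset.1 (hU.mem_nhds h1)
  obtain ⟨l', r', hlr2, hlr2'⟩ := mem_nhds_iff_exists_Ioo_subset.1 (hU.mem_nhds h2)
  obtain ⟨a, ha, ha'⟩ := exists_between hlr.1
  obtain ⟨b, hb, hb'⟩ := exists_between hlr2.2
  have haU : a ∈ U := hlr' ⟨ha, ha'.trans hlr.2⟩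
  have hbU : b ∈ U := hlr2' ⟨hlr2.1.trans hb, hb'⟩
  have hax : a < x := ha'.trans_le (min_le_left _ _)
  have hbx : x < b := (le_max_left _ _).trans_lt hb
  have hax₀ : a < x₀ := ha'.trans_le (min_le_right _ _)
  have hbx₀ : x₀ < b := (le_max_right _ _).trans_lt hb
  have hab : a ≤ b := (hax.trans hbx).le
  have hsub : Ioo a b ⊆ U := Ioo_subset_Icc_self.trans (hc.out haU hbU)
  have := intervalIntegral.continuousOn_primitive_interval' (μ := volume) (f := (g : ℝ → ℂ))
    (b₁ := a) (b₂ := b) (a := x₀)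
    (intervalIntegrable_of_memLp (Lp.memLp g) hsub (left_mem_Icc.2 hab) (right_mem_Icc.2 hab))
    (by rw [uIcc_of_le hab]; exact ⟨hax₀.le, hbx₀.le⟩)
  refine this.continuousAt ?_
  rw [uIcc_of_le hab]
  exact Icc_mem_nhds hax hbx

/-- Two functions continuous on an open set that agree almost everywhere agree everywhere, so the
representative chosen in `pointValue` is immaterial. -/
theorem pointValue_eq {U : Set ℝ} (hU : IsOpen U) {f : L2 U} {g : ℝ → ℂ} (hg : ContinuousOn g U)
    (h : f =ᵐ[volume.restrict U] g) {x : ℝ} (hx : x ∈ U) : pointValue U f x = g x := by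
  have hex : ∃ g : ℝ → ℂ, ContinuousOn g U ∧ f =ᵐ[volume.restrict U] g := ⟨g, hg, h⟩
  rw [pointValue, dif_pos hex]
  exact Measure.eqOn_open_of_ae_eq (hex.choose_spec.2.symm.trans h) hU hex.choose_spec.1 hg hx

/-- Point values of `H¹` functions. -/
theorem pointValue_spec {U : Set ℝ} (hU : IsOpen U) (hc : U.OrdConnected) {x₀ : ℝ} (hx₀ : x₀ ∈ U)
    {f g : L2 U} (h : HasWeakDeriv U 1 f g) :
    ∀ᵐ x ∂volume.restrict U, f x = pointValue U f x₀ + ∫ t in x₀..x, g t := by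
  obtain ⟨c, hcont, hcx⟩ := h.exists_continuousOn_primitive hU hc hx₀
  have hpv := pointValue_eq hU hcont hcx hx₀
  rw [intervalIntegral.integral_same, add_zero] at hpv
  rw [hpv]
  exact hcx

end Waveguide

namespace Waveguide

open scoped ContDiff

/-! ### Sections of functions with weak derivatives on products -/

/-- Tonelli's theorem for `|u|²`. Sections of infinite length are allowed, as for horizontal lines
in an unbounded strip. -/
theorem ae_memLp_prodMk_left {X Y : Type*} [MeasurableSpace X] [MeasurableSpace Y] {μ : Measure X}
    {ν : Measure Y} [SFinite ν] {u : X × Y → ℂ} (hu : MemLp u 2 (μ.prod ν)) :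
    ∀ᵐ x ∂μ, MemLp (fun y => u (x, y)) 2 ν := by
  have hfin : ∫⁻ z, ‖u z‖ₑ ^ 2 ∂(μ.prod ν) < ⊤ := by
    rw [← eLpNorm_two_sq]
    exact ENNReal.pow_lt_top hu.2
  have hm : AEMeasurable (fun z => ‖u z‖ₑ ^ 2) (μ.prod ν) := hu.1.enorm.pow_const 2
  rw [lintegral_prod _ hm] at hfin
  filter_upwards [ae_lt_top' hm.lintegral_prod_right' hfin.ne, hu.1.prodMk_left] with x hx hx'
  refine ⟨hx', ?_⟩
  rw [← eLpNorm_two_sq] at hx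
  exact lt_of_not_ge fun h => by simp [top_le_iff.1 h] at hx

theorem hasCompactSupport_prod_mul {φ ψ : ℝ → ℝ} (hφ : HasCompactSupport φ)
    (hψ : HasCompactSupport ψ) : HasCompactSupport fun z : ℝ × ℝ => φ z.1 * ψ z.2 := by
  refine HasCompactSupport.intro' (IsCompact.prod hφ hψ)
    ((isClosed_tsupport φ).prod (isClosed_tsupport ψ)) fun z hz => ?_
  by_cases h1 : z.1 ∈ tsupport φ
  · have h2 : z.2 ∉ tsupport ψ := fun h2 => hz ⟨h1, h2⟩
    rw [image_eq_zero_of_notMem_tsupport h2, mul_zero]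
  · rw [image_eq_zero_of_notMem_tsupport h1, zero_mul]

theorem tsupport_prod_mul_subset (φ ψ : ℝ → ℝ) :
    tsupport (fun z : ℝ × ℝ => φ z.1 * ψ z.2) ⊆ tsupport φ ×ˢ tsupport ψ := by
  refine closure_minimal (fun z hz => ?_) ((isClosed_tsupport φ).prod (isClosed_tsupport ψ))
  rw [Function.mem_support] at hz
  exact ⟨subset_tsupport _ fun h => hz (by simp [h]), subset_tsupport _ fun h => hz (by simp [h])⟩

theorem hasFDerivAt_prod_mul {φ ψ : ℝ → ℝ} (hφ : ContDiff ℝ ∞ φ) (hψ : ContDiff ℝ ∞ ψ)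
    (z v : ℝ × ℝ) : fderiv ℝ (fun z : ℝ × ℝ => φ z.1 * ψ z.2) z v
      = φ z.1 * (deriv ψ z.2 * v.2) + ψ z.2 * (deriv φ z.1 * v.1) := by
  have h1 : HasFDerivAt (fun z : ℝ × ℝ => φ z.1) (deriv φ z.1 • ContinuousLinearMap.fst ℝ ℝ ℝ) z :=
    ((hφ.differentiable (by simp)) z.1).hasDerivAt.comp_hasFDerivAt z hasFDerivAt_fst
  have h2 : HasFDerivAt (fun z : ℝ × ℝ => ψ z.2) (deriv ψ z.2 • ContinuousLinearMap.snd ℝ ℝ ℝ) z :=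
    ((hψ.differentiable (by simp)) z.2).hasDerivAt.comp_hasFDerivAt z hasFDerivAt_snd
  have h3 : HasFDerivAt (fun z : ℝ × ℝ => φ z.1 * ψ z.2) _ z := h1.mul h2
  rw [h3.fderiv]
  simp

theorem contDiff_prod_mul {φ ψ : ℝ → ℝ} (hφ : ContDiff ℝ ∞ φ) (hψ : ContDiff ℝ ∞ ψ) :
    ContDiff ℝ ∞ fun z : ℝ × ℝ => φ z.1 * ψ z.2 :=
  (hφ.comp contDiff_fst).mul (hψ.comp contDiff_snd)

/-- The weak derivative in the second variable, tested with products only. -/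
def HasProdWeakDeriv (I K : Set ℝ) (w g : ℝ × ℝ → ℂ) : Prop :=
  ∀ φ ψ : ℝ → ℝ, ContDiff ℝ ∞ φ → HasCompactSupport φ → tsupport φ ⊆ I →
    ContDiff ℝ ∞ ψ → HasCompactSupport ψ → tsupport ψ ⊆ K →
    ∫ z, ((φ z.1 * deriv ψ z.2 : ℝ) : ℂ) * w z ∂(volume.restrict I).prod (volume.restrict K)
      = - ∫ z, ((φ z.1 * ψ z.2 : ℝ) : ℂ) * g z ∂(volume.restrict I).prod (volume.restrict K)

theorem volume_restrict_prod (I K : Set ℝ) : (volume : Measure (ℝ × ℝ)).restrict (I ×ˢ K)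
    = (volume.restrict I).prod (volume.restrict K) := by
  rw [Measure.volume_eq_prod, Measure.prod_restrict]

theorem HasWeakDeriv.hasProdWeakDeriv {I K : Set ℝ} {w g : ℝ × ℝ → ℂ}
    (h : HasWeakDeriv (I ×ˢ K) (0, 1) w g) : HasProdWeakDeriv I K w g := by
  intro φ ψ h1 h2 h3 h4 h5 h6
  have := h _ (contDiff_prod_mul h1 h4) (hasCompactSupport_prod_mul h2 h5)
    ((tsupport_prod_mul_subset φ ψ).trans (prod_mono h3 h6))
  simp only [hasFDerivAt_prod_mul h1 h4, mul_one, mul_zero, add_zero] at this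
  rwa [volume_restrict_prod] at this

theorem integral_restrict_prod_swap (I K : Set ℝ) (F : ℝ × ℝ → ℂ) :
    ∫ z, F z.swap ∂(volume.restrict K).prod (volume.restrict I)
      = ∫ z, F z ∂(volume.restrict I).prod (volume.restrict K) :=
  integral_prod_swap F

/-- Exchanging the coordinates lets every result about the second variable serve for the first. -/
theorem HasWeakDeriv.hasProdWeakDeriv_swap {I K : Set ℝ} {w g : ℝ × ℝ → ℂ}
    (h : HasWeakDeriv (I ×ˢ K) (1, 0) w g) :
    HasProdWeakDeriv K I (fun z => w z.swap) (fun z => g z.swap) := by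
  intro φ ψ h1 h2 h3 h4 h5 h6
  have := h _ (contDiff_prod_mul h4 h1) (hasCompactSupport_prod_mul h5 h2)
    ((tsupport_prod_mul_subset ψ φ).trans (prod_mono h6 h3))
  simp only [hasFDerivAt_prod_mul h4 h1, mul_one, mul_zero, zero_add] at this
  rw [volume_restrict_prod] at this
  rw [← integral_restrict_prod_swap, ← integral_restrict_prod_swap I K] at this
  simp only [Prod.fst_swap, Prod.snd_swap] at this
  convert this using 4
  ring_nf

section Slices

variable {I K : Set ℝ} {w g : ℝ × ℝ → ℂ}

/-- Cauchy–Schwarz over a bounded piece of `I`. Local integrability is all that the fundamental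
lemma asks for, and `I` may be unbounded. -/
theorem locallyIntegrableOn_integral_test (hw : MemLp w 2 ((volume.restrict I).prod (volume.restrict K)))
    {ψ : ℝ → ℝ} (hψ : Continuous ψ) (hs : HasCompactSupport ψ) :
    LocallyIntegrableOn (fun x => ∫ y in K, (ψ y : ℂ) * w (x, y)) I := by
  refine locallyIntegrableOn_of_locallyIntegrable_restrict fun x₀ => ?_
  refine ⟨Ioo (x₀ - 1) (x₀ + 1), Ioo_mem_nhds (by linarith) (by linarith), ?_⟩
  set μ := (volume.restrict I).restrict (Ioo (x₀ - 1) (x₀ + 1)) with hμ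
  have hfin : IsFiniteMeasure μ := by
    refine ⟨?_⟩
    rw [hμ, Measure.restrict_apply_univ]
    exact (Measure.restrict_apply_le _ _).trans_lt (by simp)
  have h1 : MemLp (fun y => (ψ y : ℂ)) 2 (volume.restrict K) :=
    (Complex.continuous_ofReal.comp hψ).memLp_of_hasCompactSupport
      (hs.comp_left (g := Complex.ofReal) Complex.ofReal_zero)
  have h2 : MemLp (fun z : ℝ × ℝ => (ψ z.2 : ℂ)) 2 (μ.prod (volume.restrict K)) := h1.comp_snd μ
  have h3 : MemLp w 2 (μ.prod (volume.restrict K)) :=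
    hw.mono_measure (Measure.prod_mono Measure.restrict_le_self le_rfl)
  exact (MemLp.integrable_mul (p := 2) (q := 2) h2 h3).integral_prod_left

theorem integrable_prod_test (hw : MemLp w 2 ((volume.restrict I).prod (volume.restrict K)))
    {φ ψ : ℝ → ℝ} (h1 : Continuous φ) (h2 : HasCompactSupport φ) (h4 : Continuous ψ)
    (h5 : HasCompactSupport ψ) :
    Integrable (fun z => ((φ z.1 * ψ z.2 : ℝ) : ℂ) * w z)
      ((volume.restrict I).prod (volume.restrict K)) := by
  rw [← volume_restrict_prod] at hw ⊢
  exact integrable_test_mul ((h1.comp continuous_fst).mul (h4.comp continuous_snd))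
    (hasCompactSupport_prod_mul h2 h5) hw

/-- For fixed `ψ`, the difference of the two sides is a function of `x` that integrates to zero
against every test function `φ`, so it vanishes almost everywhere. The exceptional null set depends
on `ψ`. -/
theorem HasProdWeakDeriv.ae_integral_eq (hI : IsOpen I)
    (hw : MemLp w 2 ((volume.restrict I).prod (volume.restrict K)))
    (hg : MemLp g 2 ((volume.restrict I).prod (volume.restrict K)))
    (h : HasProdWeakDeriv I K w g) {ψ : ℝ → ℝ} (h4 : ContDiff ℝ ∞ ψ) (h5 : HasCompactSupport ψ)
    (h6 : tsupport ψ ⊆ K) :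
    ∀ᵐ x ∂volume.restrict I, ∫ y in K, ((deriv ψ y : ℝ) : ℂ) * w (x, y)
      = - ∫ y in K, (ψ y : ℂ) * g (x, y) := by
  have hc : Continuous (deriv ψ) := h4.continuous_deriv (by simp)
  have hl := (locallyIntegrableOn_integral_test hw hc h5.deriv).add
    (locallyIntegrableOn_integral_test hg h4.continuous h5)
  have := hI.ae_eq_zero_of_integral_contDiff_smul_eq_zero hl fun φ h1 h2 h3 => by
    have e : ∫ x, φ x • ((fun x => ∫ y in K, ((deriv ψ y : ℝ) : ℂ) * w (x, y))
        + fun x => ∫ y in K, (ψ y : ℂ) * g (x, y)) x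
        = ∫ x in I, (φ x : ℂ) * (((fun x => ∫ y in K, ((deriv ψ y : ℝ) : ℂ) * w (x, y))
        + fun x => ∫ y in K, (ψ y : ℂ) * g (x, y)) x) := by
      rw [setIntegral_eq_integral_of_tsupport_subset h3]
      simp only [Complex.real_smul]
    rw [e]
    have i1 := integrable_prod_test hw h1.continuous h2 hc h5.deriv
    have i2 := integrable_prod_test hg h1.continuous h2 h4.continuous h5
    have hh := h φ ψ h1 h2 h3 h4 h5 h6
    rw [integral_prod _ i1, integral_prod _ i2] at hh
    have j1 := i1.integral_prod_left
    have j2 := i2.integral_prod_left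
    have e2 : ∀ x, (φ x : ℂ) * (((fun x => ∫ y in K, ((deriv ψ y : ℝ) : ℂ) * w (x, y))
        + fun x => ∫ y in K, (ψ y : ℂ) * g (x, y)) x)
        = (∫ y in K, ((φ x * deriv ψ y : ℝ) : ℂ) * w (x, y))
          + ∫ y in K, ((φ x * ψ y : ℝ) : ℂ) * g (x, y) := fun x => by
      rw [Pi.add_apply, mul_add, ← integral_const_mul, ← integral_const_mul]
      simp only [Complex.ofReal_mul, mul_assoc]
    simp_rw [e2]
    rw [integral_add j1 j2]
    simp only at hh
    rw [hh]
    ring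
  rw [← ae_restrict_iff' hI.measurableSet] at this
  filter_upwards [this] with x hx
  exact eq_neg_of_add_eq_zero_left hx

/-- Almost all sections of a function with an `L²` weak derivative in the second variable have
the section of this derivative as their weak derivative. -/
theorem HasProdWeakDeriv.ae_hasWeakDeriv (hI : IsOpen I)
    (hw : MemLp w 2 ((volume.restrict I).prod (volume.restrict K)))
    (hg : MemLp g 2 ((volume.restrict I).prod (volume.restrict K)))
    (h : HasProdWeakDeriv I K w g) :
    ∀ᵐ x ∂volume.restrict I, HasWeakDeriv K 1 (fun y => w (x, y)) (fun y => g (x, y)) := by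
  -- Each `ψ` brings its own null set. The pairs of vectors representing `ψ'` and `ψ` lie in a
  -- separable space, so a countable dense family of them is enough.
  let S : Set (L2 K × L2 K) := {st | ∃ ψ : ℝ → ℝ, ContDiff ℝ ∞ ψ ∧ HasCompactSupport ψ ∧
    tsupport ψ ⊆ K ∧ (∀ u : L2 K, ∫ y in K, ((deriv ψ y : ℝ) : ℂ) * u y = inner ℂ st.1 u) ∧
    (∀ u : L2 K, ∫ y in K, (ψ y : ℂ) * u y = inner ℂ st.2 u)}
  have : SecondCountableTopology (L2 K) := by
    have : Fact ((2 : ℝ≥0∞) ≠ ⊤) := ⟨by norm_num⟩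
    infer_instance
  obtain ⟨D, hDc, hDd⟩ := TopologicalSpace.exists_countable_dense S
  have hall : ∀ᵐ x ∂volume.restrict I, ∀ d ∈ D, ∀ (W G : L2 K),
      W =ᵐ[volume.restrict K] (fun y => w (x, y)) → G =ᵐ[volume.restrict K] (fun y => g (x, y)) →
      inner ℂ d.1.1 W + inner ℂ d.1.2 G = 0 := by
    rw [ae_ball_iff hDc]
    rintro ⟨⟨s, t⟩, ψ, h4, h5, h6, h7, h8⟩ -
    filter_upwards [h.ae_integral_eq hI hw hg h4 h5 h6] with x hx W G hW hG
    simp only at h7 h8 ⊢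
    rw [← h7, ← h8, integral_congr_ae (g := fun y => ((deriv ψ y : ℝ) : ℂ) * w (x, y)), hx,
      integral_congr_ae (f := fun y => (ψ y : ℂ) * G y) (g := fun y => (ψ y : ℂ) * g (x, y))]
    · ring
    · filter_upwards [hG] with y hy; rw [hy]
    · filter_upwards [hW] with y hy; rw [hy]
  filter_upwards [hall, ae_memLp_prodMk_left hw, ae_memLp_prodMk_left hg] with x hx hwx hgx
  have hD : ∀ d ∈ D, inner ℂ d.1.1 (hwx.toLp _) + inner ℂ d.1.2 (hgx.toLp _) = 0 := fun d hd =>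
    hx d hd _ _ hwx.coeFn_toLp hgx.coeFn_toLp
  have hcont : Continuous fun d : S => inner ℂ d.1.1 (hwx.toLp _) + inner ℂ d.1.2 (hgx.toLp _) := by
    fun_prop
  -- Off the common null set the identity passes from the dense family to all test functions by
  -- continuity of the inner product.
  have hS := hcont.ext_on hDd continuous_const (g := fun _ => (0 : ℂ)) hD
  have : HasWeakDeriv K 1 (hwx.toLp _) (hgx.toLp _) := by
    intro ψ h4 h5 h6
    obtain ⟨s, hs⟩ := exists_inner_eq_integral_test K (h4.continuous_deriv (by simp)) h5.deriv
    obtain ⟨t, ht⟩ := exists_inner_eq_integral_test K h4.continuous h5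
    have := congrFun hS ⟨(s, t), ψ, h4, h5, h6, hs, ht⟩
    simp only [← hs, ← ht] at this
    simp only [fderiv_apply_one_eq_deriv]
    exact eq_neg_of_add_eq_zero_left this
  exact this.congr_ae hwx.coeFn_toLp hgx.coeFn_toLp

/-- Integration in the first variable commutes with the weak derivative in the second one. -/
theorem HasProdWeakDeriv.hasWeakDeriv_integral {p q : ℝ} 
    (hw : MemLp w 2 ((volume.restrict (Ioo p q)).prod (volume.restrict K)))
    (hg : MemLp g 2 ((volume.restrict (Ioo p q)).prod (volume.restrict K)))
    (h : HasProdWeakDeriv (Ioo p q) K w g) :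
    HasWeakDeriv K 1 (fun y => ∫ x in Ioo p q, w (x, y)) (fun y => ∫ x in Ioo p q, g (x, y)) := by
  intro ψ h4 h5 h6
  have hc : Continuous (deriv ψ) := h4.continuous_deriv (by simp)
  have key : ∀ {θ : ℝ → ℝ} {u : ℝ × ℝ → ℂ}, Continuous θ → HasCompactSupport θ →
      MemLp u 2 ((volume.restrict (Ioo p q)).prod (volume.restrict K)) →
      ∫ y in K, (θ y : ℂ) * ∫ x in Ioo p q, u (x, y)
        = ∫ x in Ioo p q, ∫ y in K, (θ y : ℂ) * u (x, y) := by
    intro θ u hθ hs hu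
    have h1 : MemLp (fun y => (θ y : ℂ)) 2 (volume.restrict K) :=
      (Complex.continuous_ofReal.comp hθ).memLp_of_hasCompactSupport
        (hs.comp_left (g := Complex.ofReal) Complex.ofReal_zero)
    have h2 : MemLp (fun z : ℝ × ℝ => (θ z.2 : ℂ)) 2
      ((volume.restrict (Ioo p q)).prod (volume.restrict K)) := h1.comp_snd _
    rw [integral_integral_swap (MemLp.integrable_mul (p := 2) (q := 2) h2 hu)]
    simp only [integral_const_mul]
  simp only [fderiv_apply_one_eq_deriv]
  rw [key hc h5.deriv hw, key h4.continuous h5 hg, ← integral_neg]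
  refine integral_congr_ae ?_
  filter_upwards [h.ae_integral_eq isOpen_Ioo hw hg h4 h5 h6] with x hx using hx

end Slices

end Waveguide

namespace Waveguide

/-! ### Oscillation and Poincaré inequalities -/

/-- Discs are convex. Pointwise values are compared with means through this bound. -/
theorem norm_sub_average_le {p q : ℝ} (hpq : p < q) {m : ℝ → ℂ} (hm : IntegrableOn m (Ioo p q))
    {z : ℂ} {B : ℝ} (h : ∀ᵐ y ∂volume.restrict (Ioo p q), ‖z - m y‖ ≤ B) :
    ‖z - ((q - p : ℝ) : ℂ)⁻¹ * ∫ y in Ioo p q, m y‖ ≤ B := by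
  have hqp : 0 < q - p := sub_pos.2 hpq
  have hne : ((q - p : ℝ) : ℂ) ≠ 0 := by exact_mod_cast hqp.ne'
  have e : z - ((q - p : ℝ) : ℂ)⁻¹ * ∫ y in Ioo p q, m y
      = ((q - p : ℝ) : ℂ)⁻¹ * ∫ y in Ioo p q, (z - m y) := by
    rw [integral_sub (integrable_const z) hm, setIntegral_const,
      Real.volume_real_Ioo_of_le hpq.le, Complex.real_smul]
    field_simp
  have h1 := norm_setIntegral_le_of_norm_le_const_ae (μ := volume) (s := Ioo p q)
    (f := fun y => z - m y) (C := B) (by simp) h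
  rw [Real.volume_real_Ioo_of_le hpq.le] at h1
  rw [e, norm_mul, norm_inv, Complex.norm_real, Real.norm_of_nonneg hqp.le]
  rw [inv_mul_le_iff₀ hqp]
  linarith

section OneDim

variable {p q : ℝ} {m k : ℝ → ℂ}

/-- The difference of two values is an integral of `k`, bounded by Cauchy–Schwarz; it is then
averaged over one of the points. The mean may be taken over a subinterval because values in the
passage are to be compared with means over the strip below it. -/
theorem HasWeakDeriv.ae_norm_sub_average_sq_le (hpq : p < q)
    (hm : MemLp m 2 (volume.restrict (Ioo p q))) (hk : MemLp k 2 (volume.restrict (Ioo p q)))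
    (h : HasWeakDeriv (Ioo p q) 1 m k) {p' q' : ℝ} (hp : p ≤ p') (hpq' : p' < q') (hq : q' ≤ q) :
    ∀ᵐ y ∂volume.restrict (Ioo p q),
      ‖m y - ((q' - p' : ℝ) : ℂ)⁻¹ * ∫ t in Ioo p' q', m t‖ ^ 2
        ≤ (q - p) * ∫ t in Ioo p q, ‖k t‖ ^ 2 := by
  have hsub : Ioo p' q' ⊆ Ioo p q := Ioo_subset_Ioo hp hq
  obtain ⟨c, hc⟩ := h.exists_ae_eq_primitive_base hm hk hpq subset_rfl (left_mem_Icc.2 hpq.le)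
  have hnn : 0 ≤ (q - p) * ∫ t in Ioo p q, ‖k t‖ ^ 2 :=
    mul_nonneg (sub_pos.2 hpq).le (integral_nonneg fun _ => by positivity)
  filter_upwards [hc, ae_restrict_mem measurableSet_Ioo] with y hy hym
  have hb : ‖m y - ((q' - p' : ℝ) : ℂ)⁻¹ * ∫ t in Ioo p' q', m t‖
      ≤ √((q - p) * ∫ t in Ioo p q, ‖k t‖ ^ 2) := by
    refine norm_sub_average_le hpq' (integrableOn_Ioo_of_memLp hm hsub) ?_
    filter_upwards [ae_restrict_of_ae_restrict_of_subset hsub hc,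
      ae_restrict_mem measurableSet_Ioo] with t ht htm
    have htm' := hsub htm
    refine Real.le_sqrt_of_sq_le ?_
    rw [hy, ht, add_sub_add_left_eq_sub, intervalIntegral.integral_interval_sub_left
      (intervalIntegrable_of_memLp hk subset_rfl (left_mem_Icc.2 hpq.le) (Ioo_subset_Icc_self hym))
      (intervalIntegrable_of_memLp hk subset_rfl (left_mem_Icc.2 hpq.le)
        (Ioo_subset_Icc_self htm'))]
    exact norm_intervalIntegral_sq_le hk (Ioo_subset_Icc_self htm') (Ioo_subset_Icc_self hym)
  calc _ ≤ √((q - p) * ∫ t in Ioo p q, ‖k t‖ ^ 2) ^ 2 := by gcongr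
    _ = _ := Real.sq_sqrt hnn

theorem HasWeakDeriv.poincare (hpq : p < q)
    (hm : MemLp m 2 (volume.restrict (Ioo p q))) (hk : MemLp k 2 (volume.restrict (Ioo p q)))
    (h : HasWeakDeriv (Ioo p q) 1 m k) :
    ∫ y in Ioo p q, ‖m y - ((q - p : ℝ) : ℂ)⁻¹ * ∫ t in Ioo p q, m t‖ ^ 2
      ≤ (q - p) ^ 2 * ∫ t in Ioo p q, ‖k t‖ ^ 2 := by
  have h1 := integral_mono_ae (integrable_norm_sq (hm.sub (memLp_const _)))
    (integrable_const _) (h.ae_norm_sub_average_sq_le hpq hm hk le_rfl hpq le_rfl)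
  refine h1.trans_eq ?_
  rw [integral_const, measureReal_restrict_apply_univ, Real.volume_real_Ioo_of_le hpq.le,
    smul_eq_mul]
  ring

theorem norm_add_sq_le_two (a b : ℂ) : ‖a + b‖ ^ 2 ≤ 2 * ‖a‖ ^ 2 + 2 * ‖b‖ ^ 2 := by
  have := norm_add_le a b
  have h0 := norm_nonneg (a + b)
  nlinarith [sq_nonneg (‖a‖ - ‖b‖)]

/-- The one-dimensional Sobolev inequality. -/
theorem HasWeakDeriv.ae_norm_sq_le (hpq : p < q)
    (hm : MemLp m 2 (volume.restrict (Ioo p q))) (hk : MemLp k 2 (volume.restrict (Ioo p q)))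
    (h : HasWeakDeriv (Ioo p q) 1 m k) :
    ∀ᵐ y ∂volume.restrict (Ioo p q), ‖m y‖ ^ 2
      ≤ 2 * (q - p)⁻¹ * (∫ t in Ioo p q, ‖m t‖ ^ 2)
        + 2 * (q - p) * ∫ t in Ioo p q, ‖k t‖ ^ 2 := by
  have hqp : 0 < q - p := sub_pos.2 hpq
  filter_upwards [h.ae_norm_sub_average_sq_le hpq hm hk le_rfl hpq le_rfl] with y hy
  set A := ((q - p : ℝ) : ℂ)⁻¹ * ∫ t in Ioo p q, m t with hA
  have h1 := norm_add_sq_le_two A (m y - A)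
  have h2 : ‖A‖ ^ 2 ≤ (q - p)⁻¹ * ∫ t in Ioo p q, ‖m t‖ ^ 2 := by
    rw [hA, norm_mul, norm_inv, Complex.norm_real, Real.norm_of_nonneg hqp.le, mul_pow]
    have := norm_setIntegral_Ioo_sq_le hpq.le hm
    calc (q - p)⁻¹ ^ 2 * ‖∫ t in Ioo p q, m t‖ ^ 2
        ≤ (q - p)⁻¹ ^ 2 * ((q - p) * ∫ t in Ioo p q, ‖m t‖ ^ 2) := by gcongr
      _ = _ := by field_simp
  rw [add_sub_cancel] at h1
  linarith

end OneDim

theorem memLp_integral_section {X Y : Type*} [MeasurableSpace X] [MeasurableSpace Y]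
    {μ : Measure X} {ν : Measure Y} [SFinite μ] [IsFiniteMeasure ν] {u : X × Y → ℂ}
    (hu : MemLp u 2 (μ.prod ν)) :
    MemLp (fun x => ∫ y, u (x, y) ∂ν) 2 μ :=
  ⟨hu.1.integral_prod_right', (eLpNorm_section_integral_le hu).trans_lt
    (ENNReal.mul_lt_top (ENNReal.rpow_lt_top_of_nonneg (by norm_num) (measure_ne_top _ _)) hu.2)⟩

section TwoDim

variable {I : Set ℝ} {p q : ℝ} {w g : ℝ × ℝ → ℂ}

/-- The Poincaré inequality in the second variable. -/
theorem HasProdWeakDeriv.poincare (hI : IsOpen I) (hpq : p < q)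
    (hw : MemLp w 2 ((volume.restrict I).prod (volume.restrict (Ioo p q))))
    (hg : MemLp g 2 ((volume.restrict I).prod (volume.restrict (Ioo p q))))
    (h : HasProdWeakDeriv I (Ioo p q) w g) :
    ∫ z, ‖w z - ((q - p : ℝ) : ℂ)⁻¹ * ∫ t in Ioo p q, w (z.1, t)‖ ^ 2
        ∂(volume.restrict I).prod (volume.restrict (Ioo p q))
      ≤ (q - p) ^ 2 * ∫ z, ‖g z‖ ^ 2 ∂(volume.restrict I).prod (volume.restrict (Ioo p q)) := by
  have hA : MemLp (fun z : ℝ × ℝ => ((q - p : ℝ) : ℂ)⁻¹ * ∫ t in Ioo p q, w (z.1, t)) 2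
      ((volume.restrict I).prod (volume.restrict (Ioo p q))) :=
    ((memLp_integral_section hw).const_mul _).comp_fst _
  have i1 : Integrable
      (fun z : ℝ × ℝ => ‖w z - ((q - p : ℝ) : ℂ)⁻¹ * ∫ t in Ioo p q, w (z.1, t)‖ ^ 2)
      ((volume.restrict I).prod (volume.restrict (Ioo p q))) := integrable_norm_sq (hw.sub hA)
  have i2 := integrable_norm_sq hg
  rw [← integral_const_mul, integral_prod _ i1, integral_prod _ (i2.const_mul _)]
  refine integral_mono_ae i1.integral_prod_left (i2.const_mul _).integral_prod_left ?_
  filter_upwards [h.ae_hasWeakDeriv hI hw hg, ae_memLp_prodMk_left hw, ae_memLp_prodMk_left hg]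
    with x h1 h2 h3
  have := h1.poincare hpq h2 h3
  rw [integral_const_mul]
  exact this

theorem integral_norm_sq_integral_section_le {X : Type*} [MeasurableSpace X] {μ : Measure X}
    [SFinite μ] {w : X × ℝ → ℂ} {p q : ℝ} (hpq : p ≤ q)
    (hw : MemLp w 2 (μ.prod (volume.restrict (Ioo p q)))) :
    ∫ x, ‖∫ y in Ioo p q, w (x, y)‖ ^ 2 ∂μ
      ≤ (q - p) * ∫ z, ‖w z‖ ^ 2 ∂μ.prod (volume.restrict (Ioo p q)) := by
  have i1 := integrable_norm_sq (memLp_integral_section hw)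
  have i2 := integrable_norm_sq hw
  rw [← integral_const_mul, integral_prod _ (i2.const_mul _)]
  refine integral_mono_ae i1 (i2.const_mul _).integral_prod_left ?_
  filter_upwards [ae_memLp_prodMk_left hw] with x hx
  rw [integral_const_mul]
  exact norm_setIntegral_Ioo_sq_le hpq hx

end TwoDim

/-- `w` is an `H¹` function on the rectangle `I × K` with partial derivatives `g₁`, `g₂`. -/
structure H1On (I K : Set ℝ) (w g₁ g₂ : ℝ × ℝ → ℂ) : Prop where
  memLp : MemLp w 2 ((volume.restrict I).prod (volume.restrict K))
  memLp₁ : MemLp g₁ 2 ((volume.restrict I).prod (volume.restrict K))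
  memLp₂ : MemLp g₂ 2 ((volume.restrict I).prod (volume.restrict K))
  deriv₁ : HasWeakDeriv (I ×ˢ K) (1, 0) w g₁
  deriv₂ : HasWeakDeriv (I ×ˢ K) (0, 1) w g₂

theorem MemLp.swap {I K : Set ℝ} {w : ℝ × ℝ → ℂ}
    (h : MemLp w 2 ((volume.restrict I).prod (volume.restrict K))) :
    MemLp (fun z => w z.swap) 2 ((volume.restrict K).prod (volume.restrict I)) := by
  have h' := h
  rw [← Measure.prod_swap] at h'
  exact h'.comp_measurePreserving
    ⟨measurable_swap, by rw [Measure.prod_swap]⟩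

namespace H1On

variable {I K : Set ℝ} {w g₁ g₂ : ℝ × ℝ → ℂ}

/-- The vertical integral of an `H¹` function. -/
theorem hasWeakDeriv_integral {p q : ℝ} (h : H1On I (Ioo p q) w g₁ g₂) :
    HasWeakDeriv I 1 (fun x => ∫ y in Ioo p q, w (x, y)) (fun x => ∫ y in Ioo p q, g₁ (x, y)) :=
  h.deriv₁.hasProdWeakDeriv_swap.hasWeakDeriv_integral (MemLp.swap h.memLp) (MemLp.swap h.memLp₁)

/-- The mean value over a rectangle. -/
def mean (w : ℝ × ℝ → ℂ) (a b p q : ℝ) : ℂ :=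
  (((b - a) * (q - p) : ℝ) : ℂ)⁻¹ *
    ∫ z, w z ∂(volume.restrict (Ioo a b)).prod (volume.restrict (Ioo p q))

/-- The Poincaré inequality on a rectangle. -/
theorem poincare {a b p q : ℝ} (hab : a < b) (hpq : p < q) (h : H1On (Ioo a b) (Ioo p q) w g₁ g₂) :
    ∫ z, ‖w z - mean w a b p q‖ ^ 2 ∂(volume.restrict (Ioo a b)).prod (volume.restrict (Ioo p q))
      ≤ 2 * (b - a) ^ 2
          * (∫ z, ‖g₁ z‖ ^ 2 ∂(volume.restrict (Ioo a b)).prod (volume.restrict (Ioo p q)))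
        + 2 * (q - p) ^ 2
          * ∫ z, ‖g₂ z‖ ^ 2 ∂(volume.restrict (Ioo a b)).prod (volume.restrict (Ioo p q)) := by
  have hqp : 0 < q - p := sub_pos.2 hpq
  have hba : 0 < b - a := sub_pos.2 hab
  set μ := (volume.restrict (Ioo a b)).prod (volume.restrict (Ioo p q)) with hμ
  let S : ℝ → ℂ := fun x => ∫ y in Ioo p q, w (x, y)
  have hS : MemLp S 2 (volume.restrict (Ioo a b)) := memLp_integral_section h.memLp
  have hS' : MemLp (fun x => ∫ y in Ioo p q, g₁ (x, y)) 2 (volume.restrict (Ioo a b)) :=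
    memLp_integral_section h.memLp₁
  have p1 := h.deriv₂.hasProdWeakDeriv.poincare isOpen_Ioo hpq h.memLp h.memLp₂
  have p2 := h.hasWeakDeriv_integral.poincare hab hS hS'
  have p3 := integral_norm_sq_integral_section_le hpq.le h.memLp₁
  have hmean : mean w a b p q
      = ((q - p : ℝ) : ℂ)⁻¹ * (((b - a : ℝ) : ℂ)⁻¹ * ∫ t in Ioo a b, S t) := by
    rw [mean, integral_prod _ (h.memLp.integrable (by norm_num))]
    push_cast
    rw [mul_inv]
    ring
  -- The vertical mean is inserted: `w - A` obeys the inequality in the second variable, and `A -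
  -- mean` the one-dimensional inequality for `S`.
  let A : ℝ × ℝ → ℂ := fun z => ((q - p : ℝ) : ℂ)⁻¹ * S z.1
  have hA : MemLp A 2 μ := (hS.const_mul _).comp_fst _
  have i1 : Integrable (fun z => ‖w z - A z‖ ^ 2) μ := integrable_norm_sq (h.memLp.sub hA)
  have i2 : Integrable (fun z => ‖A z - mean w a b p q‖ ^ 2) μ :=
    integrable_norm_sq (hA.sub (memLp_const (mean w a b p q)))
  have i3 : Integrable (fun z => ‖w z - mean w a b p q‖ ^ 2) μ :=
    integrable_norm_sq (h.memLp.sub (memLp_const (mean w a b p q)))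
  have hle : ∫ z, ‖w z - mean w a b p q‖ ^ 2 ∂μ
      ≤ ∫ z, (2 * ‖w z - A z‖ ^ 2 + 2 * ‖A z - mean w a b p q‖ ^ 2) ∂μ := by
    refine integral_mono i3 ((i1.const_mul 2).add (i2.const_mul 2)) fun z => ?_
    have := norm_add_sq_le_two (w z - A z) (A z - mean w a b p q)
    rwa [sub_add_sub_cancel] at this
  rw [integral_add (i1.const_mul 2) (i2.const_mul 2), integral_const_mul, integral_const_mul] at hle
  have e2 : ∫ z, ‖A z - mean w a b p q‖ ^ 2 ∂μ
      = (q - p)⁻¹ * ∫ x in Ioo a b, ‖S x - ((b - a : ℝ) : ℂ)⁻¹ * ∫ t in Ioo a b, S t‖ ^ 2 := by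
    rw [hμ, integral_prod _ i2, ← integral_const_mul]
    refine integral_congr_ae (.of_forall fun x => ?_)
    simp only [A]
    rw [integral_const, measureReal_restrict_apply_univ, Real.volume_real_Ioo_of_le hpq.le,
      hmean, ← mul_sub, norm_mul, norm_inv, Complex.norm_real, Real.norm_of_nonneg hqp.le,
      smul_eq_mul, mul_pow]
    field_simp
  have e3 : ∫ z, ‖A z - mean w a b p q‖ ^ 2 ∂μ ≤ (b - a) ^ 2 * ∫ z, ‖g₁ z‖ ^ 2 ∂μ := by
    rw [e2]
    calc (q - p)⁻¹ * ∫ x in Ioo a b, ‖S x - ((b - a : ℝ) : ℂ)⁻¹ * ∫ t in Ioo a b, S t‖ ^ 2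
        ≤ (q - p)⁻¹ * ((b - a) ^ 2 * ((q - p) * ∫ z, ‖g₁ z‖ ^ 2 ∂μ)) := by
          gcongr
          exact p2.trans (by gcongr)
      _ = _ := by field_simp
  have p1' : ∫ z, ‖w z - A z‖ ^ 2 ∂μ ≤ (q - p) ^ 2 * ∫ z, ‖g₂ z‖ ^ 2 ∂μ := p1
  linarith

/-- Mean values over nested rectangles. -/
theorem norm_mean_sub_mean_sq_le {a b p q a' b' p' q' : ℝ} (ha : a ≤ a') (hab : a' < b')
    (hb : b' ≤ b) (hp : p ≤ p') (hpq : p' < q') (hq : q' ≤ q)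
    (h : H1On (Ioo a b) (Ioo p q) w g₁ g₂) :
    ‖mean w a' b' p' q' - mean w a b p q‖ ^ 2
      ≤ ((b' - a') * (q' - p'))⁻¹ * (2 * (b - a) ^ 2
          * (∫ z, ‖g₁ z‖ ^ 2 ∂(volume.restrict (Ioo a b)).prod (volume.restrict (Ioo p q)))
        + 2 * (q - p) ^ 2
          * ∫ z, ‖g₂ z‖ ^ 2 ∂(volume.restrict (Ioo a b)).prod (volume.restrict (Ioo p q))) := by
  have hab' : 0 < b' - a' := sub_pos.2 hab
  have hpq' : 0 < q' - p' := sub_pos.2 hpq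
  have hpos : 0 < (b' - a') * (q' - p') := by positivity
  set v := (b' - a') * (q' - p') with hv
  set μ' := (volume.restrict (Ioo a' b')).prod (volume.restrict (Ioo p' q')) with hμ'
  have hle : μ' ≤ (volume.restrict (Ioo a b)).prod (volume.restrict (Ioo p q)) :=
    Measure.prod_mono (Measure.restrict_mono_set _ (Ioo_subset_Ioo ha hb))
      (Measure.restrict_mono_set _ (Ioo_subset_Ioo hp hq))
  have hvol : μ'.real univ = v := by
    rw [hμ', ← univ_prod_univ, measureReal_prod_prod, measureReal_restrict_apply_univ,
      measureReal_restrict_apply_univ, Real.volume_real_Ioo_of_le hab.le,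
      Real.volume_real_Ioo_of_le hpq.le]
  set M := mean w a b p q
  have hm : MemLp (fun z => w z - M) 2
      ((volume.restrict (Ioo a b)).prod (volume.restrict (Ioo p q))) :=
    h.memLp.sub (memLp_const M)
  -- The difference is the mean of `w - M` over the small rectangle, so Cauchy–Schwarz there and
  -- Poincaré on the large rectangle leave one factor `v⁻¹`.
  have e : mean w a' b' p' q' - M = ((v : ℝ) : ℂ)⁻¹ * ∫ z, (w z - M) ∂μ' := by
    rw [integral_sub ((h.memLp.mono_measure hle).integrable (by norm_num)) (integrable_const _),
      integral_const, hvol, mul_sub, Complex.real_smul, inv_mul_cancel_left₀ (by exact_mod_cast hpos.ne')]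
    rfl
  have h1 := norm_integral_sq_le (hm.mono_measure hle)
  rw [hvol] at h1
  have h2 : ∫ z, ‖w z - M‖ ^ 2 ∂μ'
      ≤ ∫ z, ‖w z - M‖ ^ 2 ∂(volume.restrict (Ioo a b)).prod (volume.restrict (Ioo p q)) :=
    integral_mono_measure hle (.of_forall fun _ => by positivity) (integrable_norm_sq hm)
  have h3 := h.poincare (ha.trans_lt (hab.trans_le hb)) (hp.trans_lt (hpq.trans_le hq))
  rw [e, norm_mul, norm_inv, Complex.norm_real, Real.norm_of_nonneg hpos.le, mul_pow]
  calc v⁻¹ ^ 2 * ‖∫ z, (w z - M) ∂μ'‖ ^ 2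
      ≤ v⁻¹ ^ 2 * (v * ∫ z, ‖w z - M‖ ^ 2 ∂μ') := by gcongr
    _ = v⁻¹ * ∫ z, ‖w z - M‖ ^ 2 ∂μ' := by field_simp
    _ ≤ _ := by gcongr; exact h2.trans h3

end H1On

/-- A function that varies by at most `M` when its argument at most doubles grows at most
logarithmically. -/
theorem norm_sub_le_of_doubling {A : ℝ → ℂ} {L M : ℝ}
    (h : ∀ s t, 0 < s → s ≤ t → t ≤ 2 * s → t ≤ L → ‖A s - A t‖ ≤ M) (n : ℕ) :
    ∀ d, 0 < d → d ≤ L → L ≤ 2 ^ n * d → ‖A d - A L‖ ≤ n * M := by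
  induction n with
  | zero =>
    intro d hd hdL hL
    have : d = L := le_antisymm hdL (by simpa using hL)
    simp [this]
  | succ n ih =>
    intro d hd hdL hL
    -- One doubling, stopped at `L`; afterwards `n` steps remain to reach `L`.
    have h1 : d ≤ min (2 * d) L := le_min (by linarith) hdL
    have h2 := h d (min (2 * d) L) hd h1 (min_le_left _ _) (min_le_right _ _)
    have h3 := ih (min (2 * d) L) (hd.trans_le h1) (min_le_right _ _) (by
      rcases min_choice (2 * d) L with h | h
      · rw [h]; rw [pow_succ] at hL; linarith
      · rw [h]
        have : (1 : ℝ) ≤ 2 ^ n := one_le_pow₀ (by norm_num)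
        nlinarith)
    have h4 := norm_sub_le_norm_sub_add_norm_sub (A d) (A (min (2 * d) L)) (A L)
    push_cast
    linarith

theorem norm_sub_le_log_of_doubling {A : ℝ → ℂ} {L M : ℝ}
    (h : ∀ s t, 0 < s → s ≤ t → t ≤ 2 * s → t ≤ L → ‖A s - A t‖ ≤ M) (hM : 0 ≤ M) {d : ℝ}
    (hd : 0 < d) (hdL : d ≤ L) : ‖A d - A L‖ ≤ (1 + 2 * Real.log (L / d)) * M := by
  have h1 : 1 ≤ L / d := (one_le_div hd).2 hdL
  have hlog := Real.log_nonneg h1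
  have hlog2 := Real.log_two_gt_d9
  -- Since `2 log 2 > 1`, this many doublings carry `d` beyond `L`.
  set n := ⌈2 * Real.log (L / d)⌉₊ with hn
  have hn1 : 2 * Real.log (L / d) ≤ n := Nat.le_ceil _
  have hn2 : (n : ℝ) < 2 * Real.log (L / d) + 1 := Nat.ceil_lt_add_one (by positivity)
  have h2 : L ≤ 2 ^ n * d := by
    rw [← div_le_iff₀ hd, ← Real.log_le_log_iff (by positivity) (by positivity), Real.log_pow]
    nlinarith
  refine (norm_sub_le_of_doubling h n d hd hdL h2).trans ?_
  gcongr
  linarith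

end Waveguide

namespace Waveguide

namespace Params

/-! ### Geometry of `Ω_ε` -/

variable {p : Params} {ε₀ ε : ℝ}

/-- One of `γ` and `γ⁻¹` is at most `1`. -/
theorem Admissible.lt_one' (h : p.Admissible ε₀) : ε₀ < 1 := by
  have h3 := h.lt_three
  have hγ := p.γ_pos
  rcases le_or_gt p.γ 1 with h1 | h1
  · exact (h3.trans_le (min_le_left _ _)).trans_le h1
  · exact (h3.trans_le (min_le_right _ _)).trans (inv_lt_one_of_one_lt₀ h1)

theorem h_pos (hε : 0 < ε) : 0 < p.h ε := Real.rpow_pos_of_pos hε _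

theorem b_pos (hε : 0 < ε) : 0 < p.b ε := Real.rpow_pos_of_pos hε _

theorem d_pos (hε : 0 < ε) : 0 < p.d ε := mul_pos p.γ_pos (Real.rpow_pos_of_pos hε _)

theorem d_eq (hε : 0 < ε) : p.d ε = p.γ * ε * p.h ε := by
  rw [d, h, Real.rpow_add hε, Real.rpow_one]
  ring

/-- The condition `ε₀ < (2γ)^{-1/α}`, raised to the power `α`. Together with `d = γ ε h` it makes
the gate narrower than the strip is high. -/
theorem Admissible.gamma_mul_h_lt (h : p.Admissible ε₀) (hε : ε ∈ Ioc 0 ε₀) :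
    p.γ * p.h ε < 1 / 2 := by
  have hγ := p.γ_pos
  have h1 : ε < (2 * p.γ) ^ (-1 / p.α) := hε.2.trans_lt h.lt_one
  have h2 := Real.rpow_lt_rpow hε.1.le h1 p.α_pos
  rw [← Real.rpow_mul (by positivity), div_mul_cancel₀ _ p.α_pos.ne', Real.rpow_neg_one] at h2
  have h3 : p.γ * p.h ε < p.γ * (2 * p.γ)⁻¹ := by
    rw [Params.h]; gcongr
  refine h3.trans_eq ?_
  field_simp

theorem Admissible.d_lt_eps (h : p.Admissible ε₀) (hε : ε ∈ Ioc 0 ε₀) : p.d ε < ε := by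
  have h1 := h.gamma_mul_h_lt hε
  rw [d_eq hε.1]
  nlinarith [hε.1]

/-- The quotient of the two widths is `γ ε^{α+1-β}`, which `ε₀ < γ^{-1/(α+1-β)}` keeps below `1`. -/
theorem Admissible.d_lt_b (h : p.Admissible ε₀) (hε : ε ∈ Ioc 0 ε₀) : p.d ε < p.b ε := by
  have hγ := p.γ_pos
  have he : 0 < p.α + 1 - p.β := by linarith [p.α_pos, p.β_lt]
  have h1 : ε < p.γ ^ (-1 / (p.α + 1 - p.β)) := hε.2.trans_lt h.lt_two
  have h2 := Real.rpow_lt_rpow hε.1.le h1 he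
  rw [← Real.rpow_mul hγ.le, div_mul_cancel₀ _ he.ne', Real.rpow_neg_one] at h2
  have h3 : ε ^ (p.α + 1) = ε ^ (p.α + 1 - p.β) * ε ^ p.β := by
    rw [← Real.rpow_add hε.1]; ring_nf
  have h4 : p.γ * ε ^ (p.α + 1 - p.β) < 1 := by
    calc p.γ * ε ^ (p.α + 1 - p.β) < p.γ * p.γ⁻¹ := by gcongr
      _ = 1 := mul_inv_cancel₀ hγ.ne'
  have hb : 0 < ε ^ p.β := Real.rpow_pos_of_pos hε.1 _
  rw [d, b, h3]
  nlinarith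

theorem Admissible.Ioo_subset (h : p.Admissible ε₀) : Ioo (-ε₀) ε₀ ⊆ p.Omega0 := by
  intro x hx
  refine ⟨?_, lt_trans (EReal.coe_lt_coe_iff.2 hx.2) h.lt_right⟩
  have h1 : ((-ε₀ : ℝ) : EReal) < x := EReal.coe_lt_coe_iff.2 hx.1
  refine lt_trans ?_ h1
  rw [EReal.coe_neg]
  exact EReal.lt_neg_comm.1 h.lt_left

theorem ordConnected_Omega0 (p : Params) : p.Omega0.OrdConnected :=
  ⟨fun _ hx _ hy _ hz => ⟨hx.1.trans_le (EReal.coe_le_coe_iff.2 hz.1),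
    lt_of_le_of_lt (EReal.coe_le_coe_iff.2 hz.2) hy.2⟩⟩

theorem zero_mem_Omega0 (p : Params) : (0 : ℝ) ∈ p.Omega0 :=
  ⟨by simpa using p.lm_neg, by simpa using p.lp_pos⟩

theorem passage_eq (p : Params) (ε : ℝ) :
    p.passage ε = Ioo (-(p.d ε / 2)) (p.d ε / 2) ×ˢ Ioo 0 (p.h ε) := by
  ext z
  simp [passage, abs_lt]

theorem room_eq (p : Params) (ε : ℝ) :
    p.room ε = Ioo (-(p.b ε / 2)) (p.b ε / 2) ×ˢ Ioo (p.h ε) (p.h ε + p.b ε) := by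
  ext z
  simp [room, abs_lt]

theorem passage_subset (p : Params) (ε : ℝ) : p.passage ε ⊆ p.Omega ε :=
  interior_maximal (fun _ hx => subset_closure (Or.inl (Or.inr hx))) (p.isOpen_passage ε)

theorem isOpen_Omega (p : Params) (ε : ℝ) : IsOpen (p.Omega ε) := isOpen_interior

/-- A neighbourhood of every point of `Ω_ε` lies in the union of the three closed pieces. -/
theorem exists_nhd_of_mem_Omega {z : ℝ × ℝ} (hz : z ∈ p.Omega ε) :
    ∃ r > 0, ∀ x y : ℝ, |x - z.1| < r → |y - z.2| < r →
      ((p.lm ≤ x ∧ (x : EReal) ≤ p.lp) ∧ y ∈ Icc (-ε) 0) ∨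
      (|x| ≤ p.d ε / 2 ∧ y ∈ Icc 0 (p.h ε)) ∨
      (|x| ≤ p.b ε / 2 ∧ y ∈ Icc (p.h ε) (p.h ε + p.b ε)) := by
  -- A closed set containing the three pieces, hence their closure. Its inequalities are weak;
  -- strict ones are recovered later by moving the point inside its neighbourhood.
  let F : Set (ℝ × ℝ) := {z | (p.lm ≤ z.1 ∧ (z.1 : EReal) ≤ p.lp) ∧ z.2 ∈ Icc (-ε) 0} ∪
    ({z | |z.1| ≤ p.d ε / 2 ∧ z.2 ∈ Icc 0 (p.h ε)} ∪
      {z | |z.1| ≤ p.b ε / 2 ∧ z.2 ∈ Icc (p.h ε) (p.h ε + p.b ε)})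
  have hc : Continuous fun z : ℝ × ℝ => (z.1 : EReal) :=
    continuous_coe_real_ereal.comp continuous_fst
  have hF : IsClosed F := by
    refine IsClosed.union ?_ (IsClosed.union ?_ ?_)
    · exact ((isClosed_le continuous_const hc).inter (isClosed_le hc continuous_const)).inter
        (isClosed_Icc.preimage continuous_snd)
    · exact (isClosed_le (continuous_abs.comp continuous_fst) continuous_const).inter
        (isClosed_Icc.preimage continuous_snd)
    · exact (isClosed_le (continuous_abs.comp continuous_fst) continuous_const).inter
        (isClosed_Icc.preimage continuous_snd)
  have hsub : closure (p.strip ε ∪ p.passage ε ∪ p.room ε) ⊆ F := by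
    refine closure_minimal ?_ hF
    rintro z ((⟨h1, h2⟩ | ⟨h1, h2⟩) | ⟨h1, h2⟩)
    · exact Or.inl ⟨⟨h1.1.le, h1.2.le⟩, Ioo_subset_Icc_self h2⟩
    · exact Or.inr (Or.inl ⟨h1.le, Ioo_subset_Icc_self h2⟩)
    · exact Or.inr (Or.inr ⟨h1.le, Ioo_subset_Icc_self h2⟩)
  have hz' : F ∈ 𝓝 z := mem_interior_iff_mem_nhds.1 (interior_mono hsub hz)
  obtain ⟨r, hr, hball⟩ := Metric.mem_nhds_iff.1 hz'
  refine ⟨r, hr, fun x y hx hy => hball (?_ : (x, y) ∈ _)⟩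
  rw [Metric.mem_ball, Prod.dist_eq, Real.dist_eq, Real.dist_eq]
  exact max_lt hx hy

/-- Sharpens `|x| ≤ c` to `|x| < c` at interior points: a neighbour farther from the origin obeys
the weak bound too. -/
theorem exists_abs_gt (x : ℝ) {r : ℝ} (hr : 0 < r) : ∃ x', |x' - x| < r ∧ |x| < |x'| := by
  rcases le_or_gt 0 x with h | h
  · refine ⟨x + r / 2, ?_, ?_⟩
    · rw [add_sub_cancel_left, abs_of_pos (by linarith)]; linarith
    · rw [abs_of_nonneg h, abs_of_nonneg (by linarith)]; linarith
  · refine ⟨x - r / 2, ?_, ?_⟩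
    · rw [sub_sub_cancel_left, abs_neg, abs_of_pos (by linarith)]; linarith
    · rw [abs_of_neg h, abs_of_neg (by linarith)]; linarith

/-- Below level `0` only the closed strip is available to nearby points, and shifts by `r / 2` make
its inequalities strict. -/
theorem mem_strip_of_mem_Omega (hε : 0 < ε) {z : ℝ × ℝ} (hz : z ∈ p.Omega ε) (h : z.2 < 0) :
    z ∈ p.strip ε := by
  obtain ⟨r, hr, H⟩ := exists_nhd_of_mem_Omega hz
  have hh := p.h_pos hε
  have H' : ∀ x y : ℝ, |x - z.1| < r → |y - z.2| < r → y < 0 →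
      (p.lm ≤ x ∧ (x : EReal) ≤ p.lp) ∧ y ∈ Icc (-ε) 0 := by
    intro x y hx hy hy0
    rcases H x y hx hy with h1 | ⟨-, h1⟩ | ⟨-, h1⟩
    · exact h1
    · linarith [h1.1]
    · linarith [h1.1]
  have hr2 : |r / 2| < r := by rw [abs_of_pos (by linarith)]; linarith
  have a1 := H' (z.1 - r / 2) z.2 (by simpa using hr2) (by simpa using hr) h
  have a2 := H' (z.1 + r / 2) z.2 (by simpa using hr2) (by simpa using hr) h
  have a3 := H' z.1 (z.2 - r / 2) (by simpa using hr) (by simpa using hr2) (by linarith)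
  refine ⟨⟨lt_of_le_of_lt a1.1.1 ?_, lt_of_lt_of_le ?_ a2.1.2⟩, ?_, h⟩
  · exact EReal.coe_lt_coe_iff.2 (by linarith)
  · exact EReal.coe_lt_coe_iff.2 (by linarith)
  · linarith [a3.2.1]

/-- The levels `0` and `h` are included: `Ω_ε` meets these lines only in the gates, because some
neighbour at a height strictly between them must lie in the closed passage. -/
theorem abs_lt_of_mem_Omega (hε : 0 < ε) {z : ℝ × ℝ} (hz : z ∈ p.Omega ε) (h0 : 0 ≤ z.2)
    (h1 : z.2 ≤ p.h ε) : |z.1| < p.d ε / 2 := by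
  obtain ⟨r, hr, H⟩ := exists_nhd_of_mem_Omega hz
  have hh := p.h_pos hε
  obtain ⟨x', hx', hx''⟩ := exists_abs_gt z.1 hr
  obtain ⟨y', hy', hy0, hyh⟩ : ∃ y', |y' - z.2| < r ∧ 0 < y' ∧ y' < p.h ε := by
    have hm : 0 < min (r / 2) (p.h ε / 2) := by positivity
    have hm1 := min_le_left (r / 2) (p.h ε / 2)
    have hm2 := min_le_right (r / 2) (p.h ε / 2)
    rcases le_or_gt z.2 (p.h ε / 2) with h | h
    · rcases h0.eq_or_lt with h0 | h0
      · refine ⟨z.2 + min (r / 2) (p.h ε / 2), ?_, by linarith, by linarith⟩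
        rw [add_sub_cancel_left, abs_of_pos hm]
        linarith
      · exact ⟨z.2, by simpa using hr, h0, by linarith⟩
    · refine ⟨z.2 - min (r / 2) (p.h ε / 2), ?_, by linarith, by linarith⟩
      rw [sub_sub_cancel_left, abs_neg, abs_of_pos hm]
      linarith
  rcases H x' y' hx' hy' with ⟨-, h2⟩ | ⟨h2, -⟩ | ⟨-, h2⟩
  · linarith [h2.2]
  · linarith
  · linarith [h2.1]

theorem mem_room_of_mem_Omega (hε : 0 < ε) {z : ℝ × ℝ} (hz : z ∈ p.Omega ε) (h1 : p.h ε < z.2) :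
    z ∈ p.room ε := by
  obtain ⟨r, hr, H⟩ := exists_nhd_of_mem_Omega hz
  have hh := p.h_pos hε
  obtain ⟨x', hx', hx''⟩ := exists_abs_gt z.1 hr
  have H' : ∀ x y : ℝ, |x - z.1| < r → |y - z.2| < r → p.h ε < y →
      |x| ≤ p.b ε / 2 ∧ y ∈ Icc (p.h ε) (p.h ε + p.b ε) := by
    intro x y hx hy hy0
    rcases H x y hx hy with ⟨-, h1⟩ | ⟨-, h1⟩ | h1
    · linarith [h1.2]
    · linarith [h1.2]
    · exact h1
  have hr2 : |r / 2| < r := by rw [abs_of_pos (by linarith)]; linarith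
  have a1 := H' x' z.2 hx' (by simpa using hr) h1
  have a2 := H' z.1 (z.2 + r / 2) (by simpa using hr) (by simpa using hr2) (by linarith)
  exact ⟨hx''.trans_le a1.1, h1, by linarith [a2.2.2]⟩

theorem mem_passage_of_mem_Omega (hε : 0 < ε) {z : ℝ × ℝ} (hz : z ∈ p.Omega ε) (h0 : 0 < z.2)
    (h1 : z.2 < p.h ε) : z ∈ p.passage ε :=
  ⟨abs_lt_of_mem_Omega hε hz h0.le h1.le, h0, h1⟩

/-- The open column over the gate crosses both interfaces. It lies in the closure of the pieces and
is open, hence lies in `Ω_ε`. This is what connects strip, passage and room. -/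
theorem column_subset_Omega (h : p.Admissible ε₀) (hε : ε ∈ Ioc 0 ε₀) :
    Ioo (-(p.d ε / 2)) (p.d ε / 2) ×ˢ Ioo (-ε) (p.h ε + p.b ε) ⊆ p.Omega ε := by
  refine interior_maximal ?_ (isOpen_Ioo.prod isOpen_Ioo)
  rintro ⟨x, y⟩ ⟨hx, hy⟩
  simp only at hx hy
  have hd := h.d_lt_eps hε
  have hdb := h.d_lt_b hε
  rcases lt_or_ge y 0 with h0 | h0
  · refine subset_closure (Or.inl (Or.inl ⟨h.Ioo_subset ⟨?_, ?_⟩, hy.1, h0⟩))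
    · linarith [hx.1, hε.2, hε.1]
    · linarith [hx.2, hε.2, hε.1]
  rcases le_or_gt y (p.h ε) with h1 | h1
  · refine closure_mono (subset_union_right.trans subset_union_left :
      p.passage ε ⊆ p.strip ε ∪ p.passage ε ∪ p.room ε) ?_
    rw [passage_eq, closure_prod_eq, closure_Ioo (p.h_pos hε.1).ne]
    exact ⟨subset_closure hx, h0, h1⟩
  · refine subset_closure (Or.inr ?_)
    rw [room_eq]
    exact ⟨⟨by linarith [hx.1], by linarith [hx.2]⟩, h1, hy.2⟩

/-- Only points at the levels `0` and `h` are lost, and horizontal lines are null sets. -/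
theorem ae_mem_pieces (hε : 0 < ε) : ∀ᵐ z ∂volume.restrict (p.Omega ε),
    z ∈ p.strip ε ∨ z ∈ p.passage ε ∨ z ∈ p.room ε := by
  have hnull : ∀ c : ℝ, ∀ᵐ z : ℝ × ℝ, z.2 ≠ c := by
    intro c
    have h : ∀ᵐ y : ℝ, y ≠ c := by simp [ae_iff]
    exact (Measure.quasiMeasurePreserving_snd (μ := (volume : Measure ℝ))
      (ν := (volume : Measure ℝ))).ae h
  filter_upwards [ae_restrict_of_ae (hnull 0), ae_restrict_of_ae (hnull (p.h ε)),
    ae_restrict_mem (p.isOpen_Omega ε).measurableSet] with z h0 h1 hz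
  rcases lt_or_gt_of_ne h0 with h0 | h0
  · exact Or.inl (mem_strip_of_mem_Omega hε hz h0)
  rcases lt_or_gt_of_ne h1 with h1 | h1
  · exact Or.inr (Or.inl (mem_passage_of_mem_Omega hε hz h0 h1))
  · exact Or.inr (Or.inr (mem_room_of_mem_Omega hε hz h1))

theorem disjoint_strip_passage (p : Params) (ε : ℝ) : Disjoint (p.strip ε) (p.passage ε) :=
  Set.disjoint_left.2 fun _ h1 h2 => lt_asymm h1.2.2 h2.2.1

theorem disjoint_strip_room (hε : 0 < ε) : Disjoint (p.strip ε) (p.room ε) :=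
  Set.disjoint_left.2 fun _ h1 h2 => lt_asymm (h1.2.2.trans (p.h_pos hε)) h2.2.1

theorem disjoint_passage_room (p : Params) (ε : ℝ) : Disjoint (p.passage ε) (p.room ε) :=
  Set.disjoint_left.2 fun _ h1 h2 => lt_asymm h1.2.2 h2.2.1

theorem setIntegral_Omega {E : Type*} [NormedAddCommGroup E] [NormedSpace ℝ E] (hε : 0 < ε)
    {f : ℝ × ℝ → E} (hf : IntegrableOn f (p.Omega ε)) :
    ∫ z in p.Omega ε, f z
      = (∫ z in p.strip ε, f z) + (∫ z in p.passage ε, f z) + ∫ z in p.room ε, f z := by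
  have hS := hf.mono_set (p.strip_subset ε)
  have hP := hf.mono_set (p.passage_subset ε)
  have hR := hf.mono_set (p.room_subset ε)
  have he : p.Omega ε =ᵐ[volume] (p.strip ε ∪ p.passage ε ∪ p.room ε : Set (ℝ × ℝ)) := by
    have h := (ae_restrict_iff' (p.isOpen_Omega ε).measurableSet).1 (p.ae_mem_pieces hε)
    filter_upwards [h] with z hz
    refine propext ⟨fun h => ?_, ?_⟩
    · rcases hz h with h | h | h
      · exact Or.inl (Or.inl h)
      · exact Or.inl (Or.inr h)
      · exact Or.inr h
    · rintro ((h | h) | h)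
      · exact p.strip_subset ε h
      · exact p.passage_subset ε h
      · exact p.room_subset ε h
  rw [setIntegral_congr_set he, setIntegral_union
    (Disjoint.union_left (p.disjoint_strip_room hε) (p.disjoint_passage_room ε))
    (p.isOpen_room ε).measurableSet (hS.union hP) hR,
    setIntegral_union (p.disjoint_strip_passage ε) (p.isOpen_passage ε).measurableSet hS hP]

end Params

end Waveguide

namespace Waveguide

/-! ### Multiplication operators -/

section Multiplication

variable {X : Type*} [MeasurableSpace X] {μ : Measure X}

/-- Multiplication by a bounded real function on `L²`. -/
def mulLp {m : X → ℝ} (hm : MemLp m ∞ μ) : Lp ℂ 2 μ →L[ℂ] Lp ℂ 2 μ :=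
  (ContinuousLinearMap.mul ℂ ℂ).holderL μ ∞ 2 2 (hm.ofReal (K := ℂ)).toLp

theorem mulLp_coeFn {m : X → ℝ} (hm : MemLp m ∞ μ) (u : Lp ℂ 2 μ) :
    mulLp hm u =ᵐ[μ] fun x => (m x : ℂ) * u x := by
  have h1 := (ContinuousLinearMap.mul ℂ ℂ).coeFn_holder (r := 2) (hm.ofReal (K := ℂ)).toLp u
  filter_upwards [h1, (hm.ofReal (K := ℂ)).coeFn_toLp] with x hx hx'
  have : mulLp hm u = (ContinuousLinearMap.mul ℂ ℂ).holder 2 (hm.ofReal (K := ℂ)).toLp u := rfl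
  rw [this, hx, hx']
  simp

theorem inner_mulLp {m : X → ℝ} (hm : MemLp m ∞ μ) (u v : Lp ℂ 2 μ) :
    inner ℂ v (mulLp hm u) = ∫ x, (m x : ℂ) * u x * star (v x) ∂μ := by
  rw [L2.inner_def]
  refine integral_congr_ae ?_
  filter_upwards [mulLp_coeFn hm u] with x hx
  rw [hx]
  simp

theorem memLp_sqrt {m : X → ℝ} (hm : MemLp m ∞ μ) : MemLp (fun x => √(m x)) ∞ μ := by
  have h1 : AEStronglyMeasurable (fun x => √(m x)) μ :=
    Real.continuous_sqrt.comp_aestronglyMeasurable hm.1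
  refine memLp_top_of_bound h1 (1 + (eLpNorm m ∞ μ).toReal) ?_
  have h2 := ae_le_eLpNormEssSup (f := m) (μ := μ)
  filter_upwards [h2] with x hx
  have hfin : eLpNormEssSup m μ ≠ ∞ := by
    have := hm.2.ne
    rwa [eLpNorm_exponent_top] at this
  have h3 : ‖m x‖ ≤ (eLpNorm m ∞ μ).toReal := by
    rw [eLpNorm_exponent_top]
    have := ENNReal.toReal_mono hfin hx
    simpa using this
  rw [Real.norm_of_nonneg (Real.sqrt_nonneg _)]
  refine Real.sqrt_le_iff.2 ⟨by positivity, ?_⟩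
  have h4 := Real.le_norm_self (m x)
  nlinarith [ENNReal.toReal_nonneg (a := eLpNorm m ∞ μ)]

/-- Splitting `m` into square roots displays the potential term as an inner product, from which its
symmetry and positivity are visible. -/
theorem inner_mulLp_sqrt {m : X → ℝ} (hm : MemLp m ∞ μ) (h0 : ∀ᵐ x ∂μ, 0 ≤ m x) (u v : Lp ℂ 2 μ) :
    inner ℂ (mulLp (memLp_sqrt hm) v) (mulLp (memLp_sqrt hm) u)
      = ∫ x, (m x : ℂ) * u x * star (v x) ∂μ := by
  rw [L2.inner_def]
  refine integral_congr_ae ?_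
  filter_upwards [mulLp_coeFn (memLp_sqrt hm) u, mulLp_coeFn (memLp_sqrt hm) v, h0] with x hx hx' h0
  rw [hx, hx']
  have : (√(m x) : ℂ) * √(m x) = m x := by
    rw [← Complex.ofReal_mul, Real.mul_self_sqrt h0]
  simp only [RCLike.inner_apply, map_mul, Complex.conj_ofReal]
  rw [← this]
  simp only [Complex.star_def]
  ring

end Multiplication

theorem inner_L2_eq {X : Type*} [MeasurableSpace X] {μ : Measure X} (u v : Lp ℂ 2 μ) :
    inner ℂ v u = ∫ x, u x * star (v x) ∂μ := by
  rw [L2.inner_def]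
  simp

theorem norm_L2_sq {X : Type*} [MeasurableSpace X] {μ : Measure X} (u : Lp ℂ 2 μ) :
    ‖u‖ ^ 2 = ∫ x, ‖u x‖ ^ 2 ∂μ := by
  have h := inner_L2_eq u u
  rw [inner_self_eq_norm_sq_to_K] at h
  have e : ∀ x, u x * star (u x) = ((‖u x‖ ^ 2 : ℝ) : ℂ) := fun x => by
    rw [Complex.star_def, Complex.mul_conj, Complex.normSq_eq_norm_sq]
  simp_rw [e] at h
  rw [integral_complex_ofReal] at h
  exact Complex.ofReal_injective (by push_cast at h ⊢; exact h)

theorem integrable_mul_star {X : Type*} [MeasurableSpace X] {μ : Measure X} (u v : Lp ℂ 2 μ) :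
    Integrable (fun x => u x * star (v x)) μ := by
  have := L2.integrable_inner (𝕜 := ℂ) v u
  simpa using this

namespace Params

variable {p : Params} {ε₀ ε : ℝ}

/-! ### The identification operators are mutually adjoint -/

theorem inner_stripLift (f : L2 p.Omega0) (u : p.HEps ε) :
    inner ℂ u (p.stripLift ε f) = inner ℂ (p.stripIntegral ε u) f := by
  have e1 : p.stripLift ε f =ᵐ[volume.restrict (p.Omega ε)]
      (p.strip ε).indicator fun x => f x.1 := (p.memLp_stripLift ε f).coeFn_toLp
  have e2 : p.stripIntegral ε u =ᵐ[volume.restrict p.Omega0]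
      fun x₁ : ℝ => ∫ x₂ in Ioo (-ε) 0, u (x₁, x₂) := (p.memLp_stripMean ε u).coeFn_toLp
  rw [inner_L2_eq, inner_L2_eq]
  have a1 : ∫ x in p.Omega ε, p.stripLift ε f x * star (u x)
      = ∫ x in p.Omega ε, (p.strip ε).indicator (fun x => f x.1 * star (u x)) x := by
    refine integral_congr_ae ?_
    filter_upwards [e1] with x hx
    rw [hx]
    by_cases hs : x ∈ p.strip ε <;> simp [hs]
  have hf : MemLp (fun x : ℝ × ℝ => f x.1) 2
      ((volume.restrict p.Omega0).prod (volume.restrict (Ioo (-ε) 0))) := (Lp.memLp f).comp_fst _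
  have hi : Integrable (fun x : ℝ × ℝ => f x.1 * star (u x))
      ((volume.restrict p.Omega0).prod (volume.restrict (Ioo (-ε) 0))) :=
    MemLp.integrable_mul (p := 2) (q := 2) hf (p.memLp_on_strip ε u).star
  rw [a1, integral_indicator (p.isOpen_strip ε).measurableSet, p.restrict_strip' ε,
    integral_prod _ hi]
  refine integral_congr_ae ?_
  filter_upwards [e2] with x hx
  rw [hx, integral_const_mul]
  congr 1
  exact integral_conj

/-- Exact adjointness: the third requirement of quasi-unitary equivalence holds without error. -/
theorem inner_J (f : p.HZero) (u : p.HEps ε) :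
    inner ℂ u (p.J ε f) = inner ℂ (p.Jtilde ε u) f := by
  have e1 : p.J ε f = ((ε ^ (-1 / 2 : ℝ) : ℝ) : ℂ) • p.stripLift ε f.fst
      + (((p.b ε)⁻¹ : ℝ) : ℂ) • (f.snd • indicatorConstLp 2 (p.isOpen_room ε).measurableSet
        (p.volume_room_ne_top ε) (1 : ℂ)) := rfl
  have e2 : (p.Jtilde ε u).fst = ((ε ^ (-1 / 2 : ℝ) : ℝ) : ℂ) • p.stripIntegral ε u := rfl
  have e3 : (p.Jtilde ε u).snd = (((p.b ε)⁻¹ : ℝ) : ℂ) * p.roomIntegral ε u := rfl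
  have e4 : p.roomIntegral ε u = inner ℂ (indicatorConstLp 2 (p.isOpen_room ε).measurableSet
        (p.volume_room_ne_top ε) (1 : ℂ)) u := rfl
  have e5 : inner ℂ (p.Jtilde ε u) f
      = inner ℂ (p.Jtilde ε u).fst f.fst + inner ℂ (p.Jtilde ε u).snd f.snd := rfl
  rw [e5, e2, e3, e4, e1, inner_add_right, inner_smul_right, inner_smul_right, inner_smul_right,
    inner_smul_left, inner_stripLift, Complex.conj_ofReal, RCLike.inner_apply, map_mul,
    inner_conj_symm, Complex.conj_ofReal]
  ring

theorem eps_rpow_mul_self (hε : 0 < ε) :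
    ((ε ^ (-1 / 2 : ℝ) : ℝ) : ℂ) * ((ε ^ (-1 / 2 : ℝ) : ℝ) : ℂ) * ε = 1 := by
  rw [← Complex.ofReal_mul, ← Real.rpow_add hε, ← Complex.ofReal_mul]
  norm_num [Real.rpow_neg_one, hε.ne']

/-- The factors `ε^{-1/2}` and `b⁻¹`, each occurring twice, cancel the height `ε` of the strip and
the area `b²` of the room. -/
theorem Jtilde_J (hε : 0 < ε) (f : p.HZero) : p.Jtilde ε (p.J ε f) = f := by
  have hb := p.b_pos hε
  have h1 : (p.Jtilde ε (p.J ε f)).fst = f.fst := by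
    refine Lp.ext ?_
    filter_upwards [p.Jtilde_fst_ae ε (p.J ε f), p.ae_strip ε (p.J_apply_ae ε f),
      ae_restrict_mem p.isOpen_Omega0.measurableSet] with x h1 h2 hx
    rw [h1]
    have : ∫ y in Ioo (-ε) 0, p.J ε f (x, y)
        = ∫ y in Ioo (-ε) 0, ((ε ^ (-1 / 2 : ℝ) : ℝ) : ℂ) * f.fst x := by
      refine integral_congr_ae ?_
      filter_upwards [h2, ae_restrict_mem measurableSet_Ioo] with y hy hym
      have hmem : (x, y) ∈ p.strip ε := ⟨hx, hym⟩
      rw [hy, if_pos hmem]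
    rw [this, setIntegral_const, Real.volume_real_Ioo_of_le (by linarith), Complex.real_smul]
    have := eps_rpow_mul_self hε
    push_cast
    rw [zero_sub, neg_neg]
    linear_combination f.fst x * this
  have h2 : (p.Jtilde ε (p.J ε f)).snd = f.snd := by
    rw [Jtilde_snd]
    have : ∫ x in p.room ε, p.J ε f x = ∫ x in p.room ε, (((p.b ε)⁻¹ : ℝ) : ℂ) * f.snd := by
      refine integral_congr_ae ?_
      filter_upwards [ae_restrict_of_ae_restrict_of_subset (p.room_subset ε) (p.J_apply_ae ε f),
        ae_restrict_mem (p.isOpen_room ε).measurableSet] with x hx hxm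
      rw [hx, if_neg fun h => (p.disjoint_strip_room hε).le_bot ⟨h, hxm⟩, if_pos hxm]
    have hvol : volume.real (p.room ε) = p.b ε * p.b ε := by
      rw [room_eq, Measure.volume_eq_prod, measureReal_prod_prod,
        Real.volume_real_Ioo_of_le (by linarith), Real.volume_real_Ioo_of_le (by linarith)]
      ring
    rw [this, setIntegral_const, hvol, Complex.real_smul]
    push_cast
    have : (p.b ε : ℂ) ≠ 0 := by exact_mod_cast hb.ne'
    field_simp
  exact WithLp.ofLp_injective 2 (Prod.ext h1 h2)

/-- An operator with a left inverse equal to its adjoint is an isometry. -/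
theorem norm_J (hε : 0 < ε) (f : p.HZero) : ‖p.J ε f‖ = ‖f‖ := by
  have h := p.inner_J f (p.J ε f)
  rw [Jtilde_J hε, inner_self_eq_norm_sq_to_K, inner_self_eq_norm_sq_to_K] at h
  have h' : ‖p.J ε f‖ ^ 2 = ‖f‖ ^ 2 := by exact_mod_cast h
  exact (pow_left_inj₀ (norm_nonneg _) (norm_nonneg _) two_ne_zero).1 h'

theorem norm_Jtilde_le (hε : 0 < ε) (u : p.HEps ε) : ‖p.Jtilde ε u‖ ≤ ‖u‖ := by
  refine norm_le_of_forall_inner_le (norm_nonneg u) fun f => ?_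
  rw [← inner_conj_symm, ← inner_J, RCLike.norm_conj]
  refine (norm_inner_le_norm _ _).trans_eq ?_
  rw [norm_J hε]

/-! ### The form `a_ε` -/

theorem memLp_potential {V₀ : ℝ → ℝ} (hV : MemLp V₀ ∞ (volume.restrict p.Omega0)) :
    MemLp (p.potential ε V₀) ∞ (volume.restrict (p.Omega ε)) := by
  classical
  have : p.potential ε V₀ = (p.strip ε).indicator fun x => V₀ x.1 := by
    ext x
    by_cases hx : x ∈ p.strip ε <;> simp [potential, hx]
  rw [this, memLp_indicator_iff_restrict (p.isOpen_strip ε).measurableSet, p.restrict_strip' ε]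
  exact hV.comp_fst _

theorem potential_nonneg {V₀ : ℝ → ℝ} (hV : ∀ᵐ x ∂volume.restrict p.Omega0, 0 ≤ V₀ x) :
    ∀ᵐ x ∂volume.restrict (p.Omega ε), 0 ≤ p.potential ε V₀ x := by
  have h : ∀ᵐ x ∂(volume.restrict (p.Omega ε)).restrict (p.strip ε), 0 ≤ V₀ x.1 := by
    rw [p.restrict_strip' ε]
    exact Measure.quasiMeasurePreserving_fst.ae hV
  filter_upwards [ae_imp_of_ae_restrict h] with x hx
  by_cases hs : x ∈ p.strip ε
  · simp [potential, hs, hx hs]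
  · simp [potential, hs]

variable {V₀ : ℝ → ℝ}

theorem formEps_apply (hV : MemLp V₀ ∞ (volume.restrict p.Omega0)) (u v : p.HEps ε) :
    (p.formEps ε V₀).form u v
      = inner ℂ (weakDeriv (p.Omega ε) (1, 0) v) (weakDeriv (p.Omega ε) (1, 0) u)
        + inner ℂ (weakDeriv (p.Omega ε) (0, 1) v) (weakDeriv (p.Omega ε) (0, 1) u)
        + inner ℂ v (mulLp (memLp_potential hV) u) := by
  rw [inner_L2_eq, inner_L2_eq, inner_mulLp]
  have i3 : Integrable (fun x => (p.potential ε V₀ x : ℂ) * u x * star (v x))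
      (volume.restrict (p.Omega ε)) := by
    refine (integrable_mul_star (mulLp (memLp_potential hV) u) v).congr ?_
    filter_upwards [mulLp_coeFn (memLp_potential hV) u] with x hx
    rw [hx]
  have i12 : Integrable (fun x =>
      weakDeriv (p.Omega ε) (1, 0) u x * star (weakDeriv (p.Omega ε) (1, 0) v x)
        + weakDeriv (p.Omega ε) (0, 1) u x * star (weakDeriv (p.Omega ε) (0, 1) v x))
      (volume.restrict (p.Omega ε)) := (integrable_mul_star _ _).add (integrable_mul_star _ _)
  rw [← integral_add (integrable_mul_star _ _) (integrable_mul_star _ _),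
    ← integral_add i12 i3]
  rfl

theorem formEps_apply_sqrt (hV : MemLp V₀ ∞ (volume.restrict p.Omega0))
    (hV0 : ∀ᵐ x ∂volume.restrict p.Omega0, 0 ≤ V₀ x) (u v : p.HEps ε) :
    (p.formEps ε V₀).form u v
      = inner ℂ (weakDeriv (p.Omega ε) (1, 0) v) (weakDeriv (p.Omega ε) (1, 0) u)
        + inner ℂ (weakDeriv (p.Omega ε) (0, 1) v) (weakDeriv (p.Omega ε) (0, 1) u)
        + inner ℂ (mulLp (memLp_sqrt (memLp_potential hV)) v)
          (mulLp (memLp_sqrt (memLp_potential hV)) u) := by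
  rw [formEps_apply hV, inner_mulLp_sqrt (memLp_potential hV) (potential_nonneg hV0), inner_mulLp]

theorem formEps_symm (hV : MemLp V₀ ∞ (volume.restrict p.Omega0))
    (hV0 : ∀ᵐ x ∂volume.restrict p.Omega0, 0 ≤ V₀ x) (u v : p.HEps ε) :
    (p.formEps ε V₀).form u v = star ((p.formEps ε V₀).form v u) := by
  rw [formEps_apply_sqrt hV hV0, formEps_apply_sqrt hV hV0, star_add, star_add]
  congr 1
  · congr 1 <;> exact (inner_conj_symm _ _).symm
  · exact (inner_conj_symm _ _).symm

theorem re_inner_self {H : Type*} [NormedAddCommGroup H] [InnerProductSpace ℂ H] (x : H) :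
    (inner ℂ x x).re = ‖x‖ ^ 2 := by
  have := inner_self_eq_norm_sq (𝕜 := ℂ) x
  simpa using this

theorem formEps_re (hV : MemLp V₀ ∞ (volume.restrict p.Omega0))
    (hV0 : ∀ᵐ x ∂volume.restrict p.Omega0, 0 ≤ V₀ x) (u : p.HEps ε) :
    ‖weakDeriv (p.Omega ε) (1, 0) u‖ ^ 2 + ‖weakDeriv (p.Omega ε) (0, 1) u‖ ^ 2
      ≤ ((p.formEps ε V₀).form u u).re := by
  rw [formEps_apply_sqrt hV hV0, Complex.add_re, Complex.add_re, re_inner_self, re_inner_self,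
    re_inner_self]
  exact le_add_of_nonneg_right (by positivity)

/-- As `V₀ ≥ 0`, the potential may be dropped. Estimates in terms of this lower bound have constants
independent of `V₀`. -/
theorem energyNorm_sq_ge (hV : MemLp V₀ ∞ (volume.restrict p.Omega0))
    (hV0 : ∀ᵐ x ∂volume.restrict p.Omega0, 0 ≤ V₀ x) (u : p.HEps ε) :
    ‖weakDeriv (p.Omega ε) (1, 0) u‖ ^ 2 + ‖weakDeriv (p.Omega ε) (0, 1) u‖ ^ 2 + ‖u‖ ^ 2
      ≤ (p.formEps ε V₀).energyNorm u ^ 2 := by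
  have h := formEps_re hV hV0 u
  rw [HForm.energyNorm, Real.sq_sqrt]
  · linarith
  · have : 0 ≤ ((p.formEps ε V₀).form u u).re := le_trans (by positivity) h
    positivity

end Params

end Waveguide

namespace Waveguide

theorem HasWeakDeriv.const_mul {E : Type*} [NormedAddCommGroup E] [NormedSpace ℝ E]
    [MeasureSpace E] {U : Set E} {v : E} {u g : E → ℂ} (h : HasWeakDeriv U v u g) (c : ℂ) :
    HasWeakDeriv U v (fun x => c * u x) (fun x => c * g x) := by
  intro φ h1 h2 h3
  have := h φ h1 h2 h3
  simp_rw [mul_left_comm _ c]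
  rw [integral_const_mul, integral_const_mul, this]
  ring

/-- The integral of the derivative between two intervals, compared with the difference of the
mean values over these intervals. -/
theorem HasWeakDeriv.norm_integral_sub_averages_le {p q : ℝ} {m k : ℝ → ℂ}
    (hm : MemLp m 2 (volume.restrict (Ioo p q))) (hk : MemLp k 2 (volume.restrict (Ioo p q)))
    (h : HasWeakDeriv (Ioo p q) 1 m k) {p' e e' q' B : ℝ} (hp : p ≤ p') (hpe : p' < e)
    (hee : e ≤ e') (heq : e' < q') (hq : q' ≤ q) (hB : 0 ≤ B)
    (h1 : (e - p') * ∫ t in Ioo p q, ‖k t‖ ^ 2 ≤ B ^ 2)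
    (h2 : (q' - e') * ∫ t in Ioo p q, ‖k t‖ ^ 2 ≤ B ^ 2) :
    ‖(∫ t in Ioo e e', k t) - (((q' - e' : ℝ) : ℂ)⁻¹ * (∫ t in Ioo e' q', m t)
      - ((e - p' : ℝ) : ℂ)⁻¹ * ∫ t in Ioo p' e, m t)‖ ≤ 2 * B := by
  have hpq : p < q := by linarith
  obtain ⟨c, hc⟩ := h.exists_ae_eq_primitive_base hm hk hpq subset_rfl (left_mem_Icc.2 hpq.le)
  -- The value of the primitive at a point of an interval differs from the mean of `m` over that
  -- interval by at most `B`. It is used at the two inner ends `e` and `e'`.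
  have key : ∀ {a b z : ℝ}, p ≤ a → a < b → b ≤ q → z ∈ Icc a b →
      (b - a) * ∫ t in Ioo p q, ‖k t‖ ^ 2 ≤ B ^ 2 →
      ‖(c + ∫ t in p..z, k t) - ((b - a : ℝ) : ℂ)⁻¹ * ∫ t in Ioo a b, m t‖ ≤ B := by
    intro a b z ha hab hb hz hB2
    have hsub : Ioo a b ⊆ Ioo p q := Ioo_subset_Ioo ha hb
    refine norm_sub_average_le hab (integrableOn_Ioo_of_memLp hm hsub) ?_
    filter_upwards [ae_restrict_of_ae_restrict_of_subset hsub hc,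
      ae_restrict_mem measurableSet_Ioo] with t ht htm
    rw [ht, add_sub_add_left_eq_sub, intervalIntegral.integral_interval_sub_left
      (intervalIntegrable_of_memLp hk subset_rfl (left_mem_Icc.2 hpq.le)
        ⟨ha.trans hz.1, hz.2.trans hb⟩)
      (intervalIntegrable_of_memLp hk subset_rfl (left_mem_Icc.2 hpq.le)
        (Ioo_subset_Icc_self (hsub htm)))]
    have h3 := norm_intervalIntegral_sq_le (memLp_Ioo_of_subset hk hsub) (Ioo_subset_Icc_self htm) hz
    have h4 : ∫ t in Ioo a b, ‖k t‖ ^ 2 ≤ ∫ t in Ioo p q, ‖k t‖ ^ 2 :=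
      setIntegral_mono_set (integrable_norm_sq hk) (.of_forall fun _ => by positivity)
        hsub.eventuallyLE
    have h5 : (b - a) * ∫ t in Ioo a b, ‖k t‖ ^ 2 ≤ (b - a) * ∫ t in Ioo p q, ‖k t‖ ^ 2 :=
      mul_le_mul_of_nonneg_left h4 (by linarith)
    exact (sq_le_sq₀ (norm_nonneg _) hB).1 (h3.trans (h5.trans hB2))
  have k1 := key hp hpe (by linarith) (right_mem_Icc.2 hpe.le) h1
  have k2 := key (by linarith) heq hq (left_mem_Icc.2 heq.le) h2
  have e1 : ∫ t in Ioo e e', k t = (∫ t in p..e', k t) - ∫ t in p..e, k t := by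
    rw [intervalIntegral.integral_interval_sub_left
      (intervalIntegrable_of_memLp hk subset_rfl (left_mem_Icc.2 hpq.le) ⟨by linarith, by linarith⟩)
      (intervalIntegrable_of_memLp hk subset_rfl (left_mem_Icc.2 hpq.le) ⟨by linarith, by linarith⟩),
      intervalIntegral.integral_of_le hee, integral_Ioc_eq_integral_Ioo]
  rw [e1]
  have := norm_sub_le ((c + ∫ t in p..e', k t) - ((q' - e' : ℝ) : ℂ)⁻¹ * ∫ t in Ioo e' q', m t)
    ((c + ∫ t in p..e, k t) - ((e - p' : ℝ) : ℂ)⁻¹ * ∫ t in Ioo p' e, m t)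
  refine le_trans (le_of_eq ?_) (this.trans (by linarith))
  congr 1
  ring

namespace Params

variable {p : Params} {ε₀ ε : ℝ}

/-! ### Estimates for functions in `H¹(Ω_ε)` -/

theorem restrict_prod_le {I K : Set ℝ} (hsub : I ×ˢ K ⊆ p.Omega ε) :
    (volume.restrict I).prod (volume.restrict K) ≤ volume.restrict (p.Omega ε) := by
  rw [← volume_restrict_prod]
  exact Measure.restrict_mono_set _ hsub

theorem integral_prod_norm_sq_le {I K : Set ℝ} (hsub : I ×ˢ K ⊆ p.Omega ε) (v : p.HEps ε) :
    ∫ z, ‖v z‖ ^ 2 ∂(volume.restrict I).prod (volume.restrict K) ≤ ‖v‖ ^ 2 := by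
  rw [norm_L2_sq]
  exact integral_mono_measure (restrict_prod_le hsub) (.of_forall fun _ => by positivity)
    (integrable_norm_sq (Lp.memLp v))

theorem h1On_of_subset {I K : Set ℝ} (hsub : I ×ˢ K ⊆ p.Omega ε) {u g₁ g₂ : p.HEps ε}
    (h₁ : HasWeakDeriv (p.Omega ε) (1, 0) u g₁) (h₂ : HasWeakDeriv (p.Omega ε) (0, 1) u g₂) :
    H1On I K u g₁ g₂ :=
  ⟨(Lp.memLp u).mono_measure (restrict_prod_le hsub), (Lp.memLp g₁).mono_measure (restrict_prod_le hsub),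
    (Lp.memLp g₂).mono_measure (restrict_prod_le hsub), h₁.mono hsub, h₂.mono hsub⟩

theorem norm_fst_le {E F : Type*} [NormedAddCommGroup E] [NormedAddCommGroup F]
    (x : WithLp 2 (E × F)) : ‖x.fst‖ ≤ ‖x‖ := by
  rw [WithLp.prod_norm_eq_of_L2]
  exact Real.le_sqrt_of_sq_le (by linarith [sq_nonneg ‖x.snd‖])

theorem norm_snd_le {E F : Type*} [NormedAddCommGroup E] [NormedAddCommGroup F]
    (x : WithLp 2 (E × F)) : ‖x.snd‖ ≤ ‖x‖ := by
  rw [WithLp.prod_norm_eq_of_L2]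
  exact Real.le_sqrt_of_sq_le (by linarith [sq_nonneg ‖x.fst‖])

/-- Vertical integration commutes with `∂₁`. Hence `J̃` maps the form domain of `a_ε` into that of
`a₀`, and the derivative of the image is again an image under `J̃`. -/
theorem hasWeakDeriv_Jtilde_fst {u g₁ : p.HEps ε}
    (h₁ : HasWeakDeriv (p.Omega ε) (1, 0) u g₁) :
    HasWeakDeriv p.Omega0 1 (p.Jtilde ε u).fst (p.Jtilde ε g₁).fst := by
  have h : HasWeakDeriv p.Omega0 1 (fun x => ∫ y in Ioo (-ε) 0, u (x, y))
      (fun x => ∫ y in Ioo (-ε) 0, g₁ (x, y)) :=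
    (h₁.mono (p.strip_subset ε)).hasProdWeakDeriv_swap.hasWeakDeriv_integral
      (MemLp.swap (p.memLp_on_strip ε u)) (MemLp.swap (p.memLp_on_strip ε g₁))
  exact (h.const_mul ((ε ^ (-1 / 2 : ℝ) : ℝ) : ℂ)).congr_ae (p.Jtilde_fst_ae ε u).symm
    (p.Jtilde_fst_ae ε g₁).symm

/-- The constant in the Sobolev inequality on `(-ε₀, ε₀)`. -/
def sobolevConst (ε₀ : ℝ) : ℝ := ε₀⁻¹ + 4 * ε₀

theorem sobolevConst_pos (h : 0 < ε₀) : 0 < sobolevConst ε₀ := by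
  unfold sobolevConst; positivity

theorem setIntegral_norm_sq_le {U : Set ℝ} {a b : ℝ} (hsub : Ioo a b ⊆ U) (f : L2 U) :
    ∫ t in Ioo a b, ‖f t‖ ^ 2 ≤ ‖f‖ ^ 2 := by
  rw [norm_L2_sq]
  exact integral_mono_measure (Measure.restrict_mono_set _ hsub)
    (.of_forall fun _ => by positivity) (integrable_norm_sq (Lp.memLp f))

theorem Admissible.ae_norm_sq_le (h : p.Admissible ε₀) {f g : L2 p.Omega0}
    (hfg : HasWeakDeriv p.Omega0 1 f g) :
    ∀ᵐ x ∂volume.restrict (Ioo (-ε₀) ε₀), ‖f x‖ ^ 2 ≤ sobolevConst ε₀ * (‖f‖ ^ 2 + ‖g‖ ^ 2) := by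
  have hε₀ := h.pos
  have hs := h.Ioo_subset
  filter_upwards [(hfg.mono hs).ae_norm_sq_le (by linarith) (memLp_Ioo_of_subset (Lp.memLp f) hs)
    (memLp_Ioo_of_subset (Lp.memLp g) hs)] with x hx
  refine hx.trans ?_
  have a1 := setIntegral_norm_sq_le hs f
  have a2 := setIntegral_norm_sq_le hs g
  have e1 : 2 * (ε₀ - -ε₀)⁻¹ = ε₀⁻¹ := by field_simp; norm_num
  have e2 : 2 * (ε₀ - -ε₀) = 4 * ε₀ := by ring
  rw [e1, e2, sobolevConst]
  have b1 : ε₀⁻¹ * (∫ t in Ioo (-ε₀) ε₀, ‖f t‖ ^ 2) ≤ ε₀⁻¹ * ‖f‖ ^ 2 := by gcongr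
  have b2 : 4 * ε₀ * (∫ t in Ioo (-ε₀) ε₀, ‖g t‖ ^ 2) ≤ 4 * ε₀ * ‖g‖ ^ 2 := by gcongr
  have b3 : 0 ≤ ε₀⁻¹ * ‖g‖ ^ 2 := by positivity
  have b4 : 0 ≤ 4 * ε₀ * ‖f‖ ^ 2 := by positivity
  linarith

/-- Sobolev on the fixed interval `(-ε₀, ε₀)`, combined with the contractivity of `J̃`; so the
constant does not depend on `ε`. -/
theorem ae_norm_Jtilde_fst_sq_le (h : p.Admissible ε₀) (hε : ε ∈ Ioc 0 ε₀) {u g₁ g₂ : p.HEps ε}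
    (h₁ : HasWeakDeriv (p.Omega ε) (1, 0) u g₁)
    {N : ℝ} (hN : ‖g₁‖ ^ 2 + ‖g₂‖ ^ 2 + ‖u‖ ^ 2 ≤ N ^ 2) :
    ∀ᵐ x ∂volume.restrict (Ioo (-ε₀) ε₀),
      ‖(p.Jtilde ε u).fst x‖ ^ 2 ≤ sobolevConst ε₀ * N ^ 2 := by
  filter_upwards [h.ae_norm_sq_le (hasWeakDeriv_Jtilde_fst h₁)] with x hx
  refine hx.trans ?_
  have hC := sobolevConst_pos h.pos
  have a1 := (norm_fst_le (p.Jtilde ε u)).trans (norm_Jtilde_le hε.1 u)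
  have a2 := (norm_fst_le (p.Jtilde ε g₁)).trans (norm_Jtilde_le hε.1 g₁)
  have a3 : ‖(p.Jtilde ε u).fst‖ ^ 2 ≤ ‖u‖ ^ 2 := by gcongr
  have a4 : ‖(p.Jtilde ε g₁).fst‖ ^ 2 ≤ ‖g₁‖ ^ 2 := by gcongr
  gcongr
  linarith [sq_nonneg ‖g₂‖]

/-- The deviation from the vertical mean in the strip. -/
theorem strip_estimate (hε : ε ∈ Ioc 0 ε₀) {u g₂ : p.HEps ε}
    (h₂ : HasWeakDeriv (p.Omega ε) (0, 1) u g₂) :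
    ∫ z in p.strip ε, ‖u z - ((ε : ℝ) : ℂ)⁻¹ * ∫ t in Ioo (-ε) 0, u (z.1, t)‖ ^ 2
      ≤ ε ^ 2 * ‖g₂‖ ^ 2 := by
  have hP := (h₂.mono (p.strip_subset ε)).hasProdWeakDeriv.poincare p.isOpen_Omega0
    (by linarith [hε.1]) (p.memLp_on_strip ε u) (p.memLp_on_strip ε g₂)
  rw [p.restrict_strip]
  rw [zero_sub, neg_neg] at hP
  refine hP.trans ?_
  gcongr
  exact integral_prod_norm_sq_le (p.strip_subset ε) g₂

/-- The deviation from the mean in the room. -/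
theorem room_estimate (hε : ε ∈ Ioc 0 ε₀) {u g₁ g₂ : p.HEps ε}
    (h₁ : HasWeakDeriv (p.Omega ε) (1, 0) u g₁) (h₂ : HasWeakDeriv (p.Omega ε) (0, 1) u g₂)
    {N : ℝ} (hN : ‖g₁‖ ^ 2 + ‖g₂‖ ^ 2 + ‖u‖ ^ 2 ≤ N ^ 2) :
    ∫ z in p.room ε, ‖u z - ((p.b ε ^ 2 : ℝ) : ℂ)⁻¹ * ∫ z in p.room ε, u z‖ ^ 2
      ≤ 2 * p.b ε ^ 2 * N ^ 2 := by
  have hb := p.b_pos hε.1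
  have hsub : Ioo (-(p.b ε / 2)) (p.b ε / 2) ×ˢ Ioo (p.h ε) (p.h ε + p.b ε) ⊆ p.Omega ε := by
    rw [← room_eq]; exact p.room_subset ε
  have hP := (h1On_of_subset hsub h₁ h₂).poincare (by linarith) (by linarith)
  rw [H1On.mean] at hP
  have e1 : p.b ε / 2 - -(p.b ε / 2) = p.b ε := by ring
  have e2 : p.h ε + p.b ε - p.h ε = p.b ε := by ring
  rw [e1, e2, ← sq, ← volume_restrict_prod, ← room_eq] at hP
  refine hP.trans ?_
  have a1 := integral_prod_norm_sq_le hsub g₁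
  have a2 := integral_prod_norm_sq_le hsub g₂
  rw [← volume_restrict_prod, ← room_eq] at a1 a2
  have : 2 * p.b ε ^ 2 * (∫ z in p.room ε, ‖g₁ z‖ ^ 2) + 2 * p.b ε ^ 2 * ∫ z in p.room ε, ‖g₂ z‖ ^ 2
      = 2 * p.b ε ^ 2 * ((∫ z in p.room ε, ‖g₁ z‖ ^ 2) + ∫ z in p.room ε, ‖g₂ z‖ ^ 2) := by ring
  rw [this]
  gcongr
  linarith [sq_nonneg ‖u‖]

theorem norm_eps_rpow_sq (hε : 0 < ε) : ‖((ε ^ (-1 / 2 : ℝ) : ℝ) : ℂ)‖ ^ 2 = ε⁻¹ := by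
  rw [Complex.norm_real, Real.norm_of_nonneg (by positivity), ← Real.rpow_natCast,
    ← Real.rpow_mul hε.le]
  norm_num [Real.rpow_neg_one]

/-- The `L²` norm in the passage. -/
theorem passage_estimate (h : p.Admissible ε₀) (hε : ε ∈ Ioc 0 ε₀) {u g₁ g₂ : p.HEps ε}
    (h₁ : HasWeakDeriv (p.Omega ε) (1, 0) u g₁) (h₂ : HasWeakDeriv (p.Omega ε) (0, 1) u g₂)
    {N : ℝ} (hN : ‖g₁‖ ^ 2 + ‖g₂‖ ^ 2 + ‖u‖ ^ 2 ≤ N ^ 2) :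
    ∫ z in p.passage ε, ‖u z‖ ^ 2
      ≤ (2 * p.γ * sobolevConst ε₀ * p.h ε ^ 2 + 2 * p.h ε * (p.h ε + ε)) * N ^ 2 := by
  have hh := p.h_pos hε.1
  have hb := p.b_pos hε.1
  have hd := p.d_pos hε.1
  have hdε := h.d_lt_eps hε
  have hε0 := hε.1
  set I := Ioo (-(p.d ε / 2)) (p.d ε / 2) with hI
  have hsub : I ×ˢ Ioo (-ε) (p.h ε) ⊆ p.Omega ε :=
    (prod_mono subset_rfl (Ioo_subset_Ioo le_rfl (by linarith))).trans (column_subset_Omega h hε)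
  have hsubP : I ×ˢ Ioo 0 (p.h ε) ⊆ p.Omega ε := by
    rw [hI, ← passage_eq]; exact p.passage_subset ε
  have hIε : I ⊆ Ioo (-ε₀) ε₀ := Ioo_subset_Ioo (by linarith [hε.2]) (by linarith [hε.2])
  have hH := h1On_of_subset hsub h₁ h₂
  have hHP := h1On_of_subset hsubP h₁ h₂
  have iu := integrable_norm_sq hHP.memLp
  have ig := integrable_norm_sq hH.memLp₂
  set C := sobolevConst ε₀ with hC
  rw [passage_eq, volume_restrict_prod, ← hI, integral_prod _ iu]
  -- On the vertical line over `x`, `u` is the mean `A` over its part in the strip plus an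
  -- oscillation controlled by `g₂` over a length `h + ε`. The Sobolev bound for `J̃ u` gives `|A|²
  -- ≤ ε⁻¹ C N²`.
  have hbound : ∀ᵐ x ∂volume.restrict I, ∫ y in Ioo 0 (p.h ε), ‖u (x, y)‖ ^ 2
      ≤ 2 * p.h ε * (ε⁻¹ * (C * N ^ 2))
        + 2 * p.h ε * (p.h ε + ε) * ∫ y in Ioo (-ε) (p.h ε), ‖g₂ (x, y)‖ ^ 2 := by
    have hW := ae_restrict_of_ae_restrict_of_subset hIε (ae_norm_Jtilde_fst_sq_le h hε h₁ hN)
    have hJ := ae_restrict_of_ae_restrict_of_subset (hIε.trans h.Ioo_subset) (p.Jtilde_fst_ae ε u)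
    filter_upwards [hH.deriv₂.hasProdWeakDeriv.ae_hasWeakDeriv isOpen_Ioo hH.memLp hH.memLp₂,
      ae_memLp_prodMk_left hH.memLp, ae_memLp_prodMk_left hH.memLp₂,
      ae_memLp_prodMk_left hHP.memLp, hW, hJ] with x hx m1 m2 m3 hWx hJx
    have hosc := hx.ae_norm_sub_average_sq_le (by linarith) m1 m2 le_rfl
      (by linarith : -ε < 0) hh.le
    have hsubK : Ioo 0 (p.h ε) ⊆ Ioo (-ε) (p.h ε) := Ioo_subset_Ioo (by linarith) le_rfl
    have hosc' := ae_restrict_of_ae_restrict_of_subset hsubK hosc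
    set A := ((0 - -ε : ℝ) : ℂ)⁻¹ * ∫ t in Ioo (-ε) 0, u (x, t) with hA
    have hAn : ‖A‖ ^ 2 ≤ ε⁻¹ * (C * N ^ 2) := by
      rw [hJx, norm_mul, mul_pow, norm_eps_rpow_sq hε0] at hWx
      rw [hA, norm_mul, norm_inv, Complex.norm_real, zero_sub, neg_neg,
        Real.norm_of_nonneg hε0.le, mul_pow]
      calc ε⁻¹ ^ 2 * ‖∫ t in Ioo (-ε) 0, u (x, t)‖ ^ 2
          = ε⁻¹ * (ε⁻¹ * ‖∫ t in Ioo (-ε) 0, u (x, t)‖ ^ 2) := by ring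
        _ ≤ _ := by gcongr
    have hle : ∀ᵐ y ∂volume.restrict (Ioo 0 (p.h ε)), ‖u (x, y)‖ ^ 2
        ≤ 2 * (ε⁻¹ * (C * N ^ 2))
          + 2 * ((p.h ε + ε) * ∫ y in Ioo (-ε) (p.h ε), ‖g₂ (x, y)‖ ^ 2) := by
      filter_upwards [hosc'] with y hy
      have := norm_add_sq_le_two A (u (x, y) - A)
      rw [add_sub_cancel] at this
      rw [sub_neg_eq_add] at hy
      linarith
    refine (integral_mono_ae (integrable_norm_sq m3) (integrable_const _) hle).trans_eq ?_
    rw [integral_const, measureReal_restrict_apply_univ, Real.volume_real_Ioo_of_le hh.le,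
      smul_eq_mul]
    ring
  refine (integral_mono_ae iu.integral_prod_left
    ((integrable_const _).add ((ig.integral_prod_left).const_mul _)) hbound).trans ?_
  have e : ∫ x in I, ∫ y in Ioo (-ε) (p.h ε), ‖g₂ (x, y)‖ ^ 2
      = ∫ z, ‖g₂ z‖ ^ 2 ∂(volume.restrict I).prod (volume.restrict (Ioo (-ε) (p.h ε))) :=
    (integral_prod _ ig).symm
  have hg := integral_prod_norm_sq_le hsub g₂
  simp only [Pi.add_apply]
  rw [integral_add (integrable_const _) ((ig.integral_prod_left).const_mul _), integral_const,
    measureReal_restrict_apply_univ, hI, Real.volume_real_Ioo_of_le (by linarith), ← hI,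
    integral_const_mul, e, smul_eq_mul]
  -- The width `d = γ ε h` absorbs the factor `ε⁻¹`.
  have e2 : (p.d ε / 2 - -(p.d ε / 2)) * (2 * p.h ε * (ε⁻¹ * (C * N ^ 2)))
      = 2 * p.γ * C * p.h ε ^ 2 * N ^ 2 := by
    rw [d_eq hε0]
    field_simp
    norm_num
  rw [e2, add_mul]
  have hgN : ‖g₂‖ ^ 2 ≤ N ^ 2 := by linarith [sq_nonneg ‖u‖, sq_nonneg ‖g₁‖]
  have : 2 * p.h ε * (p.h ε + ε)
      * (∫ z, ‖g₂ z‖ ^ 2 ∂(volume.restrict I).prod (volume.restrict (Ioo (-ε) (p.h ε))))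
      ≤ 2 * p.h ε * (p.h ε + ε) * N ^ 2 := by
    gcongr
    exact hg.trans hgN
  linarith

end Params

end Waveguide

namespace Waveguide

namespace Params

variable {p : Params} {ε₀ ε : ℝ}

theorem eps_rpow_mul_self_real (hε : 0 < ε) : ε ^ (-1 / 2 : ℝ) * ε ^ (-1 / 2 : ℝ) * ε = 1 := by
  rw [← Real.rpow_add hε]
  norm_num [Real.rpow_neg_one, hε.ne']

theorem J_Jtilde_ae (hε : 0 < ε) (u : p.HEps ε) :
    (∀ᵐ z ∂volume.restrict (p.strip ε),
      p.J ε (p.Jtilde ε u) z = ((ε : ℝ) : ℂ)⁻¹ * ∫ t in Ioo (-ε) 0, u (z.1, t)) ∧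
    (∀ᵐ z ∂volume.restrict (p.passage ε), p.J ε (p.Jtilde ε u) z = 0) ∧
    (∀ᵐ z ∂volume.restrict (p.room ε),
      p.J ε (p.Jtilde ε u) z = ((p.b ε ^ 2 : ℝ) : ℂ)⁻¹ * ∫ z in p.room ε, u z) := by
  have hJ := p.J_apply_ae ε (p.Jtilde ε u)
  refine ⟨?_, ?_, ?_⟩
  · have hF : ∀ᵐ z ∂volume.restrict (p.strip ε), (p.Jtilde ε u).fst z.1
        = ((ε ^ (-1 / 2 : ℝ) : ℝ) : ℂ) * ∫ x₂ in Ioo (-ε) 0, u (z.1, x₂) := by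
      rw [p.restrict_strip]
      exact Measure.quasiMeasurePreserving_fst.ae (p.Jtilde_fst_ae ε u)
    filter_upwards [ae_restrict_of_ae_restrict_of_subset (p.strip_subset ε) hJ,
      ae_restrict_mem (p.isOpen_strip ε).measurableSet, hF] with z h1 h2 h3
    rw [h1, if_pos h2, h3]
    have := eps_rpow_mul_self hε
    rw [← mul_assoc, eq_inv_of_mul_eq_one_left this]
  · filter_upwards [ae_restrict_of_ae_restrict_of_subset (p.passage_subset ε) hJ,
      ae_restrict_mem (p.isOpen_passage ε).measurableSet] with z h1 h2
    rw [h1, if_neg fun h => (p.disjoint_strip_passage ε).le_bot ⟨h, h2⟩,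
      if_neg fun h => (p.disjoint_passage_room ε).le_bot ⟨h2, h⟩]
  · filter_upwards [ae_restrict_of_ae_restrict_of_subset (p.room_subset ε) hJ,
      ae_restrict_mem (p.isOpen_room ε).measurableSet] with z h1 h2
    rw [h1, if_neg fun h => (p.disjoint_strip_room hε).le_bot ⟨h, h2⟩, if_pos h2, Jtilde_snd]
    push_cast
    ring

/-- The estimate for `u - J_ε J̃_ε u`. -/
theorem norm_sub_J_Jtilde_le (h : p.Admissible ε₀) (hε : ε ∈ Ioc 0 ε₀) {u g₁ g₂ : p.HEps ε}
    (h₁ : HasWeakDeriv (p.Omega ε) (1, 0) u g₁) (h₂ : HasWeakDeriv (p.Omega ε) (0, 1) u g₂)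
    {N : ℝ} (hN0 : 0 ≤ N) (hN : ‖g₁‖ ^ 2 + ‖g₂‖ ^ 2 + ‖u‖ ^ 2 ≤ N ^ 2) :
    ‖u - p.J ε (p.Jtilde ε u)‖
      ≤ √(2 * p.γ * sobolevConst ε₀ + 7) * ε ^ min p.α p.β * N := by
  have hε0 := hε.1
  have hε1 : ε < 1 := hε.2.trans_lt h.lt_one'
  have hC := sobolevConst_pos h.pos
  have hγ := p.γ_pos
  have hh := p.h_pos hε0
  have hb := p.b_pos hε0
  set q := ε ^ min p.α p.β with hq
  have hq0 : 0 < q := Real.rpow_pos_of_pos hε0 _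
  have hhq : p.h ε ≤ q := Real.rpow_le_rpow_of_exponent_ge hε0 hε1.le (min_le_left _ _)
  have hbq : p.b ε ≤ q := Real.rpow_le_rpow_of_exponent_ge hε0 hε1.le (min_le_right _ _)
  have hεq : ε ≤ q := by
    refine le_trans ?_ hbq
    have := Real.rpow_le_rpow_of_exponent_ge hε0 hε1.le (by linarith [p.β_lt] : p.β ≤ 1)
    rwa [Real.rpow_one] at this
  obtain ⟨hS, hP, hR⟩ := J_Jtilde_ae hε0 u
  set v := u - p.J ε (p.Jtilde ε u) with hv
  have hvae := Lp.coeFn_sub u (p.J ε (p.Jtilde ε u))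
  have hvi : IntegrableOn (fun z => ‖v z‖ ^ 2) (p.Omega ε) := integrable_norm_sq (Lp.memLp v)
  have e0 : ‖v‖ ^ 2 = (∫ z in p.strip ε, ‖v z‖ ^ 2) + (∫ z in p.passage ε, ‖v z‖ ^ 2)
      + ∫ z in p.room ε, ‖v z‖ ^ 2 := by
    rw [norm_L2_sq, setIntegral_Omega hε0 hvi]
  have eS : ∫ z in p.strip ε, ‖v z‖ ^ 2
      = ∫ z in p.strip ε, ‖u z - ((ε : ℝ) : ℂ)⁻¹ * ∫ t in Ioo (-ε) 0, u (z.1, t)‖ ^ 2 := by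
    refine integral_congr_ae ?_
    filter_upwards [ae_restrict_of_ae_restrict_of_subset (p.strip_subset ε) hvae, hS] with z a1 a2
    rw [a1, Pi.sub_apply, a2]
  have eP : ∫ z in p.passage ε, ‖v z‖ ^ 2 = ∫ z in p.passage ε, ‖u z‖ ^ 2 := by
    refine integral_congr_ae ?_
    filter_upwards [ae_restrict_of_ae_restrict_of_subset (p.passage_subset ε) hvae, hP] with z a1 a2
    rw [a1, Pi.sub_apply, a2, sub_zero]
  have eR : ∫ z in p.room ε, ‖v z‖ ^ 2
      = ∫ z in p.room ε, ‖u z - ((p.b ε ^ 2 : ℝ) : ℂ)⁻¹ * ∫ z in p.room ε, u z‖ ^ 2 := by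
    refine integral_congr_ae ?_
    filter_upwards [ae_restrict_of_ae_restrict_of_subset (p.room_subset ε) hvae, hR] with z a1 a2
    rw [a1, Pi.sub_apply, a2]
  have bS := strip_estimate hε h₂
  have bP := passage_estimate h hε h₁ h₂ hN
  have bR := room_estimate hε h₁ h₂ hN
  have hg : ‖g₂‖ ^ 2 ≤ N ^ 2 := by linarith [sq_nonneg ‖u‖, sq_nonneg ‖g₁‖]
  have bS' : ε ^ 2 * ‖g₂‖ ^ 2 ≤ ε ^ 2 * N ^ 2 := by gcongr
  -- The number `7 = 1 + 4 + 2` collects strip, oscillation in the passage, and room; `q` dominates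
  -- each of `ε`, `h`, `b`.
  have hK : ε ^ 2 + (2 * p.γ * sobolevConst ε₀ * p.h ε ^ 2 + 2 * p.h ε * (p.h ε + ε))
      + 2 * p.b ε ^ 2 ≤ (2 * p.γ * sobolevConst ε₀ + 7) * q ^ 2 := by
    have c1 : ε ^ 2 ≤ q ^ 2 := by gcongr
    have c2 : p.h ε ^ 2 ≤ q ^ 2 := by gcongr
    have c3 : p.b ε ^ 2 ≤ q ^ 2 := by gcongr
    have c4 : p.h ε * ε ≤ q * q := by gcongr
    have c5 : 2 * p.γ * sobolevConst ε₀ * p.h ε ^ 2 ≤ 2 * p.γ * sobolevConst ε₀ * q ^ 2 := by gcongr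
    nlinarith
  have hfin : ‖v‖ ^ 2 ≤ (2 * p.γ * sobolevConst ε₀ + 7) * q ^ 2 * N ^ 2 := by
    rw [e0, eS, eP, eR]
    have := mul_le_mul_of_nonneg_right hK (sq_nonneg N)
    nlinarith
  have hpos : 0 ≤ 2 * p.γ * sobolevConst ε₀ + 7 := by positivity
  refine (sq_le_sq₀ (norm_nonneg _) (by positivity)).1 (hfin.trans_eq ?_)
  rw [mul_pow, mul_pow, Real.sq_sqrt hpos]

/-! ### The gates of the passage -/

/-- Scale invariance in two dimensions: the side enters only through `t / s ≤ 2`, and `2 * 2² = 8 ≤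
3²`. -/
theorem le_three_mul_of_doubling {X s t A B N : ℝ} (hX : 0 ≤ X) (hN : 0 ≤ N) (hs : 0 < s)
    (ht : 0 ≤ t) (hts : t ≤ 2 * s) (hA : A + B ≤ N ^ 2)
    (h : X ^ 2 ≤ (s * s)⁻¹ * (2 * t ^ 2 * A + 2 * t ^ 2 * B)) : X ≤ 3 * N := by
  refine (sq_le_sq₀ hX (by positivity)).1 (h.trans ?_)
  rw [inv_mul_le_iff₀ (by positivity)]
  have h1 : t ^ 2 ≤ (2 * s) ^ 2 := by gcongr
  calc 2 * t ^ 2 * A + 2 * t ^ 2 * B = 2 * t ^ 2 * (A + B) := by ring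
    _ ≤ 2 * t ^ 2 * N ^ 2 := by gcongr
    _ ≤ 2 * (2 * s) ^ 2 * N ^ 2 := by gcongr
    _ ≤ s * s * (3 * N) ^ 2 := by nlinarith [mul_nonneg (sq_nonneg s) (sq_nonneg N)]

/-- The mean over the square of side `s` below the lower gate. -/
def lowerMean (u : ℝ × ℝ → ℂ) (s : ℝ) : ℂ := H1On.mean u (-(s / 2)) (s / 2) (-s) 0

/-- The mean over the square of side `s` above the level `y`. -/
def upperMean (u : ℝ × ℝ → ℂ) (y s : ℝ) : ℂ := H1On.mean u (-(s / 2)) (s / 2) y (y + s)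

section Gates

variable {u g₁ g₂ : p.HEps ε} {N : ℝ}

theorem lowerSquare_subset (h : p.Admissible ε₀) (hε : ε ∈ Ioc 0 ε₀) {t : ℝ} (ht : t ≤ ε) :
    Ioo (-(t / 2)) (t / 2) ×ˢ Ioo (-t) 0 ⊆ p.Omega ε := by
  have hε0 := hε.1
  refine subset_trans (prod_mono ?_ (Ioo_subset_Ioo (by linarith) le_rfl)) (p.strip_subset ε)
  exact (Ioo_subset_Ioo (by linarith [hε.2]) (by linarith [hε.2])).trans h.Ioo_subset

theorem upperSquare_subset {t : ℝ} (ht : t ≤ p.b ε) :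
    Ioo (-(t / 2)) (t / 2) ×ˢ Ioo (p.h ε) (p.h ε + t) ⊆ p.Omega ε := by
  refine subset_trans (prod_mono (Ioo_subset_Ioo ?_ ?_) (Ioo_subset_Ioo le_rfl ?_))
    ((p.room_eq ε).symm.trans_subset (p.room_subset ε)) <;> linarith

/-- Each doubling of the square costs at most `3 N`, whatever its side, and about `log (ε / d)`
doublings lead from the gate to the full height of the strip. -/
theorem norm_lowerMean_sub_le (h : p.Admissible ε₀) (hε : ε ∈ Ioc 0 ε₀)
    (h₁ : HasWeakDeriv (p.Omega ε) (1, 0) u g₁) (h₂ : HasWeakDeriv (p.Omega ε) (0, 1) u g₂)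
    (hN0 : 0 ≤ N) (hN : ‖g₁‖ ^ 2 + ‖g₂‖ ^ 2 + ‖u‖ ^ 2 ≤ N ^ 2) :
    ‖lowerMean u (p.d ε) - lowerMean u ε‖ ≤ (1 + 2 * Real.log (ε / p.d ε)) * (3 * N) := by
  refine norm_sub_le_log_of_doubling (fun s t hs hst hts htL => ?_) (by positivity)
    (p.d_pos hε.1) (h.d_lt_eps hε).le
  have hsub := lowerSquare_subset h hε htL
  have hm := (h1On_of_subset hsub h₁ h₂).norm_mean_sub_mean_sq_le
    (a' := -(s / 2)) (b' := s / 2) (p' := -s) (q' := 0) (by linarith) (by linarith) (by linarith)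
    (by linarith) (by linarith) le_rfl
  have a1 := integral_prod_norm_sq_le hsub g₁
  have a2 := integral_prod_norm_sq_le hsub g₂
  have e : ∀ r : ℝ, r / 2 - -(r / 2) = r := fun r => by ring
  rw [e, e, zero_sub, zero_sub, neg_neg, neg_neg] at hm
  exact le_three_mul_of_doubling (norm_nonneg _) hN0 hs (hs.le.trans hst) hts
    (by linarith [sq_nonneg ‖u‖]) hm

theorem norm_upperMean_sub_le (h : p.Admissible ε₀) (hε : ε ∈ Ioc 0 ε₀)
    (h₁ : HasWeakDeriv (p.Omega ε) (1, 0) u g₁) (h₂ : HasWeakDeriv (p.Omega ε) (0, 1) u g₂)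
    (hN0 : 0 ≤ N) (hN : ‖g₁‖ ^ 2 + ‖g₂‖ ^ 2 + ‖u‖ ^ 2 ≤ N ^ 2) :
    ‖upperMean u (p.h ε) (p.d ε) - upperMean u (p.h ε) (p.b ε)‖
      ≤ (1 + 2 * Real.log (p.b ε / p.d ε)) * (3 * N) := by
  refine norm_sub_le_log_of_doubling (A := upperMean u (p.h ε))
    (fun s t hs hst hts htL => ?_) (by positivity)
    (p.d_pos hε.1) (h.d_lt_b hε).le
  have hsub := upperSquare_subset htL
  have hm := (h1On_of_subset hsub h₁ h₂).norm_mean_sub_mean_sq_le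
    (a' := -(s / 2)) (b' := s / 2) (p' := p.h ε) (q' := p.h ε + s) (by linarith) (by linarith)
    (by linarith) le_rfl (by linarith) (by linarith)
  have a1 := integral_prod_norm_sq_le hsub g₁
  have a2 := integral_prod_norm_sq_le hsub g₂
  have e : ∀ r : ℝ, r / 2 - -(r / 2) = r := fun r => by ring
  rw [e, e, add_sub_cancel_left, add_sub_cancel_left] at hm
  exact le_three_mul_of_doubling (norm_nonneg _) hN0 hs (hs.le.trans hst) hts
    (by linarith [sq_nonneg ‖u‖]) hm

/-- Cauchy–Schwarz on the area `b²`. The room component need not be small, so nothing better than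
`b⁻¹` is available; this is the source of the exponent `1/2 - β`. -/
theorem norm_upperMean_b_le (hε : 0 < ε) (hN0 : 0 ≤ N) (hN : ‖u‖ ^ 2 ≤ N ^ 2) :
    ‖upperMean u (p.h ε) (p.b ε)‖ ≤ (p.b ε)⁻¹ * N := by
  have hb := p.b_pos hε
  have hsub : Ioo (-(p.b ε / 2)) (p.b ε / 2) ×ˢ Ioo (p.h ε) (p.h ε + p.b ε) ⊆ p.Omega ε :=
    upperSquare_subset le_rfl
  have h1 := norm_integral_sq_le ((Lp.memLp u).mono_measure (restrict_prod_le hsub))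
  have h2 := integral_prod_norm_sq_le hsub u
  have e : p.b ε / 2 - -(p.b ε / 2) = p.b ε := by ring
  have hvol : ((volume.restrict (Ioo (-(p.b ε / 2)) (p.b ε / 2))).prod
      (volume.restrict (Ioo (p.h ε) (p.h ε + p.b ε)))).real univ = p.b ε * p.b ε := by
    rw [← univ_prod_univ, measureReal_prod_prod, measureReal_restrict_apply_univ,
      measureReal_restrict_apply_univ, Real.volume_real_Ioo_of_le (by linarith),
      Real.volume_real_Ioo_of_le (by linarith), e, add_sub_cancel_left]
  rw [hvol] at h1
  refine (sq_le_sq₀ (norm_nonneg _) (by positivity)).1 ?_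
  rw [upperMean, H1On.mean, e, add_sub_cancel_left, norm_mul, norm_inv, Complex.norm_real,
    Real.norm_of_nonneg (by positivity), mul_pow]
  calc (p.b ε * p.b ε)⁻¹ ^ 2 * _ ≤ (p.b ε * p.b ε)⁻¹ ^ 2 * (p.b ε * p.b ε * N ^ 2) := by
        gcongr
        exact h1.trans (by gcongr; exact h2.trans hN)
    _ = _ := by field_simp

/-- The flux through the passage. -/
theorem norm_passage_flux_le (h : p.Admissible ε₀) (hε : ε ∈ Ioc 0 ε₀)
    (h₁ : HasWeakDeriv (p.Omega ε) (1, 0) u g₁) (h₂ : HasWeakDeriv (p.Omega ε) (0, 1) u g₂)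
    (hN0 : 0 ≤ N) (hN : ‖g₂‖ ^ 2 ≤ N ^ 2) :
    ‖(∫ z in p.passage ε, g₂ z)
      - (p.d ε : ℂ) * (upperMean u (p.h ε) (p.d ε) - lowerMean u (p.d ε))‖ ≤ 2 * (p.d ε * N) := by
  have hh := p.h_pos hε.1
  have hd := p.d_pos hε.1
  have hdε := h.d_lt_eps hε
  have hdb := h.d_lt_b hε
  set d := p.d ε with hd_def
  set I := Ioo (-(d / 2)) (d / 2) with hI
  have hsub : I ×ˢ Ioo (-d) (p.h ε + d) ⊆ p.Omega ε :=
    (prod_mono subset_rfl (Ioo_subset_Ioo (by linarith) (by linarith))).trans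
      (column_subset_Omega h hε)
  have hH := h1On_of_subset hsub h₁ h₂
  -- The integral of `u` across the column is a function of height with derivative `∫_I g₂`, and the
  -- flux through the passage is the increment of this function from `0` to `h`. Replacing its end
  -- values by means over squares of side `d` costs `d N` each.
  have hw := hH.deriv₂.hasProdWeakDeriv.hasWeakDeriv_integral hH.memLp hH.memLp₂
  have m1 := memLp_integral_section (MemLp.swap hH.memLp)
  have m2 := memLp_integral_section (MemLp.swap hH.memLp₂)
  have hk := integral_norm_sq_integral_section_le (by linarith) (MemLp.swap hH.memLp₂)
  have hsw : ∫ z, ‖g₂ z.swap‖ ^ 2 ∂(volume.restrict (Ioo (-d) (p.h ε + d))).prod (volume.restrict I)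
      = ∫ z, ‖g₂ z‖ ^ 2 ∂(volume.restrict I).prod (volume.restrict (Ioo (-d) (p.h ε + d))) :=
    integral_prod_swap (fun z => ‖g₂ z‖ ^ 2)
  have hg := integral_prod_norm_sq_le hsub g₂
  rw [hsw, show d / 2 - -(d / 2) = d by ring] at hk
  have hk' : ∫ y in Ioo (-d) (p.h ε + d), ‖∫ x in I, g₂ (x, y)‖ ^ 2 ≤ d * N ^ 2 :=
    hk.trans (by gcongr; exact hg.trans hN)
  have hB : d * ∫ y in Ioo (-d) (p.h ε + d), ‖∫ x in I, g₂ (x, y)‖ ^ 2 ≤ (d * N) ^ 2 :=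
    (mul_le_mul_of_nonneg_left hk' hd.le).trans_eq (by ring)
  have key := hw.norm_integral_sub_averages_le m1 m2 (p' := -d) (e := 0) (e' := p.h ε)
    (q' := p.h ε + d) (B := d * N) le_rfl (by linarith) hh.le (by linarith) le_rfl (by positivity)
    (by rwa [zero_sub, neg_neg]) (by rwa [add_sub_cancel_left])
  have swapInt : ∀ {a b : ℝ} (v : p.HEps ε), I ×ˢ Ioo a b ⊆ p.Omega ε →
      ∫ z, v z ∂(volume.restrict I).prod (volume.restrict (Ioo a b))
        = ∫ y in Ioo a b, ∫ x in I, v (x, y) := by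
    intro a b v hab
    exact integral_prod_symm _ (((Lp.memLp v).mono_measure (restrict_prod_le hab)).integrable
      (by norm_num))
  have e1 : ∫ z in p.passage ε, g₂ z = ∫ y in Ioo 0 (p.h ε), ∫ x in I, g₂ (x, y) := by
    rw [passage_eq, ← hd_def, volume_restrict_prod]
    exact swapInt g₂ (by rw [hI, hd_def, ← passage_eq]; exact p.passage_subset ε)
  have e2 : (d : ℂ) * upperMean u (p.h ε) d
      = ((p.h ε + d - p.h ε : ℝ) : ℂ)⁻¹ * ∫ y in Ioo (p.h ε) (p.h ε + d), ∫ x in I, u (x, y) := by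
    rw [upperMean, H1On.mean, swapInt u (upperSquare_subset hdb.le),
      show d / 2 - -(d / 2) = d by ring, add_sub_cancel_left]
    have : (d : ℂ) ≠ 0 := by exact_mod_cast hd.ne'
    push_cast
    field_simp
  have e3 : (d : ℂ) * lowerMean u d
      = ((0 - -d : ℝ) : ℂ)⁻¹ * ∫ y in Ioo (-d) 0, ∫ x in I, u (x, y) := by
    rw [lowerMean, H1On.mean, swapInt u (lowerSquare_subset h hε hdε.le),
      show d / 2 - -(d / 2) = d by ring, zero_sub, neg_neg]
    have : (d : ℂ) ≠ 0 := by exact_mod_cast hd.ne'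
    push_cast
    field_simp
  rw [e1, mul_sub, e2, e3]
  exact key

/-- The point value of the vertical mean, compared with the mean over a square. -/
theorem norm_pointValue_sub_lowerMean_le (h : p.Admissible ε₀) (hε : ε ∈ Ioc 0 ε₀)
    (h₁ : HasWeakDeriv (p.Omega ε) (1, 0) u g₁) (hN0 : 0 ≤ N) (hN : ‖g₁‖ ^ 2 ≤ N ^ 2) :
    ‖pointValue p.Omega0 (p.Jtilde ε u).fst 0
      - ((ε ^ (-1 / 2 : ℝ) * ε : ℝ) : ℂ) * lowerMean u ε‖ ≤ ε ^ (-1 / 2 : ℝ) * ε * N := by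
  have hε0 := hε.1
  have hW := hasWeakDeriv_Jtilde_fst h₁
  have hspec := pointValue_spec p.isOpen_Omega0 p.ordConnected_Omega0 p.zero_mem_Omega0 hW
  set s := ε ^ (-1 / 2 : ℝ) with hs
  have hs0 : 0 < s := Real.rpow_pos_of_pos hε0 _
  have hss : s * s * ε = 1 := eps_rpow_mul_self_real hε0
  have hsub : Ioo (-(ε / 2)) (ε / 2) ⊆ p.Omega0 :=
    (Ioo_subset_Ioo (by linarith [hε.2]) (by linarith [hε.2])).trans h.Ioo_subset
  have hg : ‖(p.Jtilde ε g₁).fst‖ ^ 2 ≤ N ^ 2 := by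
    have := (norm_fst_le (p.Jtilde ε g₁)).trans (norm_Jtilde_le hε0 g₁)
    exact le_trans (by gcongr) hN
  have hbound : ∀ᵐ x ∂volume.restrict (Ioo (-(ε / 2)) (ε / 2)),
      ‖pointValue p.Omega0 (p.Jtilde ε u).fst 0 - (p.Jtilde ε u).fst x‖ ≤ s * ε * N := by
    filter_upwards [ae_restrict_of_ae_restrict_of_subset hsub hspec,
      ae_restrict_mem measurableSet_Ioo] with x hx hxm
    rw [hx, sub_add_cancel_left, norm_neg]
    have a1 := norm_intervalIntegral_sq_le
      (memLp_Ioo_of_subset (Lp.memLp (p.Jtilde ε g₁).fst) hsub)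
      (⟨by linarith, by linarith⟩ : (0 : ℝ) ∈ Icc (-(ε / 2)) (ε / 2)) (Ioo_subset_Icc_self hxm)
    have a2 := setIntegral_norm_sq_le hsub (p.Jtilde ε g₁).fst
    refine (sq_le_sq₀ (norm_nonneg _) (by positivity)).1 (a1.trans ?_)
    rw [show ε / 2 - -(ε / 2) = ε by ring]
    -- The factor `s² ε = 1` is inserted in order to write `ε` as `(s ε)²`.
    calc ε * _ ≤ ε * N ^ 2 := by gcongr; exact a2.trans hg
      _ = (s * s * ε) * (ε * N ^ 2) := by rw [hss, one_mul]
      _ = _ := by ring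
  have key := norm_sub_average_le (by linarith)
    (integrableOn_Ioo_of_memLp (Lp.memLp (p.Jtilde ε u).fst) hsub) hbound
  have e : ((ε / 2 - -(ε / 2) : ℝ) : ℂ)⁻¹ * ∫ x in Ioo (-(ε / 2)) (ε / 2), (p.Jtilde ε u).fst x
      = ((s * ε : ℝ) : ℂ) * lowerMean u ε := by
    have hi : Integrable u ((volume.restrict (Ioo (-(ε / 2)) (ε / 2))).prod
        (volume.restrict (Ioo (-ε) 0))) :=
      ((Lp.memLp u).mono_measure (restrict_prod_le (lowerSquare_subset h hε le_rfl))).integrable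
        (by norm_num)
    rw [integral_congr_ae (ae_restrict_of_ae_restrict_of_subset hsub (p.Jtilde_fst_ae ε u)),
      integral_const_mul, lowerMean, H1On.mean, integral_prod _ hi,
      show ε / 2 - -(ε / 2) = ε by ring, zero_sub, neg_neg, ← hs]
    have : (ε : ℂ) ≠ 0 := by exact_mod_cast hε0.ne'
    push_cast
    field_simp
  rwa [e] at key

end Gates

end Params

end Waveguide

namespace Waveguide

namespace Params

variable {p : Params} {ε₀ ε : ℝ}

/-- The constant in the estimate for the flux through the passage. -/
def gateConst (p : Params) : ℝ :=
  p.γ * (10 + 12 * |Real.log p.γ| + 6 * (2 * p.α + 1 - p.β) / p.β)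

theorem gateConst_pos (p : Params) : 0 < p.gateConst := by
  have h1 := p.γ_pos
  have h2 := p.α_pos
  have h3 := p.β_pos
  have h4 : 0 < 2 * p.α + 1 - p.β := by linarith [p.β_lt]
  unfold gateConst
  positivity

/-- From `log x ≤ x^β / β` at `x = 1 / ε`. Since a factor `b⁻¹` occurs anyway, the logarithms from
the doublings do not worsen the rate. -/
theorem neg_log_le (hε : 0 < ε) : -Real.log ε ≤ (p.b ε)⁻¹ / p.β := by
  have h := Real.log_le_rpow_div (inv_nonneg.2 hε.le) p.β_pos
  rwa [Real.log_inv, Real.inv_rpow hε.le] at h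

/-- The flux through the passage balances the point interaction. -/
theorem norm_gate_le (h : p.Admissible ε₀) (hε : ε ∈ Ioc 0 ε₀) {u g₁ g₂ : p.HEps ε}
    (h₁ : HasWeakDeriv (p.Omega ε) (1, 0) u g₁) (h₂ : HasWeakDeriv (p.Omega ε) (0, 1) u g₂)
    {N : ℝ} (hN0 : 0 ≤ N) (hN : ‖g₁‖ ^ 2 + ‖g₂‖ ^ 2 + ‖u‖ ^ 2 ≤ N ^ 2) :
    ‖(p.γ : ℂ) * pointValue p.Omega0 (p.Jtilde ε u).fst 0
      + (((p.h ε)⁻¹ * ε ^ (-1 / 2 : ℝ) : ℝ) : ℂ) * ∫ z in p.passage ε, g₂ z‖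
      ≤ p.gateConst * (ε ^ (-1 / 2 : ℝ) * ε * (p.b ε)⁻¹) * N := by
  have hε0 := hε.1
  have hε1 : ε < 1 := hε.2.trans_lt h.lt_one'
  have hγ := p.γ_pos
  have hα := p.α_pos
  have hβ := p.β_pos
  have hh := p.h_pos hε0
  have hb := p.b_pos hε0
  have hd := p.d_pos hε0
  have a1 := norm_pointValue_sub_lowerMean_le h hε h₁ hN0
    (by linarith [sq_nonneg ‖u‖, sq_nonneg ‖g₂‖])
  have a2 := norm_passage_flux_le h hε h₁ h₂ hN0 (by linarith [sq_nonneg ‖u‖, sq_nonneg ‖g₁‖])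
  have a3 := norm_lowerMean_sub_le h hε h₁ h₂ hN0 hN
  have a4 := norm_upperMean_sub_le h hε h₁ h₂ hN0 hN
  have a5 := norm_upperMean_b_le (u := u) hε0 hN0 (by linarith [sq_nonneg ‖g₂‖, sq_nonneg ‖g₁‖])
  have hb1 : 1 ≤ (p.b ε)⁻¹ :=
    (one_le_inv₀ hb).2 (Real.rpow_le_one hε0.le hε1.le hβ.le)
  have hlog := neg_log_le (p := p) hε0
  have l1 : Real.log (ε / p.d ε) = -Real.log p.γ - p.α * Real.log ε := by
    rw [d, Real.log_div hε0.ne' (by positivity), Real.log_mul hγ.ne' (by positivity),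
      Real.log_rpow hε0]
    ring
  have l2 : Real.log (p.b ε / p.d ε)
      = -Real.log p.γ - (p.α + 1 - p.β) * Real.log ε := by
    rw [d, b, Real.log_div (by positivity) (by positivity), Real.log_mul hγ.ne' (by positivity),
      Real.log_rpow hε0, Real.log_rpow hε0]
    ring
  rw [l1] at a3
  rw [l2] at a4
  set s := ε ^ (-1 / 2 : ℝ) with hs
  have hs0 : 0 < s := Real.rpow_pos_of_pos hε0 _
  set W := pointValue p.Omega0 (p.Jtilde ε u).fst 0
  set F := ∫ z in p.passage ε, g₂ z
  set κ := (p.b ε)⁻¹ with hκ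
  set Ud := upperMean u (p.h ε) (p.d ε)
  set Ub := upperMean u (p.h ε) (p.b ε)
  set Ld := lowerMean u (p.d ε)
  set Le := lowerMean u ε
  -- The calibration of the passage: the scaling `d = γ ε h` is what makes `γ` the coupling constant
  -- of the limit.
  have hdh : (p.h ε)⁻¹ * s * p.d ε = p.γ * (s * ε) := by
    rw [d_eq hε0]
    field_simp
  have hdhC : (((p.h ε)⁻¹ * s : ℝ) : ℂ) * (p.d ε : ℂ) = ((p.γ * (s * ε) : ℝ) : ℂ) := by
    rw [← Complex.ofReal_mul, hdh]
  -- Telescoping from the point value through the squares of sides `ε` and `d` below the passage and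
  -- `d` and `b` above it. The lower means cancel the point value; only `Ub` survives as a main
  -- term.
  have e : (p.γ : ℂ) * W + (((p.h ε)⁻¹ * s : ℝ) : ℂ) * F
      = (p.γ : ℂ) * (W - ((s * ε : ℝ) : ℂ) * Le)
        + (((p.h ε)⁻¹ * s : ℝ) : ℂ) * (F - (p.d ε : ℂ) * (Ud - Ld))
        + ((p.γ * (s * ε) : ℝ) : ℂ) * ((Ud - Ub) + Ub - (Ld - Le)) := by
    have : ((p.γ * (s * ε) : ℝ) : ℂ) = (p.γ : ℂ) * ((s * ε : ℝ) : ℂ) := by push_cast; ring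
    linear_combination (Ud - Ld) * hdhC - Le * this
  have b1 : ‖(p.γ : ℂ) * (W - ((s * ε : ℝ) : ℂ) * Le)‖ ≤ p.γ * (s * ε * N) := by
    rw [norm_mul, Complex.norm_real, Real.norm_of_nonneg hγ.le]
    gcongr
  have b2 : ‖(((p.h ε)⁻¹ * s : ℝ) : ℂ) * (F - (p.d ε : ℂ) * (Ud - Ld))‖
      ≤ p.γ * (s * ε) * (2 * N) := by
    rw [norm_mul, Complex.norm_real, Real.norm_of_nonneg (by positivity), ← hdh]
    calc (p.h ε)⁻¹ * s * ‖F - (p.d ε : ℂ) * (Ud - Ld)‖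
        ≤ (p.h ε)⁻¹ * s * (2 * (p.d ε * N)) := by gcongr
      _ = _ := by ring
  have b3 : ‖(Ud - Ub) + Ub - (Ld - Le)‖
      ≤ (1 + 2 * (-Real.log p.γ - (p.α + 1 - p.β) * Real.log ε)) * (3 * N) + κ * N
        + (1 + 2 * (-Real.log p.γ - p.α * Real.log ε)) * (3 * N) := by
    have c1 := norm_sub_le ((Ud - Ub) + Ub) (Ld - Le)
    have c2 := norm_add_le (Ud - Ub) Ub
    linarith
  have b4 : ‖((p.γ * (s * ε) : ℝ) : ℂ) * ((Ud - Ub) + Ub - (Ld - Le))‖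
      ≤ p.γ * (s * ε) * ((1 + 2 * (-Real.log p.γ - (p.α + 1 - p.β) * Real.log ε)) * (3 * N) + κ * N
        + (1 + 2 * (-Real.log p.γ - p.α * Real.log ε)) * (3 * N)) := by
    rw [norm_mul, Complex.norm_real, Real.norm_of_nonneg (by positivity)]
    gcongr
  rw [e]
  refine (norm_add_le _ _).trans ?_
  have b5 := norm_add_le ((p.γ : ℂ) * (W - ((s * ε : ℝ) : ℂ) * Le))
    ((((p.h ε)⁻¹ * s : ℝ) : ℂ) * (F - (p.d ε : ℂ) * (Ud - Ld)))
  -- Here `9 = 1 + 2 + 3 + 3` adds the point value, the flux and the two chains of squares. The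
  -- logarithms come from both chains, and `κ ≥ 1` lets everything be charged to `κ`.
  have hcoef : 9 + κ - 12 * Real.log p.γ + 6 * (2 * p.α + 1 - p.β) * (-Real.log ε)
      ≤ (10 + 12 * |Real.log p.γ| + 6 * (2 * p.α + 1 - p.β) / p.β) * κ := by
    have q1 : -Real.log p.γ ≤ |Real.log p.γ| := neg_le_abs _
    have q2 : |Real.log p.γ| ≤ |Real.log p.γ| * κ := le_mul_of_one_le_right (abs_nonneg _) hb1
    have q3 : 0 ≤ 6 * (2 * p.α + 1 - p.β) := by linarith [p.β_lt]
    have q4 := mul_le_mul_of_nonneg_left hlog q3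
    have q5 : 6 * (2 * p.α + 1 - p.β) * (κ / p.β) = 6 * (2 * p.α + 1 - p.β) / p.β * κ := by ring
    linarith
  have hfin := mul_le_mul_of_nonneg_left hcoef (by positivity : 0 ≤ p.γ * (s * ε) * N)
  have hR : p.gateConst * (s * ε * κ) * N = p.γ * (s * ε) * N *
      ((10 + 12 * |Real.log p.γ| + 6 * (2 * p.α + 1 - p.β) / p.β) * κ) := by
    rw [gateConst]; ring
  rw [hR]
  refine le_trans ?_ hfin
  linarith

end Params

end Waveguide

namespace Waveguide

open scoped ContDiff

/-! ### Integration by parts against functions of product form -/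

section Test

variable {φ : ℝ × ℝ → ℝ} {I K : Set ℝ} {f k : ℝ → ℂ}

theorem hasDerivAt_section_snd (h1 : ContDiff ℝ ∞ φ) (x y : ℝ) :
    HasDerivAt (fun y => φ (x, y)) (fderiv ℝ φ (x, y) (0, 1)) y := by
  have h := (h1.differentiable (by simp) (x, y)).hasFDerivAt
  exact h.comp_hasDerivAt y ((hasDerivAt_const y x).prodMk (hasDerivAt_id y))

theorem hasDerivAt_section_fst (h1 : ContDiff ℝ ∞ φ) (x y : ℝ) :
    HasDerivAt (fun x => φ (x, y)) (fderiv ℝ φ (x, y) (1, 0)) x := by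
  have h := (h1.differentiable (by simp) (x, y)).hasFDerivAt
  exact h.comp_hasDerivAt x ((hasDerivAt_id x).prodMk (hasDerivAt_const x y))

theorem tsupport_section_fst_subset (y : ℝ) :
    tsupport (fun x => φ (x, y)) ⊆ (fun x => (x, y)) ⁻¹' tsupport φ :=
  closure_minimal (fun _ hx => subset_tsupport φ hx)
    ((isClosed_tsupport φ).preimage (by fun_prop))

theorem hasCompactSupport_section_fst (h2 : HasCompactSupport φ) (y : ℝ) :
    HasCompactSupport fun x => φ (x, y) := by
  refine IsCompact.of_isClosed_subset (h2.image continuous_fst) (isClosed_tsupport _) ?_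
  exact fun x hx => ⟨(x, y), tsupport_section_fst_subset y hx, rfl⟩

theorem memLp_affine_mul {p q : ℝ} (hf : MemLp f 2 (volume.restrict I)) (a b : ℝ) :
    MemLp (fun z : ℝ × ℝ => ((a + b * z.2 : ℝ) : ℂ) * f z.1) 2
      ((volume.restrict I).prod (volume.restrict (Ioo p q))) := by
  have h1 := hf.comp_fst (volume.restrict (Ioo p q))
  refine MemLp.of_le_mul (c := |a| + |b| * (|p| + |q|)) h1 ?_ ?_
  · refine AEStronglyMeasurable.mul ?_ h1.1
    exact Continuous.aestronglyMeasurable (by fun_prop)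
  · have hm : ∀ᵐ z ∂(volume.restrict I).prod (volume.restrict (Ioo p q)), z.2 ∈ Ioo p q :=
      Measure.quasiMeasurePreserving_snd.ae (ae_restrict_mem measurableSet_Ioo)
    filter_upwards [hm] with z hz
    rw [norm_mul, Complex.norm_real, Real.norm_eq_abs]
    gcongr
    refine (abs_add_le _ _).trans ?_
    rw [abs_mul]
    gcongr
    rw [abs_le]
    constructor
    · linarith [hz.1, neg_abs_le p, abs_nonneg q]
    · linarith [hz.2, le_abs_self q, abs_nonneg p]

/-- Integration by parts in the second variable against `(a + b y) f(x)`. -/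
theorem integral_fderiv_snd_mul {p q : ℝ} (hpq : p ≤ q) (h1 : ContDiff ℝ ∞ φ)
    (h2 : HasCompactSupport φ) (hf : MemLp f 2 (volume.restrict I)) (a b : ℝ) :
    ∫ z, ((fderiv ℝ φ z (0, 1) : ℝ) : ℂ) * (((a + b * z.2 : ℝ) : ℂ) * f z.1)
        ∂(volume.restrict I).prod (volume.restrict (Ioo p q))
      = (∫ x in I, (φ (x, q) : ℂ) * (((a + b * q : ℝ) : ℂ) * f x))
        - (∫ x in I, (φ (x, p) : ℂ) * (((a + b * p : ℝ) : ℂ) * f x))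
        - ∫ z, (φ z : ℂ) * ((b : ℂ) * f z.1)
          ∂(volume.restrict I).prod (volume.restrict (Ioo p q)) := by
  have hmem : MemLp (fun z : ℝ × ℝ => (b : ℂ) * f z.1) 2
      ((volume.restrict I).prod (volume.restrict (Ioo p q))) := by
    simpa using memLp_affine_mul (p := p) (q := q) hf b 0
  have hd := continuous_fderiv_apply_of_contDiff h1 ((0 : ℝ), (1 : ℝ))
  have i1 : Integrable (fun z : ℝ × ℝ => ((fderiv ℝ φ z (0, 1) : ℝ) : ℂ)
      * (((a + b * z.2 : ℝ) : ℂ) * f z.1))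
      ((volume.restrict I).prod (volume.restrict (Ioo p q))) := by
    have hm := memLp_affine_mul (p := p) (q := q) hf a b
    rw [← volume_restrict_prod] at hm ⊢
    exact integrable_test_mul hd (hasCompactSupport_fderiv_apply h2 _) hm
  have i2 : Integrable (fun z : ℝ × ℝ => (φ z : ℂ) * ((b : ℂ) * f z.1))
      ((volume.restrict I).prod (volume.restrict (Ioo p q))) := by
    have hm := hmem
    rw [← volume_restrict_prod] at hm ⊢
    exact integrable_test_mul h1.continuous h2 hm
  have i3 : ∀ y c : ℝ, IntegrableOn (fun x => (φ (x, y) : ℂ) * ((c : ℂ) * f x)) I := fun y c =>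
    integrable_test_mul (h1.continuous.comp (by fun_prop)) (hasCompactSupport_section_fst h2 y)
      (hf.const_mul _)
  have i4 : IntegrableOn (fun x => (φ (x, q) : ℂ) * (((a + b * q : ℝ) : ℂ) * f x)
      - (φ (x, p) : ℂ) * (((a + b * p : ℝ) : ℂ) * f x)) I := (i3 _ _).sub (i3 _ _)
  rw [integral_prod _ i1, integral_prod _ i2, ← integral_sub (i3 _ _) (i3 _ _),
    ← integral_sub i4 i2.integral_prod_left]
  -- On each vertical line this is the fundamental theorem of calculus for `φ(x, y)(a + b y)`. The
  -- factor `f x` is constant there, so no regularity of `f` is needed.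
  refine integral_congr_ae (.of_forall fun x => ?_)
  have hD : ∀ y, HasDerivAt (fun y => φ (x, y) * (a + b * y))
      (fderiv ℝ φ (x, y) (0, 1) * (a + b * y) + φ (x, y) * b) y := fun y => by
    have := (hasDerivAt_section_snd h1 x y).mul (((hasDerivAt_id y).const_mul b).const_add a)
    simpa [Pi.mul_def] using this
  have c1 : Continuous fun y => fderiv ℝ φ (x, y) (0, 1) * (a + b * y) :=
    (hd.comp (by fun_prop : Continuous fun y : ℝ => (x, y))).mul (by fun_prop)
  have c2 : Continuous fun y => φ (x, y) * b := (h1.continuous.comp (by fun_prop)).mul_const b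
  have hFTC := intervalIntegral.integral_eq_sub_of_hasDerivAt (a := p) (b := q)
    (fun y _ => hD y) ((c1.add c2).intervalIntegrable _ _)
  rw [intervalIntegral.integral_add (c1.intervalIntegrable _ _) (c2.intervalIntegrable _ _),
    intervalIntegral.integral_of_le hpq, intervalIntegral.integral_of_le hpq,
    integral_Ioc_eq_integral_Ioo, integral_Ioc_eq_integral_Ioo] at hFTC
  have e1 : ∫ y in Ioo p q, ((fderiv ℝ φ (x, y) (0, 1) : ℝ) : ℂ) * (((a + b * y : ℝ) : ℂ) * f x)
      = ((∫ y in Ioo p q, fderiv ℝ φ (x, y) (0, 1) * (a + b * y) : ℝ) : ℂ) * f x := by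
    rw [← integral_complex_ofReal, ← integral_mul_const]
    refine integral_congr_ae (.of_forall fun y => ?_)
    simp only
    push_cast
    ring
  have e2 : ∫ y in Ioo p q, (φ (x, y) : ℂ) * ((b : ℂ) * f x)
      = ((∫ y in Ioo p q, φ (x, y) * b : ℝ) : ℂ) * f x := by
    rw [← integral_complex_ofReal, ← integral_mul_const]
    refine integral_congr_ae (.of_forall fun y => ?_)
    simp only
    push_cast
    ring
  simp only
  rw [e1, e2]
  have hC : ((∫ y in Ioo p q, fderiv ℝ φ (x, y) (0, 1) * (a + b * y) : ℝ) : ℂ)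
      + ((∫ y in Ioo p q, φ (x, y) * b : ℝ) : ℂ)
      = ((φ (x, q) * (a + b * q) - φ (x, p) * (a + b * p) : ℝ) : ℂ) := by
    rw [← Complex.ofReal_add, hFTC]
  push_cast at hC ⊢
  linear_combination f x * hC

/-- Integration by parts in the first variable against `(a + b y) f(x)`. -/
theorem integral_fderiv_fst_mul {p q : ℝ} (h1 : ContDiff ℝ ∞ φ)
    (h2 : HasCompactSupport φ) (hsupp : ∀ y ∈ Ioo p q, ∀ x, (x, y) ∈ tsupport φ → x ∈ I)
    (hf : MemLp f 2 (volume.restrict I)) (hk : MemLp k 2 (volume.restrict I))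
    (hfk : HasWeakDeriv I 1 f k) (a b : ℝ) :
    ∫ z, ((fderiv ℝ φ z (1, 0) : ℝ) : ℂ) * (((a + b * z.2 : ℝ) : ℂ) * f z.1)
        ∂(volume.restrict I).prod (volume.restrict (Ioo p q))
      = - ∫ z, (φ z : ℂ) * (((a + b * z.2 : ℝ) : ℂ) * k z.1)
          ∂(volume.restrict I).prod (volume.restrict (Ioo p q)) := by
  have hd := continuous_fderiv_apply_of_contDiff h1 ((1 : ℝ), (0 : ℝ))
  have i1 : Integrable (fun z : ℝ × ℝ => ((fderiv ℝ φ z (1, 0) : ℝ) : ℂ)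
      * (((a + b * z.2 : ℝ) : ℂ) * f z.1))
      ((volume.restrict I).prod (volume.restrict (Ioo p q))) := by
    have hm := memLp_affine_mul (p := p) (q := q) hf a b
    rw [← volume_restrict_prod] at hm ⊢
    exact integrable_test_mul hd (hasCompactSupport_fderiv_apply h2 _) hm
  have i2 : Integrable (fun z : ℝ × ℝ => (φ z : ℂ) * (((a + b * z.2 : ℝ) : ℂ) * k z.1))
      ((volume.restrict I).prod (volume.restrict (Ioo p q))) := by
    have hm := memLp_affine_mul (p := p) (q := q) hk a b
    rw [← volume_restrict_prod] at hm ⊢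
    exact integrable_test_mul h1.continuous h2 hm
  rw [integral_prod_symm _ i1, integral_prod_symm _ i2, ← integral_neg]
  refine setIntegral_congr_fun measurableSet_Ioo fun y hy => ?_
  have hw := hfk (fun x => φ (x, y)) (h1.comp (by fun_prop)) (hasCompactSupport_section_fst h2 y)
    (fun x hx => hsupp y hy x (tsupport_section_fst_subset y hx))
  simp only [fderiv_apply_one_eq_deriv, fun x => (hasDerivAt_section_fst h1 x y).deriv] at hw
  simp only
  simp_rw [mul_left_comm _ (((a + b * y : ℝ) : ℂ))]
  rw [integral_const_mul, integral_const_mul, hw]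
  ring

theorem hasWeakDeriv_const (a b : ℝ) (c : ℂ) : HasWeakDeriv (Ioo a b) 1 (fun _ => c) 0 := by
  intro ψ h1 h2 h3
  rcases le_or_gt b a with hab | hab
  · simp [Ioo_eq_empty hab.not_gt]
  have ha : ψ a = 0 := image_eq_zero_of_notMem_tsupport fun h => lt_irrefl a (h3 h).1
  have hb : ψ b = 0 := image_eq_zero_of_notMem_tsupport fun h => lt_irrefl b (h3 h).2
  simp only [fderiv_apply_one_eq_deriv, Pi.zero_apply, mul_zero, integral_zero, neg_zero]
  rw [integral_mul_const, integral_complex_ofReal, ← integral_Ioc_eq_integral_Ioo,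
    ← intervalIntegral.integral_of_le hab.le,
    intervalIntegral.integral_deriv_eq_sub (fun x _ => h1.differentiable (by simp) x)
      ((h1.continuous_deriv (by simp)).intervalIntegrable _ _), ha, hb]
  simp

end Test

end Waveguide

namespace Waveguide

namespace Params

variable {p : Params} {ε₀ ε : ℝ}

/-! ### The trial function -/

/-- The projection of the passage to the first coordinate. -/
def gate (p : Params) (ε : ℝ) : Set ℝ := Ioo (-(p.d ε / 2)) (p.d ε / 2)

theorem restrict_passage (p : Params) (ε : ℝ) : (volume : Measure (ℝ × ℝ)).restrict (p.passage ε)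
    = (volume.restrict (p.gate ε)).prod (volume.restrict (Ioo 0 (p.h ε))) := by
  rw [passage_eq, volume_restrict_prod, gate]

theorem restrict_room (p : Params) (ε : ℝ) : (volume : Measure (ℝ × ℝ)).restrict (p.room ε)
    = (volume.restrict (Ioo (-(p.b ε / 2)) (p.b ε / 2))).prod
      (volume.restrict (Ioo (p.h ε) (p.h ε + p.b ε))) := by
  rw [room_eq, volume_restrict_prod]

theorem gate_subset (h : p.Admissible ε₀) (hε : ε ∈ Ioc 0 ε₀) :
    p.gate ε ⊆ Ioo (-ε₀) ε₀ := by
  have := h.d_lt_eps hε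
  have := p.d_pos hε.1
  exact Ioo_subset_Ioo (by linarith [hε.2]) (by linarith [hε.2])

theorem memLp_passageLift {f : ℝ → ℂ} (hf : MemLp f 2 (volume.restrict (p.gate ε))) (a b : ℝ) :
    MemLp ((p.passage ε).indicator fun z : ℝ × ℝ => ((a + b * z.2 : ℝ) : ℂ) * f z.1) 2
      (volume.restrict (p.Omega ε)) := by
  rw [memLp_indicator_iff_restrict (p.isOpen_passage ε).measurableSet,
    Measure.restrict_restrict_of_subset (p.passage_subset ε), restrict_passage]
  exact memLp_affine_mul hf a b

/-- The function `(a + b x₂) f(x₁)` on the passage, extended by zero. -/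
def passageLift {f : ℝ → ℂ} (hf : MemLp f 2 (volume.restrict (p.gate ε))) (a b : ℝ) : p.HEps ε :=
  (memLp_passageLift hf a b).toLp

theorem passageLift_ae {f : ℝ → ℂ} (hf : MemLp f 2 (volume.restrict (p.gate ε))) (a b : ℝ) :
    passageLift hf a b =ᵐ[volume.restrict (p.Omega ε)]
      (p.passage ε).indicator fun z : ℝ × ℝ => ((a + b * z.2 : ℝ) : ℂ) * f z.1 :=
  MemLp.coeFn_toLp _

theorem norm_passageLift_sq_le (hε : 0 < ε) {f : ℝ → ℂ}
    (hf : MemLp f 2 (volume.restrict (p.gate ε))) {a b M K : ℝ}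
    (hab : ∀ y ∈ Ioo 0 (p.h ε), |a + b * y| ≤ M)
    (hfK : ∀ᵐ x ∂volume.restrict (p.gate ε), ‖f x‖ ≤ K) :
    ‖passageLift hf a b‖ ^ 2 ≤ (M * K) ^ 2 * (p.d ε * p.h ε) := by
  have hd := p.d_pos hε
  have hh := p.h_pos hε
  have hM : 0 ≤ M := (abs_nonneg _).trans (hab (p.h ε / 2) ⟨by linarith, by linarith⟩)
  have e1 : ‖passageLift hf a b‖ ^ 2
      = ∫ z in p.passage ε, ‖((a + b * z.2 : ℝ) : ℂ) * f z.1‖ ^ 2 := by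
    rw [norm_L2_sq, ← Measure.restrict_restrict_of_subset (p.passage_subset ε),
      ← integral_indicator (p.isOpen_passage ε).measurableSet]
    refine integral_congr_ae ?_
    filter_upwards [passageLift_ae hf a b] with z hz
    rw [hz]
    by_cases h : z ∈ p.passage ε <;> simp [h]
  have hvol : volume.real (p.passage ε) = p.d ε * p.h ε := by
    rw [passage_eq, Measure.volume_eq_prod, measureReal_prod_prod,
      Real.volume_real_Ioo_of_le (by linarith), Real.volume_real_Ioo_of_le (by linarith)]
    ring
  have hfin : volume (p.passage ε) ≠ ⊤ := by
    intro h0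
    rw [Measure.real, h0, ENNReal.toReal_top] at hvol
    exact (mul_pos hd hh).ne hvol
  rw [e1]
  have hle : ∫ z in p.passage ε, ‖((a + b * z.2 : ℝ) : ℂ) * f z.1‖ ^ 2
      ≤ ∫ z in p.passage ε, (M * K) ^ 2 := by
    refine integral_mono_ae ?_ ?_ ?_
    · rw [restrict_passage]
      exact integrable_norm_sq (memLp_affine_mul hf a b)
    · exact integrableOn_const hfin
    · have hK' : ∀ᵐ z ∂volume.restrict (p.passage ε), ‖f z.1‖ ≤ K := by
        rw [restrict_passage]
        exact Measure.quasiMeasurePreserving_fst.ae hfK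
      filter_upwards [hK', ae_restrict_mem (p.isOpen_passage ε).measurableSet] with z h1 h2
      rw [norm_mul, Complex.norm_real, Real.norm_eq_abs]
      have := hab z.2 h2.2
      gcongr
  refine hle.trans_eq ?_
  rw [setIntegral_const, hvol, smul_eq_mul, mul_comm]

theorem ae_strip_J (f : p.HZero) : ∀ᵐ z ∂volume.restrict (p.strip ε),
    p.J ε f z = ((ε ^ (-1 / 2 : ℝ) : ℝ) : ℂ) * f.fst z.1 := by
  filter_upwards [ae_restrict_of_ae_restrict_of_subset (p.strip_subset ε) (p.J_apply_ae ε f),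
    ae_restrict_mem (p.isOpen_strip ε).measurableSet] with z h1 h2
  rw [h1, if_pos h2]

theorem ae_passage_J (f : p.HZero) : ∀ᵐ z ∂volume.restrict (p.passage ε), p.J ε f z = 0 := by
  filter_upwards [ae_restrict_of_ae_restrict_of_subset (p.passage_subset ε) (p.J_apply_ae ε f),
    ae_restrict_mem (p.isOpen_passage ε).measurableSet] with z h1 h2
  rw [h1, if_neg fun h => (p.disjoint_strip_passage ε).le_bot ⟨h, h2⟩,
    if_neg fun h => (p.disjoint_passage_room ε).le_bot ⟨h2, h⟩]

theorem ae_room_J (hε : 0 < ε) (f : p.HZero) : ∀ᵐ z ∂volume.restrict (p.room ε),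
    p.J ε f z = (((p.b ε)⁻¹ : ℝ) : ℂ) * f.snd := by
  filter_upwards [ae_restrict_of_ae_restrict_of_subset (p.room_subset ε) (p.J_apply_ae ε f),
    ae_restrict_mem (p.isOpen_room ε).measurableSet] with z h1 h2
  rw [h1, if_neg fun h => (p.disjoint_strip_room hε).le_bot ⟨h, h2⟩, if_pos h2]

section Lift

variable {f : ℝ → ℂ} (hf : MemLp f 2 (volume.restrict (p.gate ε))) (a b : ℝ)

theorem ae_strip_passageLift : ∀ᵐ z ∂volume.restrict (p.strip ε), passageLift hf a b z = 0 := by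
  filter_upwards [ae_restrict_of_ae_restrict_of_subset (p.strip_subset ε) (passageLift_ae hf a b),
    ae_restrict_mem (p.isOpen_strip ε).measurableSet] with z h1 h2
  rw [h1, indicator_of_notMem fun h => (p.disjoint_strip_passage ε).le_bot ⟨h2, h⟩]

theorem ae_room_passageLift : ∀ᵐ z ∂volume.restrict (p.room ε), passageLift hf a b z = 0 := by
  filter_upwards [ae_restrict_of_ae_restrict_of_subset (p.room_subset ε) (passageLift_ae hf a b),
    ae_restrict_mem (p.isOpen_room ε).measurableSet] with z h1 h2
  rw [h1, indicator_of_notMem fun h => (p.disjoint_passage_room ε).le_bot ⟨h, h2⟩]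

theorem ae_passage_passageLift : ∀ᵐ z ∂volume.restrict (p.passage ε),
    passageLift hf a b z = ((a + b * z.2 : ℝ) : ℂ) * f z.1 := by
  filter_upwards [ae_restrict_of_ae_restrict_of_subset (p.passage_subset ε)
    (passageLift_ae hf a b), ae_restrict_mem (p.isOpen_passage ε).measurableSet] with z h1 h2
  rw [h1, indicator_of_mem h2]

end Lift

section Trial

variable {g : p.HZero} {k : L2 p.Omega0}
  (hg : MemLp (fun x => ((ε ^ (-1 / 2 : ℝ) : ℝ) : ℂ) * g.fst x) 2 (volume.restrict (p.gate ε)))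
  (hk : MemLp (fun x => ((ε ^ (-1 / 2 : ℝ) : ℝ) : ℂ) * k x) 2 (volume.restrict (p.gate ε)))
  (hc : MemLp (fun _ : ℝ => (((p.b ε)⁻¹ : ℝ) : ℂ) * g.snd) 2 (volume.restrict (p.gate ε)))

/-- The correction that joins the values of `J_ε g` in the strip and in the room by an affine
function of the height of the passage. -/
def trialCorrection : p.HEps ε :=
  passageLift hg 1 (-(p.h ε)⁻¹) + passageLift hc 0 (p.h ε)⁻¹

theorem ae_strip_trial : ∀ᵐ z ∂volume.restrict (p.strip ε),
    (p.J ε g + trialCorrection hg hc : p.HEps ε) z = ((ε ^ (-1 / 2 : ℝ) : ℝ) : ℂ) * g.fst z.1 := by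
  filter_upwards [ae_restrict_of_ae_restrict_of_subset (p.strip_subset ε)
      (Lp.coeFn_add (p.J ε g) (trialCorrection hg hc)),
    ae_restrict_of_ae_restrict_of_subset (p.strip_subset ε)
      (Lp.coeFn_add (passageLift hg 1 (-(p.h ε)⁻¹)) (passageLift hc 0 (p.h ε)⁻¹)),
    ae_strip_J g, ae_strip_passageLift hg 1 (-(p.h ε)⁻¹), ae_strip_passageLift hc 0 (p.h ε)⁻¹]
    with z h1 h2 h3 h4 h5
  rw [h1, Pi.add_apply, trialCorrection, h2, Pi.add_apply, h3, h4, h5, add_zero, add_zero]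

theorem ae_room_trial (hε : 0 < ε) : ∀ᵐ z ∂volume.restrict (p.room ε),
    (p.J ε g + trialCorrection hg hc : p.HEps ε) z = (((p.b ε)⁻¹ : ℝ) : ℂ) * g.snd := by
  filter_upwards [ae_restrict_of_ae_restrict_of_subset (p.room_subset ε)
      (Lp.coeFn_add (p.J ε g) (trialCorrection hg hc)),
    ae_restrict_of_ae_restrict_of_subset (p.room_subset ε)
      (Lp.coeFn_add (passageLift hg 1 (-(p.h ε)⁻¹)) (passageLift hc 0 (p.h ε)⁻¹)),
    ae_room_J hε g, ae_room_passageLift hg 1 (-(p.h ε)⁻¹), ae_room_passageLift hc 0 (p.h ε)⁻¹]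
    with z h1 h2 h3 h4 h5
  rw [h1, Pi.add_apply, trialCorrection, h2, Pi.add_apply, h3, h4, h5, add_zero, add_zero]

theorem ae_passage_trial : ∀ᵐ z ∂volume.restrict (p.passage ε),
    (p.J ε g + trialCorrection hg hc : p.HEps ε) z
      = ((1 + -(p.h ε)⁻¹ * z.2 : ℝ) : ℂ) * (((ε ^ (-1 / 2 : ℝ) : ℝ) : ℂ) * g.fst z.1)
        + ((0 + (p.h ε)⁻¹ * z.2 : ℝ) : ℂ) * ((((p.b ε)⁻¹ : ℝ) : ℂ) * g.snd) := by
  filter_upwards [ae_restrict_of_ae_restrict_of_subset (p.passage_subset ε)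
      (Lp.coeFn_add (p.J ε g) (trialCorrection hg hc)),
    ae_restrict_of_ae_restrict_of_subset (p.passage_subset ε)
      (Lp.coeFn_add (passageLift hg 1 (-(p.h ε)⁻¹)) (passageLift hc 0 (p.h ε)⁻¹)),
    ae_passage_J g, ae_passage_passageLift hg 1 (-(p.h ε)⁻¹),
    ae_passage_passageLift hc 0 (p.h ε)⁻¹]
    with z h1 h2 h3 h4 h5
  rw [h1, Pi.add_apply, trialCorrection, h2, Pi.add_apply, h3, h4, h5, zero_add]

open scoped ContDiff

theorem setIntegral_test_Omega {φ : ℝ × ℝ → ℝ} (hε : 0 < ε) (h1 : Continuous φ)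
    (h2 : HasCompactSupport φ) (u : p.HEps ε) :
    ∫ z in p.Omega ε, (φ z : ℂ) * u z = (∫ z in p.strip ε, (φ z : ℂ) * u z)
      + (∫ z in p.passage ε, (φ z : ℂ) * u z) + ∫ z in p.room ε, (φ z : ℂ) * u z :=
  setIntegral_Omega hε (integrable_test_mul h1 h2 (Lp.memLp u))

theorem integrableOn_test_passage {φ : ℝ × ℝ → ℝ} (h1 : Continuous φ) (h2 : HasCompactSupport φ)
    {f : ℝ → ℂ} (hf : MemLp f 2 (volume.restrict (p.gate ε))) (a b : ℝ) :
    IntegrableOn (fun z : ℝ × ℝ => (φ z : ℂ) * (((a + b * z.2 : ℝ) : ℂ) * f z.1))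
      (p.passage ε) := by
  have hm := memLp_affine_mul (p := 0) (q := p.h ε) hf a b
  rw [← restrict_passage] at hm
  exact integrable_test_mul h1 h2 hm

/-- A test function supported in `Ω_ε` stays away from the vertical sides of each piece, so
integration by parts in `x₁` leaves no boundary terms. The room value is constant and contributes
nothing. -/
theorem hasWeakDeriv_trial_fst (hε : 0 < ε) (hsub : p.gate ε ⊆ p.Omega0)
    (hw : HasWeakDeriv p.Omega0 1 g.fst k) :
    HasWeakDeriv (p.Omega ε) (1, 0) (p.J ε g + trialCorrection hg hc : p.HEps ε)
      (p.J ε (WithLp.toLp 2 (k, 0)) + passageLift hk 1 (-(p.h ε)⁻¹) : p.HEps ε) := by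
  intro φ h1 h2 h3
  have hd := continuous_fderiv_apply_of_contDiff h1 ((1 : ℝ), (0 : ℝ))
  have hd2 := hasCompactSupport_fderiv_apply h2 ((1 : ℝ), (0 : ℝ))
  rw [setIntegral_test_Omega hε hd hd2, setIntegral_test_Omega hε h1.continuous h2]
  have hws := hw.const_mul ((ε ^ (-1 / 2 : ℝ) : ℝ) : ℂ)
  have S := integral_fderiv_fst_mul (p := -ε) (q := 0) h1 h2
    (fun y hy x hx => (mem_strip_of_mem_Omega hε (h3 hx) hy.2).1)
    ((Lp.memLp g.fst).const_mul ((ε ^ (-1 / 2 : ℝ) : ℝ) : ℂ))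
    ((Lp.memLp k).const_mul ((ε ^ (-1 / 2 : ℝ) : ℝ) : ℂ)) hws 1 0
  have P1 := integral_fderiv_fst_mul (I := p.gate ε) (p := 0) (q := p.h ε) h1 h2
    (fun y hy x hx => abs_lt.1 (mem_passage_of_mem_Omega hε (h3 hx) hy.1 hy.2).1)
    hg hk (hws.mono hsub) 1 (-(p.h ε)⁻¹)
  have P2 := integral_fderiv_fst_mul (I := p.gate ε) (p := 0) (q := p.h ε) h1 h2
    (fun y hy x hx => abs_lt.1 (mem_passage_of_mem_Omega hε (h3 hx) hy.1 hy.2).1)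
    hc MemLp.zero (hasWeakDeriv_const _ _ _) 0 (p.h ε)⁻¹
  have R := integral_fderiv_fst_mul (I := Ioo (-(p.b ε / 2)) (p.b ε / 2)) (p := p.h ε)
    (q := p.h ε + p.b ε) h1 h2
    (fun y hy x hx => abs_lt.1 (mem_room_of_mem_Omega hε (h3 hx) hy.1).1)
    (memLp_const _) MemLp.zero (hasWeakDeriv_const (-(p.b ε / 2)) (p.b ε / 2)
      ((((p.b ε)⁻¹ : ℝ) : ℂ) * g.snd)) 1 0
  rw [← restrict_strip] at S
  rw [← restrict_passage] at P1 P2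
  rw [← restrict_room] at R
  simp only [Pi.zero_apply, mul_zero, integral_zero, neg_zero, zero_mul, add_zero,
    Complex.ofReal_one, one_mul] at S P2 R
  have eS : ∫ z in p.strip ε, ((fderiv ℝ φ z (1, 0) : ℝ) : ℂ)
        * (p.J ε g + trialCorrection hg hc : p.HEps ε) z
      = ∫ z in p.strip ε, ((fderiv ℝ φ z (1, 0) : ℝ) : ℂ)
        * (((ε ^ (-1 / 2 : ℝ) : ℝ) : ℂ) * g.fst z.1) := by
    refine integral_congr_ae ?_
    filter_upwards [ae_strip_trial hg hc] with z hz
    rw [hz]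
  have eR : ∫ z in p.room ε, ((fderiv ℝ φ z (1, 0) : ℝ) : ℂ)
        * (p.J ε g + trialCorrection hg hc : p.HEps ε) z
      = ∫ z in p.room ε, ((fderiv ℝ φ z (1, 0) : ℝ) : ℂ)
        * ((((p.b ε)⁻¹ : ℝ) : ℂ) * g.snd) := by
    refine integral_congr_ae ?_
    filter_upwards [ae_room_trial hg hc hε] with z hz
    rw [hz]
  have eP : ∫ z in p.passage ε, ((fderiv ℝ φ z (1, 0) : ℝ) : ℂ)
        * (p.J ε g + trialCorrection hg hc : p.HEps ε) z
      = (∫ z in p.passage ε, ((fderiv ℝ φ z (1, 0) : ℝ) : ℂ)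
        * (((1 + -(p.h ε)⁻¹ * z.2 : ℝ) : ℂ) * (((ε ^ (-1 / 2 : ℝ) : ℝ) : ℂ) * g.fst z.1)))
        + ∫ z in p.passage ε, ((fderiv ℝ φ z (1, 0) : ℝ) : ℂ)
          * (((0 + (p.h ε)⁻¹ * z.2 : ℝ) : ℂ) * ((((p.b ε)⁻¹ : ℝ) : ℂ) * g.snd)) := by
    rw [← integral_add (integrableOn_test_passage hd hd2 hg _ _)
      (integrableOn_test_passage hd hd2 hc _ _)]
    refine integral_congr_ae ?_
    filter_upwards [ae_passage_trial hg hc] with z hz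
    rw [hz, mul_add]
  have hadd := Lp.coeFn_add (p.J ε (WithLp.toLp 2 (k, 0))) (passageLift hk 1 (-(p.h ε)⁻¹))
  have fS : ∫ z in p.strip ε, (φ z : ℂ)
        * (p.J ε (WithLp.toLp 2 (k, 0)) + passageLift hk 1 (-(p.h ε)⁻¹) : p.HEps ε) z
      = ∫ z in p.strip ε, (φ z : ℂ) * (((ε ^ (-1 / 2 : ℝ) : ℝ) : ℂ) * k z.1) := by
    refine integral_congr_ae ?_
    filter_upwards [ae_restrict_of_ae_restrict_of_subset (p.strip_subset ε) hadd,
      ae_strip_J (WithLp.toLp 2 (k, 0)), ae_strip_passageLift hk 1 (-(p.h ε)⁻¹)] with z a1 a2 a3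
    rw [a1, Pi.add_apply, a2, a3, add_zero]
    rfl
  have fR : ∫ z in p.room ε, (φ z : ℂ)
        * (p.J ε (WithLp.toLp 2 (k, 0)) + passageLift hk 1 (-(p.h ε)⁻¹) : p.HEps ε) z = 0 := by
    refine integral_eq_zero_of_ae ?_
    filter_upwards [ae_restrict_of_ae_restrict_of_subset (p.room_subset ε) hadd,
      ae_room_J hε (WithLp.toLp 2 (k, 0)), ae_room_passageLift hk 1 (-(p.h ε)⁻¹)] with z a1 a2 a3
    rw [a1, Pi.add_apply, a2, a3]
    simp
  have fP : ∫ z in p.passage ε, (φ z : ℂ)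
        * (p.J ε (WithLp.toLp 2 (k, 0)) + passageLift hk 1 (-(p.h ε)⁻¹) : p.HEps ε) z
      = ∫ z in p.passage ε, (φ z : ℂ) * (((1 + -(p.h ε)⁻¹ * z.2 : ℝ) : ℂ)
        * (((ε ^ (-1 / 2 : ℝ) : ℝ) : ℂ) * k z.1)) := by
    refine integral_congr_ae ?_
    filter_upwards [ae_restrict_of_ae_restrict_of_subset (p.passage_subset ε) hadd,
      ae_passage_J (WithLp.toLp 2 (k, 0)), ae_passage_passageLift hk 1 (-(p.h ε)⁻¹)]
      with z a1 a2 a3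
    rw [a1, Pi.add_apply, a2, a3, zero_add]
  rw [eS, eR, eP, fS, fR, fP, S, P1, P2, R]
  ring

/-- The boundary terms at the two ends of the passage cancel those of strip and room, because the
affine weights make the trial function continuous across the gates. The gradient left over lives on
the passage. -/
theorem hasWeakDeriv_trial_snd (h : p.Admissible ε₀) (hε : ε ∈ Ioc 0 ε₀)
    (hgc : MemLp (fun x => (((p.b ε)⁻¹ : ℝ) : ℂ) * g.snd - ((ε ^ (-1 / 2 : ℝ) : ℝ) : ℂ) * g.fst x) 2
      (volume.restrict (p.gate ε))) :
    HasWeakDeriv (p.Omega ε) (0, 1) (p.J ε g + trialCorrection hg hc : p.HEps ε)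
      (passageLift hgc (p.h ε)⁻¹ 0 : p.HEps ε) := by
  have hε0 := hε.1
  have hh := p.h_pos hε0
  have hb := p.b_pos hε0
  have hsub : p.gate ε ⊆ p.Omega0 := (gate_subset h hε).trans h.Ioo_subset
  have hsub' : p.gate ε ⊆ Ioo (-(p.b ε / 2)) (p.b ε / 2) := by
    have := h.d_lt_b hε
    exact Ioo_subset_Ioo (by linarith) (by linarith)
  intro φ h1 h2 h3
  have hd := continuous_fderiv_apply_of_contDiff h1 ((0 : ℝ), (1 : ℝ))
  have hd2 := hasCompactSupport_fderiv_apply h2 ((0 : ℝ), (1 : ℝ))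
  rw [setIntegral_test_Omega hε0 hd hd2, setIntegral_test_Omega hε0 h1.continuous h2]
  -- The test function vanishes on the bottom of the strip, on the top of the room, and at the
  -- levels `0` and `h` off the gate.
  have z1 : ∀ x, φ (x, -ε) = 0 := fun x => image_eq_zero_of_notMem_tsupport fun hx =>
    lt_irrefl _ (mem_strip_of_mem_Omega hε0 (h3 hx) (by simpa using hε0)).2.1
  have z2 : ∀ x, φ (x, p.h ε + p.b ε) = 0 := fun x => image_eq_zero_of_notMem_tsupport fun hx =>
    lt_irrefl _ (mem_room_of_mem_Omega hε0 (h3 hx) (by simpa using hb)).2.2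
  have z3 : ∀ x ∉ p.gate ε, φ (x, 0) = 0 := fun x hx' => image_eq_zero_of_notMem_tsupport fun hx =>
    hx' (abs_lt.1 (abs_lt_of_mem_Omega hε0 (h3 hx) le_rfl hh.le))
  have z4 : ∀ x ∉ p.gate ε, φ (x, p.h ε) = 0 := fun x hx' =>
    image_eq_zero_of_notMem_tsupport fun hx =>
      hx' (abs_lt.1 (abs_lt_of_mem_Omega hε0 (h3 hx) hh.le le_rfl))
  have S := integral_fderiv_snd_mul (p := -ε) (q := 0) (by linarith) h1 h2
    ((Lp.memLp g.fst).const_mul ((ε ^ (-1 / 2 : ℝ) : ℝ) : ℂ)) 1 0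
  have P1 := integral_fderiv_snd_mul (p := 0) (q := p.h ε) hh.le h1 h2 hg 1 (-(p.h ε)⁻¹)
  have P2 := integral_fderiv_snd_mul (p := 0) (q := p.h ε) hh.le h1 h2 hc 0 (p.h ε)⁻¹
  have R := integral_fderiv_snd_mul (I := Ioo (-(p.b ε / 2)) (p.b ε / 2)) (p := p.h ε)
    (q := p.h ε + p.b ε) (by linarith) h1 h2 (memLp_const ((((p.b ε)⁻¹ : ℝ) : ℂ) * g.snd)) 1 0
  rw [← restrict_strip] at S
  rw [← restrict_passage] at P1 P2
  rw [← restrict_room] at R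
  -- At the upper end the strip value has weight `0` and the room value weight `1`; at the lower end
  -- the weights are exchanged.
  have x1 : 1 + -(p.h ε)⁻¹ * p.h ε = 0 := by field_simp; ring
  have x2 : 0 + (p.h ε)⁻¹ * p.h ε = 1 := by field_simp; ring
  rw [x1] at P1
  rw [x2] at P2
  simp only [z1, z2, mul_zero, integral_zero, zero_mul, add_zero, sub_zero, zero_sub,
    Complex.ofReal_zero, Complex.ofReal_one, one_mul] at S P1 P2 R
  have b1 : ∫ x in p.Omega0, (φ (x, 0) : ℂ) * (((ε ^ (-1 / 2 : ℝ) : ℝ) : ℂ) * g.fst x)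
      = ∫ x in p.gate ε, (φ (x, 0) : ℂ) * (((ε ^ (-1 / 2 : ℝ) : ℝ) : ℂ) * g.fst x) :=
    setIntegral_eq_of_subset_of_forall_sdiff_eq_zero p.isOpen_Omega0.measurableSet hsub
      fun x hx => by simp [z3 x hx.2]
  have b2 : ∫ x in Ioo (-(p.b ε / 2)) (p.b ε / 2),
        (φ (x, p.h ε) : ℂ) * ((((p.b ε)⁻¹ : ℝ) : ℂ) * g.snd)
      = ∫ x in p.gate ε, (φ (x, p.h ε) : ℂ) * ((((p.b ε)⁻¹ : ℝ) : ℂ) * g.snd) :=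
    setIntegral_eq_of_subset_of_forall_sdiff_eq_zero measurableSet_Ioo hsub'
      fun x hx => by simp [z4 x hx.2]
  have eS : ∫ z in p.strip ε, ((fderiv ℝ φ z (0, 1) : ℝ) : ℂ)
        * (p.J ε g + trialCorrection hg hc : p.HEps ε) z
      = ∫ z in p.strip ε, ((fderiv ℝ φ z (0, 1) : ℝ) : ℂ)
        * (((ε ^ (-1 / 2 : ℝ) : ℝ) : ℂ) * g.fst z.1) := by
    refine integral_congr_ae ?_
    filter_upwards [ae_strip_trial hg hc] with z hz
    rw [hz]
  have eR : ∫ z in p.room ε, ((fderiv ℝ φ z (0, 1) : ℝ) : ℂ)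
        * (p.J ε g + trialCorrection hg hc : p.HEps ε) z
      = ∫ z in p.room ε, ((fderiv ℝ φ z (0, 1) : ℝ) : ℂ)
        * ((((p.b ε)⁻¹ : ℝ) : ℂ) * g.snd) := by
    refine integral_congr_ae ?_
    filter_upwards [ae_room_trial hg hc hε0] with z hz
    rw [hz]
  have eP : ∫ z in p.passage ε, ((fderiv ℝ φ z (0, 1) : ℝ) : ℂ)
        * (p.J ε g + trialCorrection hg hc : p.HEps ε) z
      = (∫ z in p.passage ε, ((fderiv ℝ φ z (0, 1) : ℝ) : ℂ)
        * (((1 + -(p.h ε)⁻¹ * z.2 : ℝ) : ℂ) * (((ε ^ (-1 / 2 : ℝ) : ℝ) : ℂ) * g.fst z.1)))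
        + ∫ z in p.passage ε, ((fderiv ℝ φ z (0, 1) : ℝ) : ℂ)
          * (((0 + (p.h ε)⁻¹ * z.2 : ℝ) : ℂ) * ((((p.b ε)⁻¹ : ℝ) : ℂ) * g.snd)) := by
    rw [← integral_add (integrableOn_test_passage hd hd2 hg _ _)
      (integrableOn_test_passage hd hd2 hc _ _)]
    refine integral_congr_ae ?_
    filter_upwards [ae_passage_trial hg hc] with z hz
    rw [hz, mul_add]
  have fS : ∫ z in p.strip ε, (φ z : ℂ) * (passageLift hgc (p.h ε)⁻¹ 0 : p.HEps ε) z = 0 := by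
    refine integral_eq_zero_of_ae ?_
    filter_upwards [ae_strip_passageLift hgc (p.h ε)⁻¹ 0] with z a1
    rw [a1, mul_zero, Pi.zero_apply]
  have fR : ∫ z in p.room ε, (φ z : ℂ) * (passageLift hgc (p.h ε)⁻¹ 0 : p.HEps ε) z = 0 := by
    refine integral_eq_zero_of_ae ?_
    filter_upwards [ae_room_passageLift hgc (p.h ε)⁻¹ 0] with z a1
    rw [a1, mul_zero, Pi.zero_apply]
  have fP : ∫ z in p.passage ε, (φ z : ℂ) * (passageLift hgc (p.h ε)⁻¹ 0 : p.HEps ε) z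
      = (∫ z in p.passage ε, (φ z : ℂ) * ((((p.h ε)⁻¹ + 0 * z.2 : ℝ) : ℂ)
          * ((((p.b ε)⁻¹ : ℝ) : ℂ) * g.snd)))
        + ∫ z in p.passage ε, (φ z : ℂ) * (((-(p.h ε)⁻¹ + 0 * z.2 : ℝ) : ℂ)
          * (((ε ^ (-1 / 2 : ℝ) : ℝ) : ℂ) * g.fst z.1)) := by
    rw [← integral_add (integrableOn_test_passage h1.continuous h2 hc _ _)
      (integrableOn_test_passage h1.continuous h2 hg _ _)]
    refine integral_congr_ae ?_
    filter_upwards [ae_passage_passageLift hgc (p.h ε)⁻¹ 0] with z a1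
    rw [a1]
    push_cast
    ring
  simp only [zero_mul, add_zero] at fP
  rw [eS, eR, eP, fS, fR, fP, S, P1, P2, R, b1, b2]
  ring

end Trial

end Params

end Waveguide

/-! ### Test functions on the line; the limit form and its solutions -/

namespace Waveguide

open scoped ContDiff

section Line

variable {U : Set ℝ}

theorem memLp_test {φ : ℝ → ℝ} (h1 : Continuous φ) (h2 : HasCompactSupport φ) :
    MemLp (fun x => (φ x : ℂ)) 2 (volume.restrict U) :=
  (Complex.continuous_ofReal.comp h1).memLp_of_hasCompactSupport
    (h2.comp_left (g := Complex.ofReal) Complex.ofReal_zero)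

/-- No condition on the support of `φ` relative to `U` is needed, since the other test function `ψ`
already vanishes outside `U`. -/
theorem hasWeakDeriv_test {φ : ℝ → ℝ} (h1 : ContDiff ℝ ∞ φ) (h2 : HasCompactSupport φ) :
    HasWeakDeriv U 1 (fun x => (φ x : ℂ)) fun x => ((fderiv ℝ φ x 1 : ℝ) : ℂ) := by
  intro ψ g1 g2 g3
  have hs : tsupport (fun x => fderiv ℝ ψ x 1) ⊆ U := (tsupport_fderiv_apply_subset 1).trans g3
  rw [setIntegral_eq_integral_of_tsupport_subset hs, setIntegral_eq_integral_of_tsupport_subset g3]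
  simp_rw [← Complex.ofReal_mul]
  rw [integral_complex_ofReal, integral_complex_ofReal, ← Complex.ofReal_neg]
  congr 1
  simp only [fderiv_apply_one_eq_deriv]
  have c1 := g1.continuous_deriv (by simp)
  have c2 := h1.continuous_deriv (by simp)
  have := integral_mul_deriv_eq_deriv_mul_of_integrable
    (fun x _ => (g1.differentiable (by simp) x).hasDerivAt)
    (fun x _ => (h1.differentiable (by simp) x).hasDerivAt)
    ((g1.continuous.mul c2).integrable_of_hasCompactSupport g2.mul_right)
    ((c1.mul h1.continuous).integrable_of_hasCompactSupport h2.mul_left)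
    ((g1.continuous.mul h1.continuous).integrable_of_hasCompactSupport g2.mul_right)
  linarith

end Line

namespace Params

variable {p : Params} {ε₀ ε : ℝ} {V₀ : ℝ → ℝ}

/-! ### The form `a₀` -/

theorem formZero_apply (hV : MemLp V₀ ⊤ (volume.restrict p.Omega0)) (u v : p.HZero) :
    (p.formZero V₀).form u v
      = inner ℂ (weakDeriv p.Omega0 1 v.fst) (weakDeriv p.Omega0 1 u.fst)
        + inner ℂ v.fst (mulLp hV u.fst)
        + (p.γ : ℂ) * pointValue p.Omega0 u.fst 0 * star (pointValue p.Omega0 v.fst 0) := by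
  rw [inner_L2_eq, inner_mulLp]
  have i3 : Integrable (fun x => (V₀ x : ℂ) * u.fst x * star (v.fst x))
      (volume.restrict p.Omega0) := by
    refine (integrable_mul_star (mulLp hV u.fst) v.fst).congr ?_
    filter_upwards [mulLp_coeFn hV u.fst] with x hx
    rw [hx]
  rw [← integral_add (integrable_mul_star _ _) i3]
  rfl

theorem formZero_apply_sqrt (hV : MemLp V₀ ⊤ (volume.restrict p.Omega0))
    (hV0 : ∀ᵐ x ∂volume.restrict p.Omega0, 0 ≤ V₀ x) (u v : p.HZero) :
    (p.formZero V₀).form u v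
      = inner ℂ (weakDeriv p.Omega0 1 v.fst) (weakDeriv p.Omega0 1 u.fst)
        + inner ℂ (mulLp (memLp_sqrt hV) v.fst) (mulLp (memLp_sqrt hV) u.fst)
        + (p.γ : ℂ) * pointValue p.Omega0 u.fst 0 * star (pointValue p.Omega0 v.fst 0) := by
  rw [formZero_apply hV, inner_mulLp_sqrt hV hV0, inner_mulLp]

theorem formZero_re (hV : MemLp V₀ ⊤ (volume.restrict p.Omega0))
    (hV0 : ∀ᵐ x ∂volume.restrict p.Omega0, 0 ≤ V₀ x) (u : p.HZero) :
    ‖weakDeriv p.Omega0 1 u.fst‖ ^ 2 + p.γ * ‖pointValue p.Omega0 u.fst 0‖ ^ 2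
      ≤ ((p.formZero V₀).form u u).re := by
  have e : (p.γ : ℂ) * pointValue p.Omega0 u.fst 0 * star (pointValue p.Omega0 u.fst 0)
      = ((p.γ * ‖pointValue p.Omega0 u.fst 0‖ ^ 2 : ℝ) : ℂ) := by
    rw [mul_assoc, Complex.star_def, Complex.mul_conj, Complex.normSq_eq_norm_sq]
    push_cast
    ring
  rw [formZero_apply_sqrt hV hV0, e, Complex.add_re, Complex.add_re, Complex.ofReal_re,
    re_inner_self, re_inner_self]
  linarith [sq_nonneg ‖mulLp (memLp_sqrt hV) u.fst‖]

theorem formZero_nonneg (hV : MemLp V₀ ⊤ (volume.restrict p.Omega0))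
    (hV0 : ∀ᵐ x ∂volume.restrict p.Omega0, 0 ≤ V₀ x) (u : p.HZero) :
    0 ≤ ((p.formZero V₀).form u u).re := by
  refine le_trans ?_ (formZero_re hV hV0 u)
  have := p.γ_pos
  positivity

theorem formZero_energyNorm_sq_ge (hV : MemLp V₀ ⊤ (volume.restrict p.Omega0))
    (hV0 : ∀ᵐ x ∂volume.restrict p.Omega0, 0 ≤ V₀ x) (u : p.HZero) :
    ‖weakDeriv p.Omega0 1 u.fst‖ ^ 2 + p.γ * ‖pointValue p.Omega0 u.fst 0‖ ^ 2 + ‖u‖ ^ 2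
      ≤ (p.formZero V₀).energyNorm u ^ 2 := by
  have h := formZero_re hV hV0 u
  have h0 := formZero_nonneg hV hV0 u
  rw [HForm.energyNorm, Real.sq_sqrt (by positivity)]
  linarith

/-! ### Regularity of solutions of the limit equation -/

/-- Away from the origin, the derivative of a solution of the limit equation is again weakly
differentiable. -/
theorem hasWeakDeriv_of_operatorEq (hV : MemLp V₀ ⊤ (volume.restrict p.Omega0)) {g f : p.HZero}
    (hg : (p.formZero V₀).OperatorEq g (f - g)) {a b : ℝ} (hab : Ioo a b ⊆ p.Omega0)
    (h0 : (0 : ℝ) ∉ Ioo a b) :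
    HasWeakDeriv (Ioo a b) 1 (weakDeriv p.Omega0 1 g.fst)
      (mulLp hV g.fst + g.fst - f.fst : L2 p.Omega0) := by
  intro φ h1 h2 h3
  have hφ : HasWeakDeriv p.Omega0 1 (fun x => (φ x : ℂ)) fun x => ((fderiv ℝ φ x 1 : ℝ) : ℂ) :=
    hasWeakDeriv_test h1 h2
  have hd := continuous_fderiv_apply_of_contDiff h1 (1 : ℝ)
  have hd2 := hasCompactSupport_fderiv_apply h2 (1 : ℝ)
  have hm1 : MemLp (fun x => (φ x : ℂ)) 2 (volume.restrict p.Omega0) :=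
    memLp_test h1.continuous h2
  have hm2 : MemLp (fun x => ((fderiv ℝ φ x 1 : ℝ) : ℂ)) 2 (volume.restrict p.Omega0) :=
    memLp_test hd hd2
  have hw : HasWeakDeriv p.Omega0 1 hm1.toLp hm2.toLp :=
    hφ.congr_ae hm1.coeFn_toLp.symm hm2.coeFn_toLp.symm
  -- The test function avoids the origin, so it does not feel the point interaction; its `ℂ`
  -- component is chosen zero.
  have hpv : pointValue p.Omega0 hm1.toLp 0 = 0 := by
    rw [pointValue_eq p.isOpen_Omega0 (Complex.continuous_ofReal.comp h1.continuous).continuousOn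
      hm1.coeFn_toLp p.zero_mem_Omega0]
    simp [image_eq_zero_of_notMem_tsupport fun h => h0 (h3 h)]
  have key := hg.2 (WithLp.toLp 2 (hm1.toLp, 0)) ⟨_, hw⟩
  rw [formZero_apply hV] at key
  have e0 : inner ℂ (WithLp.toLp 2 (hm1.toLp, (0 : ℂ)) : p.HZero) (f - g)
      = inner ℂ hm1.toLp (f.fst - g.fst) := by
    have : inner ℂ (WithLp.toLp 2 (hm1.toLp, (0 : ℂ)) : p.HZero) (f - g)
      = inner ℂ hm1.toLp (f - g).fst + inner ℂ (0 : ℂ) (f - g).snd := rfl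
    rw [this, inner_zero_left, add_zero]
    rfl
  have e1 : (WithLp.toLp 2 (hm1.toLp, (0 : ℂ)) : p.HZero).fst = hm1.toLp := rfl
  rw [e0, e1] at key
  rw [hpv, weakDeriv_eq p.isOpen_Omega0 hw, star_zero, mul_zero, add_zero] at key
  have I1 : ∀ u : L2 p.Omega0, inner ℂ hm1.toLp u = ∫ x in p.Omega0, (φ x : ℂ) * u x := by
    intro u
    rw [inner_L2_eq]
    refine integral_congr_ae ?_
    filter_upwards [hm1.coeFn_toLp] with x hx
    rw [hx, Complex.star_def, Complex.conj_ofReal, mul_comm]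
  have I2 : ∀ u : L2 p.Omega0, inner ℂ hm2.toLp u
      = ∫ x in p.Omega0, ((fderiv ℝ φ x 1 : ℝ) : ℂ) * u x := by
    intro u
    rw [inner_L2_eq]
    refine integral_congr_ae ?_
    filter_upwards [hm2.coeFn_toLp] with x hx
    rw [hx, Complex.star_def, Complex.conj_ofReal, mul_comm]
  have hs : tsupport (fun x => fderiv ℝ φ x 1) ⊆ Ioo a b := (tsupport_fderiv_apply_subset 1).trans h3
  rw [setIntegral_eq_integral_of_tsupport_subset hs, setIntegral_eq_integral_of_tsupport_subset h3,
    ← setIntegral_eq_integral_of_tsupport_subset (hs.trans hab),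
    ← setIntegral_eq_integral_of_tsupport_subset (h3.trans hab), ← I1, ← I2, inner_sub_right,
    inner_add_right]
  rw [inner_sub_right] at key
  linear_combination -key

/-- The bound for the derivative of a solution of the limit equation near the origin. -/
def slopeConst (ε₀ M : ℝ) : ℝ := √(2 * ε₀⁻¹ + 2 * ε₀ * (M + 2) ^ 2)

theorem slopeConst_nonneg (ε₀ M : ℝ) : 0 ≤ slopeConst ε₀ M := Real.sqrt_nonneg _

section Solution

variable {g f : p.HZero}

/-- The derivative may jump at the origin, but on each side it has the weak derivative `V₀ g + g -
f` in `L²`, with norm at most `(‖V₀‖ + 2) ‖f‖` in terms of the multiplication operator. Sobolev on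
each of the two half intervals, of length `ε₀`, gives the bound. -/
theorem ae_norm_weakDeriv_le (h : p.Admissible ε₀) (hV : MemLp V₀ ⊤ (volume.restrict p.Omega0))
    (hg : (p.formZero V₀).OperatorEq g (f - g)) (hgn : ‖g‖ ≤ ‖f‖)
    (hkn : ‖weakDeriv p.Omega0 1 g.fst‖ ≤ ‖f‖) :
    ∀ᵐ x ∂volume.restrict (Ioo (-ε₀) ε₀),
      ‖weakDeriv p.Omega0 1 g.fst x‖ ≤ slopeConst ε₀ ‖mulLp hV‖ * ‖f‖ := by
  have hε₀ := h.pos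
  set k := weakDeriv p.Omega0 1 g.fst
  set q : L2 p.Omega0 := mulLp hV g.fst + g.fst - f.fst with hq
  have hgf : ‖g.fst‖ ≤ ‖f‖ := (norm_fst_le g).trans hgn
  have hqn : ‖q‖ ≤ (‖mulLp hV‖ + 2) * ‖f‖ := by
    calc ‖q‖ ≤ ‖mulLp hV g.fst + g.fst‖ + ‖f.fst‖ := norm_sub_le _ _
      _ ≤ ‖mulLp hV g.fst‖ + ‖g.fst‖ + ‖f.fst‖ := by gcongr; exact norm_add_le _ _
      _ ≤ ‖mulLp hV‖ * ‖f‖ + ‖f‖ + ‖f‖ := by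
          gcongr
          · exact (ContinuousLinearMap.le_opNorm _ _).trans (by gcongr)
          · exact norm_fst_le f
      _ = _ := by ring
  have key : ∀ a b : ℝ, Ioo a b ⊆ Ioo (-ε₀) ε₀ → b - a = ε₀ → (0 : ℝ) ∉ Ioo a b →
      ∀ᵐ x ∂volume.restrict (Ioo a b), ‖k x‖ ≤ slopeConst ε₀ ‖mulLp hV‖ * ‖f‖ := by
    intro a b hab hba h0
    have hs := hab.trans h.Ioo_subset
    filter_upwards [(hasWeakDeriv_of_operatorEq hV hg hs h0).ae_norm_sq_le (by linarith)
      (memLp_Ioo_of_subset (Lp.memLp k) hs) (memLp_Ioo_of_subset (Lp.memLp q) hs)] with x hx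
    have b1 := setIntegral_norm_sq_le hs k
    have b2 := setIntegral_norm_sq_le hs q
    rw [hba] at hx
    refine (sq_le_sq₀ (norm_nonneg _) (mul_nonneg (slopeConst_nonneg _ _) (norm_nonneg _))).1 ?_
    rw [mul_pow, slopeConst, Real.sq_sqrt (by positivity)]
    calc ‖k x‖ ^ 2 ≤ _ := hx
      _ ≤ 2 * ε₀⁻¹ * ‖k‖ ^ 2 + 2 * ε₀ * ‖q‖ ^ 2 := by gcongr
      _ ≤ 2 * ε₀⁻¹ * ‖f‖ ^ 2 + 2 * ε₀ * ((‖mulLp hV‖ + 2) * ‖f‖) ^ 2 := by gcongr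
      _ = _ := by ring
  have k1 := key 0 ε₀ (Ioo_subset_Ioo (by linarith) le_rfl) (by ring) (by simp)
  have k2 := key (-ε₀) 0 (Ioo_subset_Ioo le_rfl (by linarith)) (by ring) (by simp)
  rw [ae_restrict_iff' measurableSet_Ioo] at k1 k2 ⊢
  have hne : ∀ᵐ x : ℝ, x ≠ 0 := by simp [ae_iff]
  filter_upwards [k1, k2, hne] with x a1 a2 a3 hx
  rcases lt_or_gt_of_ne a3 with hlt | hgt
  · exact a2 ⟨hx.1, hlt⟩
  · exact a1 ⟨hgt, hx.2⟩

/-- A bounded slope makes `g` Lipschitz, and points of the gate are within `d / 2` of the origin. -/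
theorem ae_norm_sub_pointValue_le (h : p.Admissible ε₀) (hε : ε ∈ Ioc 0 ε₀)
    {g k : L2 p.Omega0} (hgk : HasWeakDeriv p.Omega0 1 g k) {K : ℝ}
    (hK : ∀ᵐ x ∂volume.restrict (Ioo (-ε₀) ε₀), ‖k x‖ ≤ K) :
    ∀ᵐ x ∂volume.restrict (p.gate ε), ‖g x - pointValue p.Omega0 g 0‖ ≤ K * p.d ε := by
  have hsub := gate_subset h hε
  have hd := p.d_pos hε.1
  have hε₀ := h.pos
  have hK0 : 0 ≤ K := by
    have : (ae (volume.restrict (Ioo (-ε₀) ε₀))).NeBot := by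
      rw [ae_restrict_neBot, Real.volume_Ioo]
      simp only [ne_eq, ENNReal.ofReal_eq_zero]
      linarith
    obtain ⟨x, hx⟩ := hK.exists
    exact (norm_nonneg _).trans hx
  filter_upwards [ae_restrict_of_ae_restrict_of_subset (hsub.trans h.Ioo_subset)
    (pointValue_spec p.isOpen_Omega0 p.ordConnected_Omega0 p.zero_mem_Omega0 hgk),
    ae_restrict_mem measurableSet_Ioo] with x hx hxm
  rw [hx, add_sub_cancel_left]
  have hxa : |x| < p.d ε / 2 := abs_lt.2 hxm
  have hxs := hsub hxm
  have := intervalIntegral.norm_integral_le_of_norm_le_const_ae (a := 0) (b := x) (C := K)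
    (f := k) (by
      rw [ae_restrict_iff' measurableSet_Ioo] at hK
      filter_upwards [hK] with t ht htm
      refine ht ?_
      rw [mem_uIoc] at htm
      rcases htm with ⟨t1, t2⟩ | ⟨t1, t2⟩
      · exact ⟨by linarith, t2.trans_lt hxs.2⟩
      · exact ⟨hxs.1.trans t1, by linarith⟩)
  rw [sub_zero] at this
  exact this.trans (by gcongr; linarith)

end Solution

end Params

end Waveguide

namespace Waveguide

namespace Params

variable {p : Params} {ε₀ ε : ℝ} {V₀ : ℝ → ℝ}

/-! ### Comparison of the forms -/

theorem eps_rpow_eq (hε : 0 < ε) : ε ^ (-1 / 2 : ℝ) = (√ε)⁻¹ := by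
  rw [neg_div, Real.rpow_neg hε.le, Real.sqrt_eq_rpow]

/-- The factor `√γ √ε h` is the square root of the area `d h` of the passage. -/
theorem norm_passageLift_le (hε : 0 < ε) {f : ℝ → ℂ}
    (hf : MemLp f 2 (volume.restrict (p.gate ε))) {a b M K : ℝ} (hM : 0 ≤ M) (hK : 0 ≤ K)
    (hab : ∀ y ∈ Ioo 0 (p.h ε), |a + b * y| ≤ M)
    (hfK : ∀ᵐ x ∂volume.restrict (p.gate ε), ‖f x‖ ≤ K) :
    ‖passageLift hf a b‖ ≤ M * K * (√p.γ * √ε * p.h ε) := by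
  have hh := p.h_pos hε
  refine (sq_le_sq₀ (norm_nonneg _) (by positivity)).1
    ((norm_passageLift_sq_le hε hf hab hfK).trans_eq ?_)
  simp only [d_eq hε, mul_pow, Real.sq_sqrt p.γ_pos.le, Real.sq_sqrt hε.le]
  ring

/-- The rate of convergence. -/
def rate (p : Params) (ε : ℝ) : ℝ := ε ^ min p.α (min p.β (1 / 2 - p.β))

theorem rate_pos (hε : 0 < ε) : 0 < p.rate ε := Real.rpow_pos_of_pos hε _

theorem h_le_rate (hε : 0 < ε) (h1 : ε ≤ 1) : p.h ε ≤ p.rate ε :=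
  Real.rpow_le_rpow_of_exponent_ge hε h1 (min_le_left _ _)

theorem eps_le_rate (hε : 0 < ε) (h1 : ε ≤ 1) : ε ≤ p.rate ε := by
  have := Real.rpow_le_rpow_of_exponent_ge hε h1
    (((min_le_right _ _).trans (min_le_left _ _)).trans (by linarith [p.β_lt]) :
      min p.α (min p.β (1 / 2 - p.β)) ≤ 1)
  rwa [Real.rpow_one] at this

theorem sqrt_mul_inv_b (hε : 0 < ε) : √ε * (p.b ε)⁻¹ = ε ^ (1 / 2 - p.β) := by
  rw [Real.sqrt_eq_rpow, b, ← Real.rpow_neg hε.le, ← Real.rpow_add hε]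
  rfl

theorem sqrt_mul_inv_b_le_rate (hε : 0 < ε) (h1 : ε ≤ 1) : √ε * (p.b ε)⁻¹ ≤ p.rate ε := by
  rw [sqrt_mul_inv_b hε]
  exact Real.rpow_le_rpow_of_exponent_ge hε h1 ((min_le_right _ _).trans (min_le_right _ _))

theorem sqrt_mul_inv_b_le_one (hε : 0 < ε) (h1 : ε ≤ 1) : √ε * (p.b ε)⁻¹ ≤ 1 := by
  rw [sqrt_mul_inv_b hε]
  exact Real.rpow_le_one hε.le h1 (by linarith [p.β_lt])

/-- The potential lives on the strip, where the trial function coincides with `J g`. The potential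
terms of the two forms therefore match exactly. -/
theorem mulLp_potential_eq_J (hV : MemLp V₀ ⊤ (volume.restrict p.Omega0)) {t : p.HEps ε}
    {g : L2 p.Omega0} (ht : ∀ᵐ z ∂volume.restrict (p.strip ε),
      t z = ((ε ^ (-1 / 2 : ℝ) : ℝ) : ℂ) * g z.1) :
    mulLp (memLp_potential hV) t = p.J ε (WithLp.toLp 2 (mulLp hV g, 0)) := by
  refine Lp.ext ?_
  have h1 : ∀ᵐ z ∂volume.restrict (p.strip ε), mulLp hV g z.1 = (V₀ z.1 : ℂ) * g z.1 := by
    rw [p.restrict_strip]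
    exact Measure.quasiMeasurePreserving_fst.ae (mulLp_coeFn hV g)
  rw [ae_restrict_iff' (p.isOpen_strip ε).measurableSet] at h1 ht
  filter_upwards [mulLp_coeFn (memLp_potential hV) t, p.J_apply_ae ε (WithLp.toLp 2 (mulLp hV g, 0)),
    ae_restrict_of_ae h1, ae_restrict_of_ae ht] with z a1 a2 a3 a4
  rw [a1, a2]
  by_cases hz : z ∈ p.strip ε
  · have e : (WithLp.toLp 2 (mulLp hV g, (0 : ℂ)) : p.HZero).fst = mulLp hV g := rfl
    rw [if_pos hz, e, a3 hz, a4 hz, potential, if_pos hz]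
    ring
  · rw [if_neg hz, potential, if_neg hz]
    simp

theorem inner_J_fst (k : L2 p.Omega0) (u : p.HEps ε) :
    inner ℂ u (p.J ε (WithLp.toLp 2 (k, 0))) = inner ℂ (p.Jtilde ε u).fst k := by
  rw [inner_J]
  have : inner ℂ (p.Jtilde ε u) (WithLp.toLp 2 (k, (0 : ℂ)) : p.HZero)
    = inner ℂ (p.Jtilde ε u).fst k + inner ℂ (p.Jtilde ε u).snd (0 : ℂ) := rfl
  rw [this, inner_zero_right, add_zero]

/-- A gradient constant on the passage sees of `u` only its integral there; this is how the flux
enters. -/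
theorem inner_passageLift_const (c : ℂ) (a : ℝ)
    (hc : MemLp (fun _ : ℝ => c) 2 (volume.restrict (p.gate ε))) (u : p.HEps ε) :
    inner ℂ u (passageLift hc a 0) = (a : ℂ) * c * star (∫ z in p.passage ε, u z) := by
  rw [inner_L2_eq, ← Measure.restrict_restrict_of_subset (p.passage_subset ε)]
  have : star (∫ z in p.passage ε, u z ∂volume.restrict (p.Omega ε))
      = ∫ z in p.passage ε, star (u z) ∂volume.restrict (p.Omega ε) := integral_conj.symm
  rw [this, ← integral_const_mul, ← integral_indicator (p.isOpen_passage ε).measurableSet]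
  refine integral_congr_ae ?_
  filter_upwards [passageLift_ae hc a 0] with z hz
  rw [hz]
  by_cases h : z ∈ p.passage ε <;> simp [h]

theorem passageLift_add {f₁ f₂ f : ℝ → ℂ} (h₁ : MemLp f₁ 2 (volume.restrict (p.gate ε)))
    (h₂ : MemLp f₂ 2 (volume.restrict (p.gate ε))) (hf : MemLp f 2 (volume.restrict (p.gate ε)))
    (h : ∀ x, f x = f₁ x + f₂ x) (a b : ℝ) :
    passageLift hf a b = passageLift h₁ a b + passageLift h₂ a b := by
  refine Lp.ext ?_
  filter_upwards [passageLift_ae hf a b, passageLift_ae h₁ a b, passageLift_ae h₂ a b,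
    Lp.coeFn_add (passageLift h₁ a b) (passageLift h₂ a b)] with z a1 a2 a3 a4
  rw [a4, Pi.add_apply, a1, a2, a3]
  by_cases hz : z ∈ p.passage ε
  · simp only [indicator_of_mem hz, h, mul_add]
  · simp [hz]

/-- The constant in the estimate of the `L²` distance of the trial function to `J_ε g`. -/
def trialConst (p : Params) (K : ℝ) : ℝ := 1 + √p.γ * K + √p.γ

/-- The constant in the estimate of the difference of the forms. -/
def formConst (p : Params) (K : ℝ) : ℝ :=
  (√p.γ)⁻¹ * p.gateConst + √p.γ * K + √p.γ * (1 + K)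

/-- A function of the limit form domain that is smooth enough near the origin has a good
approximation in the form domain of `a_ε`. -/
theorem exists_trial (h : p.Admissible ε₀) (hε : ε ∈ Ioc 0 ε₀)
    (hV : MemLp V₀ ⊤ (volume.restrict p.Omega0))
    (hV0 : ∀ᵐ x ∂volume.restrict p.Omega0, 0 ≤ V₀ x) {g : p.HZero} {k : L2 p.Omega0}
    (hgk : HasWeakDeriv p.Omega0 1 g.fst k) {N K : ℝ} (hK0 : 0 ≤ K) (hgn : ‖g‖ ≤ N)
    (hpv : √p.γ * ‖pointValue p.Omega0 g.fst 0‖ ≤ N)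
    (hK : ∀ᵐ x ∂volume.restrict (Ioo (-ε₀) ε₀), ‖k x‖ ≤ K * N) :
    ∃ t ∈ (p.formEps ε V₀).dom, ‖t - p.J ε g‖ ≤ p.trialConst K * p.rate ε * N ∧
      ∀ w ∈ (p.formEps ε V₀).dom,
        ‖(p.formZero V₀).form g (p.Jtilde ε w) - (p.formEps ε V₀).form t w‖
          ≤ p.formConst K * p.rate ε * N * (p.formEps ε V₀).energyNorm w := by
  have hε0 := hε.1
  have hε1 : ε ≤ 1 := (hε.2.trans_lt h.lt_one').le
  have hN : 0 ≤ N := (norm_nonneg _).trans hgn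
  have hγ : 0 < √p.γ := Real.sqrt_pos.2 p.γ_pos
  have hr : 0 < √ε := Real.sqrt_pos.2 hε0
  have hh := p.h_pos hε0
  have hb := p.b_pos hε0
  have hd := p.d_pos hε0
  have hdε := h.d_lt_eps hε
  have hρ := p.rate_pos hε0
  have hhρ : p.h ε ≤ p.rate ε := h_le_rate hε0 hε1
  have hερ : ε ≤ p.rate ε := eps_le_rate hε0 hε1
  have hbρ : √ε * (p.b ε)⁻¹ ≤ p.rate ε := sqrt_mul_inv_b_le_rate hε0 hε1
  have hb1 : √ε * (p.b ε)⁻¹ ≤ 1 := sqrt_mul_inv_b_le_one hε0 hε1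
  have hsub := gate_subset h hε
  have hsub0 := hsub.trans h.Ioo_subset
  set s := ε ^ (-1 / 2 : ℝ) with hs
  have hs' : s = (√ε)⁻¹ := eps_rpow_eq hε0
  have hs0 : 0 < s := by rw [hs']; positivity
  have hsr : s * √ε = 1 := by rw [hs']; field_simp
  set v₀ := pointValue p.Omega0 g.fst 0 with hv₀
  have hnv : ‖v₀‖ ≤ (√p.γ)⁻¹ * N := by rw [le_inv_mul_iff₀ hγ]; exact hpv
  have hdiff := ae_norm_sub_pointValue_le h hε hgk hK
  have hgate : volume (p.gate ε) ≠ ⊤ := by rw [gate, Real.volume_Ioo]; exact ENNReal.ofReal_ne_top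
  have : IsFiniteMeasure (volume.restrict (p.gate ε)) := isFiniteMeasure_restrict.2 hgate
  have hg1 : MemLp g.fst 2 (volume.restrict (p.gate ε)) :=
    (Lp.memLp g.fst).mono_measure (Measure.restrict_mono_set _ hsub0)
  have hk1 : MemLp k 2 (volume.restrict (p.gate ε)) :=
    (Lp.memLp k).mono_measure (Measure.restrict_mono_set _ hsub0)
  have hgs := hg1.const_mul (s : ℂ)
  have hks := hk1.const_mul (s : ℂ)
  have hc : MemLp (fun _ : ℝ => (((p.b ε)⁻¹ : ℝ) : ℂ) * g.snd) 2 (volume.restrict (p.gate ε)) :=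
    memLp_const _
  have hgc : MemLp (fun x => (((p.b ε)⁻¹ : ℝ) : ℂ) * g.snd - (s : ℂ) * g.fst x) 2
      (volume.restrict (p.gate ε)) := hc.sub hgs
  -- In the passage the vertical slope is `h⁻¹ (b⁻¹ g₂ - s g₁(x))`. The constant `-s v₀` is its main
  -- part; `herr` collects the room value and the variation of `g₁` over the gate.
  have hcv : MemLp (fun _ : ℝ => -(s : ℂ) * v₀) 2 (volume.restrict (p.gate ε)) := memLp_const _
  have herr : MemLp (fun x => (((p.b ε)⁻¹ : ℝ) : ℂ) * g.snd - (s : ℂ) * (g.fst x - v₀)) 2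
      (volume.restrict (p.gate ε)) := hc.sub ((hg1.sub (memLp_const v₀)).const_mul (s : ℂ))
  have hns : ‖(s : ℂ)‖ = s := by rw [Complex.norm_real, Real.norm_of_nonneg hs0.le]
  have hnb : ‖(((p.b ε)⁻¹ : ℝ) : ℂ)‖ = (p.b ε)⁻¹ := by
    rw [Complex.norm_real, Real.norm_of_nonneg (by positivity)]
  have hncx : ‖(((p.b ε)⁻¹ : ℝ) : ℂ) * g.snd‖ ≤ (p.b ε)⁻¹ * N := by
    rw [norm_mul, hnb]
    gcongr
    exact (norm_snd_le g).trans hgn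
  have haff : ∀ y ∈ Ioo 0 (p.h ε), |1 + -(p.h ε)⁻¹ * y| ≤ 1 := by
    intro y hy
    have h1 : (p.h ε)⁻¹ * y ≤ 1 := by rw [inv_mul_le_iff₀ hh]; linarith [hy.2]
    have h2 : 0 ≤ (p.h ε)⁻¹ * y := mul_nonneg (by positivity) hy.1.le
    rw [abs_le]
    constructor <;> linarith
  have haff' : ∀ y ∈ Ioo 0 (p.h ε), |0 + (p.h ε)⁻¹ * y| ≤ 1 := by
    intro y hy
    have h1 : (p.h ε)⁻¹ * y ≤ 1 := by rw [inv_mul_le_iff₀ hh]; linarith [hy.2]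
    have h2 : 0 ≤ (p.h ε)⁻¹ * y := mul_nonneg (by positivity) hy.1.le
    rw [abs_le]
    constructor <;> linarith
  have hconst : ∀ y ∈ Ioo 0 (p.h ε), |(p.h ε)⁻¹ + 0 * y| ≤ (p.h ε)⁻¹ := by
    intro y _
    rw [zero_mul, add_zero, abs_of_pos (by positivity)]
  -- The strip value has size `s` on a passage of area `γ ε h²`, and `s √ε = 1` leaves order `h`.
  have n1 : ‖passageLift hgs 1 (-(p.h ε)⁻¹)‖ ≤ (1 + √p.γ * K) * p.rate ε * N := by
    have hbd : ∀ᵐ x ∂volume.restrict (p.gate ε),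
        ‖(s : ℂ) * g.fst x‖ ≤ s * ((√p.γ)⁻¹ * N + K * N) := by
      filter_upwards [hdiff] with x hx
      rw [norm_mul, hns]
      gcongr
      calc ‖g.fst x‖ = ‖v₀ + (g.fst x - v₀)‖ := by congr 1; ring
        _ ≤ ‖v₀‖ + ‖g.fst x - v₀‖ := norm_add_le _ _
        _ ≤ (√p.γ)⁻¹ * N + K * N * p.d ε := add_le_add hnv hx
        _ ≤ (√p.γ)⁻¹ * N + K * N * 1 := by gcongr; linarith
        _ = _ := by ring
    refine (norm_passageLift_le hε0 hgs zero_le_one (by positivity) haff hbd).trans ?_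
    calc 1 * (s * ((√p.γ)⁻¹ * N + K * N)) * (√p.γ * √ε * p.h ε)
        = (s * √ε) * ((√p.γ * (√p.γ)⁻¹) + √p.γ * K) * p.h ε * N := by ring
      _ = (1 + √p.γ * K) * p.h ε * N := by rw [hsr, mul_inv_cancel₀ hγ.ne', one_mul]
      _ ≤ _ := by gcongr
  have n2 : ‖passageLift hc 0 (p.h ε)⁻¹‖ ≤ √p.γ * p.rate ε * N := by
    refine (norm_passageLift_le hε0 hc zero_le_one (by positivity) haff'
      (.of_forall fun _ => hncx)).trans ?_
    calc 1 * ((p.b ε)⁻¹ * N) * (√p.γ * √ε * p.h ε)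
        = √p.γ * (√ε * (p.b ε)⁻¹) * p.h ε * N := by ring
      _ ≤ √p.γ * 1 * p.rate ε * N := by gcongr
      _ = _ := by ring
  have n3 : ‖passageLift hks 1 (-(p.h ε)⁻¹)‖ ≤ √p.γ * K * p.rate ε * N := by
    have hbd : ∀ᵐ x ∂volume.restrict (p.gate ε), ‖(s : ℂ) * k x‖ ≤ s * (K * N) := by
      filter_upwards [ae_restrict_of_ae_restrict_of_subset hsub hK] with x hx
      rw [norm_mul, hns]
      gcongr
    refine (norm_passageLift_le hε0 hks zero_le_one (by positivity) haff hbd).trans ?_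
    calc 1 * (s * (K * N)) * (√p.γ * √ε * p.h ε) = (s * √ε) * (√p.γ * K) * p.h ε * N := by ring
      _ ≤ √p.γ * K * p.rate ε * N := by rw [hsr, one_mul]; gcongr
  -- The slope factor `h⁻¹` cancels the `h` from the area. The room value leaves `√ε b⁻¹`, the
  -- variation of `g₁` leaves `d`, and both are within the rate.
  have n4 : ‖passageLift herr (p.h ε)⁻¹ 0‖ ≤ √p.γ * (1 + K) * p.rate ε * N := by
    have hbd : ∀ᵐ x ∂volume.restrict (p.gate ε),
        ‖(((p.b ε)⁻¹ : ℝ) : ℂ) * g.snd - (s : ℂ) * (g.fst x - v₀)‖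
          ≤ (p.b ε)⁻¹ * N + s * (K * N * p.d ε) := by
      filter_upwards [hdiff] with x hx
      refine (norm_sub_le _ _).trans (add_le_add hncx ?_)
      rw [norm_mul, hns]
      gcongr
    refine (norm_passageLift_le hε0 herr (by positivity) (by positivity) hconst hbd).trans ?_
    calc (p.h ε)⁻¹ * ((p.b ε)⁻¹ * N + s * (K * N * p.d ε)) * (√p.γ * √ε * p.h ε)
        = (p.h ε * (p.h ε)⁻¹) * √p.γ * ((√ε * (p.b ε)⁻¹) + (s * √ε) * K * p.d ε) * N := by ring
      _ = √p.γ * ((√ε * (p.b ε)⁻¹) + K * p.d ε) * N := by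
          rw [hsr, mul_inv_cancel₀ hh.ne', one_mul, one_mul]
      _ ≤ √p.γ * (p.rate ε + K * p.rate ε) * N := by gcongr; linarith
      _ = _ := by ring
  set t : p.HEps ε := p.J ε g + trialCorrection hgs hc with ht
  have t1 := hasWeakDeriv_trial_fst hgs hks hc hε0 hsub0 hgk
  have t2 := hasWeakDeriv_trial_snd hgs hc h hε hgc
  refine ⟨t, ⟨⟨_, t1⟩, ⟨_, t2⟩⟩, ?_, ?_⟩
  · rw [ht, add_sub_cancel_left, trialCorrection]
    refine (norm_add_le _ _).trans ((add_le_add n1 n2).trans_eq ?_)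
    rw [trialConst]
    ring
  · rintro w ⟨hw1, hw2⟩
    have w1 := hasWeakDeriv_weakDeriv hw1
    have w2 := hasWeakDeriv_weakDeriv hw2
    set E := (p.formEps ε V₀).energyNorm w with hE
    have hE0 : 0 ≤ E := HForm.energyNorm_nonneg _ _
    have hEn := energyNorm_sq_ge hV hV0 w
    rw [← hE] at hEn
    set g₁ := weakDeriv (p.Omega ε) (1, 0) w
    set g₂ := weakDeriv (p.Omega ε) (0, 1) w
    have hn1 : ‖g₁‖ ≤ E := by
      refine (sq_le_sq₀ (norm_nonneg _) hE0).1 ?_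
      linarith [sq_nonneg ‖g₂‖, sq_nonneg ‖w‖]
    have hn2 : ‖g₂‖ ≤ E := by
      refine (sq_le_sq₀ (norm_nonneg _) hE0).1 ?_
      linarith [sq_nonneg ‖g₁‖, sq_nonneg ‖w‖]
    have hgate := norm_gate_le h hε w1 w2 hE0 hEn
    have hsplit : passageLift hgc (p.h ε)⁻¹ 0
        = passageLift hcv (p.h ε)⁻¹ 0 + passageLift herr (p.h ε)⁻¹ 0 :=
      passageLift_add hcv herr hgc (fun x => by ring) _ _
    -- The strip contributions cancel through adjointness. The point interaction pairs with the main
    -- part of the slope; the remaining two terms are horizontal and vertical errors in the passage.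
    have e : (p.formZero V₀).form g (p.Jtilde ε w) - (p.formEps ε V₀).form t w
        = v₀ * star ((p.γ : ℂ) * pointValue p.Omega0 (p.Jtilde ε w).fst 0
            + (((p.h ε)⁻¹ * s : ℝ) : ℂ) * ∫ z in p.passage ε, g₂ z)
          - inner ℂ g₁ (passageLift hks 1 (-(p.h ε)⁻¹))
          - inner ℂ g₂ (passageLift herr (p.h ε)⁻¹ 0) := by
      rw [formZero_apply hV, formEps_apply hV, weakDeriv_eq p.isOpen_Omega0 hgk,
        weakDeriv_eq p.isOpen_Omega0 (hasWeakDeriv_Jtilde_fst w1),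
        weakDeriv_eq (p.isOpen_Omega ε) t1, weakDeriv_eq (p.isOpen_Omega ε) t2,
        mulLp_potential_eq_J hV (ae_strip_trial hgs hc), inner_add_right, inner_J_fst, inner_J_fst,
        hsplit, inner_add_right, inner_passageLift_const]
      simp only [star_add, star_mul', Complex.star_def, Complex.conj_ofReal]
      push_cast
      ring
    rw [e]
    have m1 : ‖v₀ * star ((p.γ : ℂ) * pointValue p.Omega0 (p.Jtilde ε w).fst 0
            + (((p.h ε)⁻¹ * s : ℝ) : ℂ) * ∫ z in p.passage ε, g₂ z)‖
        ≤ (√p.γ)⁻¹ * N * (p.gateConst * p.rate ε * E) := by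
      rw [norm_mul, norm_star]
      have hG := p.gateConst_pos
      refine mul_le_mul hnv (hgate.trans ?_) (norm_nonneg _) (by positivity)
      gcongr
      -- Since `s ε = √ε`, the factor in `norm_gate_le` is `√ε b⁻¹`.
      refine le_trans (le_of_eq ?_) hbρ
      rw [← hs, hs']
      congr 1
      nth_rewrite 2 [← Real.mul_self_sqrt hε0.le]
      field_simp
    have m2 : ‖inner ℂ g₁ (passageLift hks 1 (-(p.h ε)⁻¹))‖ ≤ E * (√p.γ * K * p.rate ε * N) :=
      (norm_inner_le_norm _ _).trans (mul_le_mul hn1 n3 (norm_nonneg _) hE0)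
    have m3 : ‖inner ℂ g₂ (passageLift herr (p.h ε)⁻¹ 0)‖ ≤ E * (√p.γ * (1 + K) * p.rate ε * N) :=
      (norm_inner_le_norm _ _).trans (mul_le_mul hn2 n4 (norm_nonneg _) hE0)
    calc _ ≤ _ := (norm_sub_le _ _).trans (add_le_add ((norm_sub_le _ _).trans
            (add_le_add m1 m2)) m3)
      _ = _ := by rw [formConst]; ring

end Params

end Waveguide

namespace Waveguide

/-! ### Existence of the resolvents -/

/-- The closed graph space `V` already carries `‖u‖²` and the gradient terms; `S` supplies the
remaining terms of the form. The map `v ↦ (v, S v)` is bounded below by `1` because it keeps `v`. -/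
theorem HForm.exists_resolvent_of_submodule {H X Y : Type*} [NormedAddCommGroup H]
    [InnerProductSpace ℂ H] [CompleteSpace H] [NormedAddCommGroup X] [InnerProductSpace ℂ X]
    [CompleteSpace X] [NormedAddCommGroup Y] [InnerProductSpace ℂ Y] (a : HForm H)
    (V : Submodule ℂ X) (hV : IsClosed (V : Set X)) (ι : X →L[ℂ] H) (S : V →L[ℂ] Y)
    (hdom : a.dom = ι '' V)
    (hform : ∀ u v : V, inner ℂ v u + inner ℂ (S v) (S u)
      = a.form (ι u) (ι v) + inner ℂ (ι v) (ι u)) :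
    ∃ R : H →L[ℂ] H, a.IsResolvent R ∧ ∀ f g, inner ℂ (R f) g = inner ℂ f (R g) := by
  have : CompleteSpace V := hV.completeSpace_coe
  refine a.exists_resolvent (ι ∘L V.subtypeL)
    (((WithLp.prodContinuousLinearEquiv 2 ℂ X Y).symm : (X × Y) →L[ℂ] WithLp 2 (X × Y)) ∘L
      V.subtypeL.prod S) 1 (fun v => ?_) ?_ (fun u v => ?_)
  · rw [one_mul]
    exact Params.norm_fst_le (WithLp.toLp 2 ((v : X), S v))
  · rw [hdom]
    ext x
    simp
  · exact hform u v

section PointValue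

variable {U : Set ℝ}

theorem pointValue_add (hU : IsOpen U) (hc : U.OrdConnected) {x₀ : ℝ} (hx₀ : x₀ ∈ U)
    {f₁ k₁ f₂ k₂ : L2 U} (h₁ : HasWeakDeriv U 1 f₁ k₁) (h₂ : HasWeakDeriv U 1 f₂ k₂) :
    pointValue U (f₁ + f₂) x₀ = pointValue U f₁ x₀ + pointValue U f₂ x₀ := by
  obtain ⟨c₁, a₁, b₁⟩ := h₁.exists_continuousOn_primitive hU hc hx₀
  obtain ⟨c₂, a₂, b₂⟩ := h₂.exists_continuousOn_primitive hU hc hx₀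
  rw [pointValue_eq hU a₁ b₁ hx₀, pointValue_eq hU a₂ b₂ hx₀,
    pointValue_eq hU (a₁.add a₂) ((Lp.coeFn_add f₁ f₂).trans (b₁.add b₂)) hx₀]
  rfl

theorem pointValue_smul (hU : IsOpen U) (hc : U.OrdConnected) {x₀ : ℝ} (hx₀ : x₀ ∈ U)
    {f k : L2 U} (h : HasWeakDeriv U 1 f k) (c : ℂ) :
    pointValue U (c • f) x₀ = c * pointValue U f x₀ := by
  obtain ⟨c₁, a₁, b₁⟩ := h.exists_continuousOn_primitive hU hc hx₀
  rw [pointValue_eq hU a₁ b₁ hx₀,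
    pointValue_eq hU (a₁.const_smul c) ((Lp.coeFn_smul c f).trans (b₁.const_smul c)) hx₀]
  rfl

end PointValue

namespace Params

variable {p : Params} {ε₀ ε : ℝ} {V₀ : ℝ → ℝ}

/-- The Sobolev bound holds almost everywhere, so it holds at some `x` of the interval;
Cauchy–Schwarz for the derivative carries it from `x` to the origin, at distance less than `ε₀`. -/
theorem Admissible.norm_pointValue_sq_le (h : p.Admissible ε₀) {f k : L2 p.Omega0}
    (hfk : HasWeakDeriv p.Omega0 1 f k) :
    ‖pointValue p.Omega0 f 0‖ ^ 2 ≤ (2 * sobolevConst ε₀ + 4 * ε₀) * (‖f‖ ^ 2 + ‖k‖ ^ 2) := by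
  have hε₀ := h.pos
  have hs := h.Ioo_subset
  have : (ae (volume.restrict (Ioo (-ε₀) ε₀))).NeBot := by
    rw [ae_restrict_neBot, Real.volume_Ioo]
    simp only [ne_eq, ENNReal.ofReal_eq_zero]
    linarith
  obtain ⟨x, h1, h2, hx⟩ := ((h.ae_norm_sq_le hfk).and
    ((ae_restrict_of_ae_restrict_of_subset hs (pointValue_spec p.isOpen_Omega0
      p.ordConnected_Omega0 p.zero_mem_Omega0 hfk)).and (ae_restrict_mem measurableSet_Ioo))).exists
  have h3 := norm_intervalIntegral_sq_le (x := 0) (y := x) (memLp_Ioo_of_subset (Lp.memLp k) hs)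
    ⟨by linarith, hε₀.le⟩ (Ioo_subset_Icc_self hx)
  have h4 := setIntegral_norm_sq_le hs k
  have h5 := norm_add_sq_le_two (f x) (-∫ t in (0 : ℝ)..x, k t)
  rw [norm_neg] at h5
  have e : f x + -∫ t in (0 : ℝ)..x, k t = pointValue p.Omega0 f 0 := by rw [h2]; ring
  rw [e] at h5
  have h6 : (ε₀ - -ε₀) * ∫ t in Ioo (-ε₀) ε₀, ‖k t‖ ^ 2 ≤ (ε₀ - -ε₀) * ‖k‖ ^ 2 := by
    gcongr
    linarith
  nlinarith [sq_nonneg ‖f‖]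

/-- The space of functions in the form domain of `a_ε`, together with their gradients. -/
def domEps (p : Params) (ε : ℝ) :
    Submodule ℂ (WithLp 2 (p.HEps ε × WithLp 2 (p.HEps ε × p.HEps ε))) :=
  (weakGraph (p.Omega ε) (1, 0)).comap ((WithLp.fstL 2 ℂ _ _).prod
      (WithLp.fstL 2 ℂ _ _ ∘L WithLp.sndL 2 ℂ _ _)).toLinearMap ⊓
    (weakGraph (p.Omega ε) (0, 1)).comap ((WithLp.fstL 2 ℂ _ _).prod
      (WithLp.sndL 2 ℂ _ _ ∘L WithLp.sndL 2 ℂ _ _)).toLinearMap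

theorem isClosed_domEps (p : Params) (ε : ℝ) : 
    IsClosed (p.domEps ε : Set (WithLp 2 (p.HEps ε × WithLp 2 (p.HEps ε × p.HEps ε)))) :=
  ((isClosed_weakGraph _ _).preimage (ContinuousLinearMap.continuous _)).inter
    ((isClosed_weakGraph _ _).preimage (ContinuousLinearMap.continuous _))

theorem mem_domEps {x : WithLp 2 (p.HEps ε × WithLp 2 (p.HEps ε × p.HEps ε))} :
    x ∈ p.domEps ε ↔ HasWeakDeriv (p.Omega ε) (1, 0) x.fst x.snd.fst ∧
      HasWeakDeriv (p.Omega ε) (0, 1) x.fst x.snd.snd := Iff.rfl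

theorem exists_resolvent_formEps (hV : MemLp V₀ ⊤ (volume.restrict p.Omega0))
    (hV0 : ∀ᵐ x ∂volume.restrict p.Omega0, 0 ≤ V₀ x) :
    ∃ R : p.HEps ε →L[ℂ] p.HEps ε, (p.formEps ε V₀).IsResolvent R ∧
      ∀ f g, inner ℂ (R f) g = inner ℂ f (R g) := by
  refine HForm.exists_resolvent_of_submodule _ (p.domEps ε) (p.isClosed_domEps ε)
    (WithLp.fstL 2 ℂ _ _)
    (mulLp (memLp_sqrt (memLp_potential hV)) ∘L WithLp.fstL 2 ℂ _ _ ∘L (p.domEps ε).subtypeL)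
    ?_ ?_
  · ext u
    constructor
    · rintro ⟨⟨g₁, h₁⟩, ⟨g₂, h₂⟩⟩
      exact ⟨WithLp.toLp 2 (u, WithLp.toLp 2 (g₁, g₂)), ⟨h₁, h₂⟩, rfl⟩
    · rintro ⟨x, ⟨h₁, h₂⟩, rfl⟩
      exact ⟨⟨_, h₁⟩, ⟨_, h₂⟩⟩
  · rintro ⟨u, hu⟩ ⟨v, hv⟩
    obtain ⟨hu₁, hu₂⟩ := mem_domEps.1 hu
    obtain ⟨hv₁, hv₂⟩ := mem_domEps.1 hv
    have e1 : inner ℂ v u = inner ℂ v.fst u.fst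
      + (inner ℂ v.snd.fst u.snd.fst + inner ℂ v.snd.snd u.snd.snd) := rfl
    change inner ℂ v u + inner ℂ (mulLp (memLp_sqrt (memLp_potential hV)) v.fst)
        (mulLp (memLp_sqrt (memLp_potential hV)) u.fst)
      = (p.formEps ε V₀).form u.fst v.fst + inner ℂ v.fst u.fst
    rw [e1, formEps_apply_sqrt hV hV0, weakDeriv_eq (p.isOpen_Omega ε) hu₁,
      weakDeriv_eq (p.isOpen_Omega ε) hu₂,
      weakDeriv_eq (p.isOpen_Omega ε) hv₁,
      weakDeriv_eq (p.isOpen_Omega ε) hv₂]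
    ring

/-- The space of functions in the form domain of `a₀`, together with their derivatives. -/
def domZero (p : Params) : Submodule ℂ (WithLp 2 (p.HZero × L2 p.Omega0)) :=
  (weakGraph p.Omega0 1).comap ((WithLp.fstL 2 ℂ (L2 p.Omega0) ℂ ∘L
    WithLp.fstL 2 ℂ p.HZero (L2 p.Omega0)).prod (WithLp.sndL 2 ℂ p.HZero (L2 p.Omega0))).toLinearMap

theorem isClosed_domZero (p : Params) : 
    IsClosed (p.domZero : Set (WithLp 2 (p.HZero × L2 p.Omega0))) :=
  (isClosed_weakGraph _ _).preimage (ContinuousLinearMap.continuous _)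

theorem mem_domZero {x : WithLp 2 (p.HZero × L2 p.Omega0)} :
    x ∈ p.domZero ↔ HasWeakDeriv p.Omega0 1 x.fst.fst x.snd := Iff.rfl

/-- Evaluation at the origin as a bounded functional on the form domain of `a₀`. -/
def evalZero (h : p.Admissible ε₀) : p.domZero →L[ℂ] ℂ :=
  LinearMap.mkContinuous
    { toFun := fun x => pointValue p.Omega0 x.1.fst.fst 0
      map_add' := fun x y => pointValue_add p.isOpen_Omega0 p.ordConnected_Omega0
        p.zero_mem_Omega0 (mem_domZero.1 x.2) (mem_domZero.1 y.2)
      map_smul' := fun c x => pointValue_smul p.isOpen_Omega0 p.ordConnected_Omega0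
        p.zero_mem_Omega0 (mem_domZero.1 x.2) c }
    (√(2 * sobolevConst ε₀ + 4 * ε₀)) (fun x => by
      have hp := h.pos
      have hC := sobolevConst_pos h.pos
      have h1 := h.norm_pointValue_sq_le (mem_domZero.1 x.2)
      have h2 : ‖x‖ ^ 2 = ‖x.1.fst‖ ^ 2 + ‖x.1.snd‖ ^ 2 := WithLp.prod_norm_sq_eq_of_L2 _
      have h3 : ‖x.1.fst.fst‖ ^ 2 ≤ ‖x.1.fst‖ ^ 2 := by
        gcongr
        exact norm_fst_le _
      refine (sq_le_sq₀ (norm_nonneg _) (by positivity)).1 ?_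
      rw [mul_pow, Real.sq_sqrt (by positivity), h2]
      refine h1.trans ?_
      gcongr)

/-- The terms of `a₀` beyond the graph norm are the squares of `√V₀ u` and `√γ u(0)`. The second is
bounded on the graph space by `evalZero`. -/
theorem exists_resolvent_formZero (h : p.Admissible ε₀)
    (hV : MemLp V₀ ⊤ (volume.restrict p.Omega0))
    (hV0 : ∀ᵐ x ∂volume.restrict p.Omega0, 0 ≤ V₀ x) :
    ∃ R : p.HZero →L[ℂ] p.HZero, (p.formZero V₀).IsResolvent R ∧
      ∀ f g, inner ℂ (R f) g = inner ℂ f (R g) := by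
  refine HForm.exists_resolvent_of_submodule _ p.domZero p.isClosed_domZero
    (WithLp.fstL 2 ℂ _ _)
    (((WithLp.prodContinuousLinearEquiv 2 ℂ (L2 p.Omega0) ℂ).symm :
      (L2 p.Omega0 × ℂ) →L[ℂ] p.HZero) ∘L
      (mulLp (memLp_sqrt hV) ∘L WithLp.fstL 2 ℂ _ _ ∘L WithLp.fstL 2 ℂ _ _
        ∘L p.domZero.subtypeL).prod (((√p.γ : ℝ) : ℂ) • evalZero h)) ?_ ?_
  · ext u
    constructor
    · rintro ⟨k, hk⟩
      exact ⟨WithLp.toLp 2 (u, k), hk, rfl⟩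
    · rintro ⟨x, hx, rfl⟩
      exact ⟨_, hx⟩
  · rintro ⟨u, hu⟩ ⟨v, hv⟩
    have hu' := mem_domZero.1 hu
    have hv' := mem_domZero.1 hv
    have e1 : inner ℂ v u = inner ℂ v.fst u.fst + inner ℂ v.snd u.snd := rfl
    have e2 : inner ℂ (((√p.γ : ℝ) : ℂ) * pointValue p.Omega0 v.fst.fst 0)
          (((√p.γ : ℝ) : ℂ) * pointValue p.Omega0 u.fst.fst 0)
        = (p.γ : ℂ) * pointValue p.Omega0 u.fst.fst 0 * star (pointValue p.Omega0 v.fst.fst 0) := by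
      have hγ : ((√p.γ : ℝ) : ℂ) * ((√p.γ : ℝ) : ℂ) = p.γ := by
        rw [← Complex.ofReal_mul, Real.mul_self_sqrt p.γ_pos.le]
      rw [RCLike.inner_apply, map_mul, Complex.conj_ofReal, ← hγ, Complex.star_def]
      ring
    change inner ℂ v u + (inner ℂ (mulLp (memLp_sqrt hV) v.fst.fst)
        (mulLp (memLp_sqrt hV) u.fst.fst)
        + inner ℂ (((√p.γ : ℝ) : ℂ) * pointValue p.Omega0 v.fst.fst 0)
          (((√p.γ : ℝ) : ℂ) * pointValue p.Omega0 u.fst.fst 0))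
      = (p.formZero V₀).form u.fst v.fst + inner ℂ v.fst u.fst
    rw [e1, e2, formZero_apply_sqrt hV hV0, weakDeriv_eq p.isOpen_Omega0 hu',
      weakDeriv_eq p.isOpen_Omega0 hv']
    ring

end Params

end Waveguide

namespace Waveguide

namespace Params

variable {p : Params} {ε₀ ε : ℝ} {V₀ : ℝ → ℝ}

/-! ### Quasi-unitary equivalence -/

theorem norm_sub_J_Jtilde_le_energyNorm (h : p.Admissible ε₀) (hε : ε ∈ Ioc 0 ε₀)
    (hV : MemLp V₀ ∞ (volume.restrict p.Omega0))
    (hV0 : ∀ᵐ x ∂volume.restrict p.Omega0, 0 ≤ V₀ x) {u : p.HEps ε}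
    (hu : u ∈ (p.formEps ε V₀).dom) :
    ‖u - p.J ε (p.Jtilde ε u)‖ ≤ √(2 * p.γ * sobolevConst ε₀ + 7) * ε ^ min p.α p.β
      * (p.formEps ε V₀).energyNorm u :=
  norm_sub_J_Jtilde_le h hε (hasWeakDeriv_weakDeriv hu.1) (hasWeakDeriv_weakDeriv hu.2)
    (HForm.energyNorm_nonneg _ _) (energyNorm_sq_ge hV hV0 u)

/-- The resolvent estimates. -/
theorem norm_resolvent_comp_J_sub_le (h : p.Admissible ε₀) (hε : ε ∈ Ioc 0 ε₀)
    (hV : MemLp V₀ ∞ (volume.restrict p.Omega0))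
    (hV0 : ∀ᵐ x ∂volume.restrict p.Omega0, 0 ≤ V₀ x)
    {R₀ : p.HZero →L[ℂ] p.HZero} {R : p.HEps ε →L[ℂ] p.HEps ε}
    (hR₀ : (p.formZero V₀).IsResolvent R₀) (hR : (p.formEps ε V₀).IsResolvent R)
    (hR₀s : ∀ f g, inner ℂ (R₀ f) g = inner ℂ f (R₀ g))
    (hRs : ∀ f g, inner ℂ (R f) g = inner ℂ f (R g)) :
    ‖R ∘L p.J ε - p.J ε ∘L R₀‖ ≤ (2 * p.trialConst (slopeConst ε₀ ‖mulLp hV‖)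
        + p.formConst (slopeConst ε₀ ‖mulLp hV‖)) * p.rate ε ∧
      ‖p.Jtilde ε ∘L R - R₀ ∘L p.Jtilde ε‖ ≤ (2 * p.trialConst (slopeConst ε₀ ‖mulLp hV‖)
        + p.formConst (slopeConst ε₀ ‖mulLp hV‖)) * p.rate ε := by
  set K := slopeConst ε₀ ‖mulLp hV‖ with hKdef
  have hK : 0 ≤ K := slopeConst_nonneg _ _
  have hρ := p.rate_pos hε.1
  have hG := p.gateConst_pos
  have h1 : 0 ≤ p.trialConst K * p.rate ε := by
    have : 0 ≤ p.trialConst K := by unfold trialConst; positivity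
    positivity
  have h2 : 0 ≤ p.formConst K * p.rate ε := by
    have : 0 ≤ p.formConst K := by unfold formConst; positivity
    positivity
  have e : (2 * p.trialConst K + p.formConst K) * p.rate ε
      = 2 * (p.trialConst K * p.rate ε) + p.formConst K * p.rate ε := by ring
  rw [e]
  refine norm_resolvent_sub_le (p.formZero V₀) (p.formEps ε V₀) (p.J ε) (p.Jtilde ε) hR₀ hR hR₀s hRs
    (fun f u => inner_J f u) (fun u _ => le_trans (by positivity) (formEps_re hV hV0 u))
    (fun u _ v _ => formEps_symm hV hV0 u v)
    (fun w hw => ⟨_, hasWeakDeriv_Jtilde_fst (hasWeakDeriv_weakDeriv hw.1)⟩) h1 h2 fun f => ?_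
  have hop : (p.formZero V₀).OperatorEq (R₀ f) (f - R₀ f) := (hR₀ f (R₀ f)).1 rfl
  have hE := hR₀.energyNorm_le (fun u _ => formZero_nonneg hV hV0 u) f
  have hE2 : (p.formZero V₀).energyNorm (R₀ f) ^ 2 ≤ ‖f‖ ^ 2 := by
    have := HForm.energyNorm_nonneg (p.formZero V₀) (R₀ f)
    gcongr
  -- The energy bound for the resolvent controls `g`, `g'` and `√γ g(0)` by `‖f‖` at once, which are
  -- the inputs of the trial construction.
  have hsq := (formZero_energyNorm_sq_ge hV hV0 (R₀ f)).trans hE2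
  have hγ := p.γ_pos
  have hpv0 : 0 ≤ p.γ * ‖pointValue p.Omega0 (R₀ f).fst 0‖ ^ 2 := by positivity
  have hgn : ‖R₀ f‖ ≤ ‖f‖ := by
    refine (sq_le_sq₀ (norm_nonneg _) (norm_nonneg _)).1 ?_
    linarith [sq_nonneg ‖weakDeriv p.Omega0 1 (R₀ f).fst‖]
  have hkn : ‖weakDeriv p.Omega0 1 (R₀ f).fst‖ ≤ ‖f‖ := by
    refine (sq_le_sq₀ (norm_nonneg _) (norm_nonneg _)).1 ?_
    linarith [sq_nonneg ‖R₀ f‖]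
  have hpv : √p.γ * ‖pointValue p.Omega0 (R₀ f).fst 0‖ ≤ ‖f‖ := by
    refine (sq_le_sq₀ (by positivity) (norm_nonneg _)).1 ?_
    rw [mul_pow, Real.sq_sqrt hγ.le]
    linarith [sq_nonneg ‖R₀ f‖, sq_nonneg ‖weakDeriv p.Omega0 1 (R₀ f).fst‖]
  exact exists_trial h hε hV hV0 (hasWeakDeriv_weakDeriv hop.1) hK hgn hpv
    (ae_norm_weakDeriv_le h hV hop hgn hkn)

end Params

end Waveguide

end

/-! ### Assembly of the constants -/

theorem lemma4p6 (p : Waveguide.Params) (ε₀ : ℝ) (hε₀ : p.Admissible ε₀) :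
    ∃ C₁₈ : ℝ, 0 < C₁₈ ∧
      ∀ V₀ : ℝ → ℝ, MemLp V₀ ∞ (volume.restrict p.Omega0) →
        (∀ᵐ x ∂volume.restrict p.Omega0, 0 ≤ V₀ x) →
        (∀ ε ∈ Ioc 0 ε₀,
          (∀ f : p.HZero, p.Jtilde ε (p.J ε f) = f) ∧
          (∀ u ∈ (p.formEps ε V₀).dom,
            ‖u - p.J ε (p.Jtilde ε u)‖
              ≤ C₁₈ * ε ^ min p.α p.β * (p.formEps ε V₀).energyNorm u)) ∧
        ∃ C : ℝ, 0 < C ∧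
          (∀ ε ∈ Ioc 0 ε₀,
            Waveguide.QuasiUnitarilyEquivalent (p.formZero V₀) (p.formEps ε V₀)
              (p.J ε) (p.Jtilde ε) (C * ε ^ min p.α (min p.β (1 / 2 - p.β)))) ∧
          Tendsto (fun ε : ℝ => C * ε ^ min p.α (min p.β (1 / 2 - p.β))) (𝓝[>] 0) (𝓝 0) := by
  have hγ := p.γ_pos
  have hS := Waveguide.Params.sobolevConst_pos hε₀.pos
  set C₁₈ := √(2 * p.γ * Waveguide.Params.sobolevConst ε₀ + 7) with hC₁₈
  have hC₁₈0 : 0 < C₁₈ := Real.sqrt_pos.2 (by positivity)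
  refine ⟨C₁₈, hC₁₈0, fun V₀ hV hV0 => ⟨fun ε hε => ⟨Waveguide.Params.Jtilde_J hε.1, fun u hu =>
    Waveguide.Params.norm_sub_J_Jtilde_le_energyNorm hε₀ hε hV hV0 hu⟩, ?_⟩⟩
  set K := Waveguide.Params.slopeConst ε₀ ‖Waveguide.mulLp hV‖
  have hK : 0 ≤ K := Waveguide.Params.slopeConst_nonneg _ _
  set D := 2 * p.trialConst K + p.formConst K with hD
  have hD0 : 0 < D := by
    have hG := p.gateConst_pos
    rw [hD, Waveguide.Params.trialConst, Waveguide.Params.formConst]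
    positivity
  -- `C₁₈` pays for `u - J J̃ u` and `D` for the resolvents; only `D` depends on `V₀`.
  refine ⟨C₁₈ + D, by positivity, fun ε hε => ?_, ?_⟩
  · have hε0 := hε.1
    have hε1 : ε ≤ 1 := (hε.2.trans_lt hε₀.lt_one').le
    have hρ : 0 < ε ^ min p.α (min p.β (1 / 2 - p.β)) := Real.rpow_pos_of_pos hε0 _
    have hδ : 0 ≤ (C₁₈ + D) * ε ^ min p.α (min p.β (1 / 2 - p.β)) := by positivity
    have hDδ : D * p.rate ε ≤ (C₁₈ + D) * ε ^ min p.α (min p.β (1 / 2 - p.β)) := by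
      rw [Waveguide.Params.rate]
      gcongr
      linarith
    obtain ⟨R₀, hR₀, hR₀s⟩ := Waveguide.Params.exists_resolvent_formZero hε₀ hV hV0
    obtain ⟨R, hR, hRs⟩ := Waveguide.Params.exists_resolvent_formEps (ε := ε) hV hV0
    obtain ⟨r₁, r₂⟩ := Waveguide.Params.norm_resolvent_comp_J_sub_le hε₀ hε hV hV0 hR₀ hR hR₀s hRs
    refine ⟨hδ, ⟨fun f _ => ?_, fun u hu => ?_, fun f u => ?_⟩, R₀, R, hR₀, hR, r₁.trans hDδ,
      r₂.trans hDδ⟩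
    · rw [Waveguide.Params.Jtilde_J hε0, sub_self, norm_zero]
      exact mul_nonneg hδ (Waveguide.HForm.energyNorm_nonneg _ _)
    · refine (Waveguide.Params.norm_sub_J_Jtilde_le_energyNorm hε₀ hε hV hV0 hu).trans ?_
      -- As `ε ≤ 1`, admitting `1/2 - β` to the minimum only enlarges the power.
      have hle : ε ^ min p.α p.β ≤ ε ^ min p.α (min p.β (1 / 2 - p.β)) :=
        Real.rpow_le_rpow_of_exponent_ge hε0 hε1 (min_le_min le_rfl (min_le_left _ _))
      have := Waveguide.HForm.energyNorm_nonneg (p.formEps ε V₀) u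
      rw [← hC₁₈]
      gcongr
      linarith
    · rw [Waveguide.Params.inner_J, sub_self, norm_zero]
      positivity
  · have hpos : 0 < min p.α (min p.β (1 / 2 - p.β)) :=
      lt_min p.α_pos (lt_min p.β_pos (by linarith [p.β_lt]))
    have h1 : Tendsto (fun ε : ℝ => ε ^ min p.α (min p.β (1 / 2 - p.β))) (𝓝 0) (𝓝 0) := by
      have := (Real.continuousAt_rpow_const (0 : ℝ) _ (Or.inr hpos.le)).tendsto
      rwa [Real.zero_rpow hpos.ne'] at this
    simpa using (h1.mono_left nhdsWithin_le_nhds).const_mul (C₁₈ + D)
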